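/- **Setting.** Let $d\ge 1$ and let $\lambda$ be Lebesgue measure on $\mathbb R^d$. Let $\{Z(t),t\in\mathbb R^d\}$ be a real, jointly measurable, strictly stationary random field, and let $\mathbb N$ be a Poisson random measure on $\mathbb R^d$ with mean measure $\Lambda=r\lambda$, $r>0$, independent of $Z$ (the joint law of $Z$ and $\mathbb N$ is the product law). Let $K\subset\mathbb R^d$ be a bounded Borel set with $\lambda(K)>0$ and $\lambda(\partial K)=0$, and put $K_s=sK$. For each scale $s$ let $\hat\mu$ and $\hat\sigma\ge 0$ be measurable functions of the observed marked point configuration: for a region $sK+y$ they are evaluated on $\sum_{t_i\in sK+y}\delta_{(t_i-y,\,Z(t_i))}$, the sum being over the points $t_i$ of $\mathbb N$ in the region. Write $\hat\mu_{K_s},\hat\sigma_{K_s}$ for their values on $K_s$. Let $\mu\in\mathbb R$. Let $\tau_u=u^{\beta}\ell(u)$ for $u>0$, with $\beta\in\mathbb R$ and $\ell$ positive, measurable and slowly varying at infinity, and suppose $\tau_m=a_m/d_m$ for $m\ge1$ with positive $a_m,d_m$ such that $a_{k_i}/a_{m_i}\to0$ whenever $k_i,m_i\to\infty$ are integers with $k_i/m_i\to0$.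 **Assumptions.** There are probability laws $J,V,W$ on $\mathbb R$ with $W(\{0\})=0$ such that, as $s\to\infty$ through the reals, $$\tau_{\mathbb N(K_s)}\frac{\hat\mu_{K_s}-\mu}{\hat\sigma_{K_s}}\xrightarrow{\mathcal L}J,\qquad a_{\mathbb N(K_s)}(\hat\mu_{K_s}-\mu)\xrightarrow{\mathcal L}V,\qquad d_{\mathbb N(K_s)}\hat\sigma_{K_s}\xrightarrow{\mathcal L}W .$$ Let $c_n\in(0,1)$ with $c_n\to0$ and $c_n\delta(K_n)\to\infty$, where $\delta$ is the diameter and $n$ runs through the integers, and let $B=c_nK_n$. For $k,l\ge0$ let $$\bar\alpha_Z(k;l)=\sup\bigl|\mathbb P(A_1\cap A_2)-\mathbb P(A_1)\mathbb P(A_2)\bigr|,$$ the supremum being over compact convex $E_1\subset\mathbb R^d$ with $\lambda(E_1)\le l$, over translates $E_2=E_1+h$ at distance at least $k$ from $E_1$, and over events $A_i\in\sigma(Z(t),t\in E_i)$. Assume the mixing condition $$\frac1{\lambda(K_n)}\int_0^{\delta(K_n)}k^{d-1}\,\bar\alpha_Z\bigl(k;\lambda(\operatorname{conv}B)\bigr)\,dk\longrightarrow0$$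 (for convex $K$, $\lambda(\operatorname{conv}B)=\lambda(B)$). **The estimator.** Let $K_n(1-c_n)=\{y\in K_n: B+y\subset K_n\}$, let $\hat\mu_{K_n,B,y},\hat\sigma_{K_n,B,y}$ be the statistics evaluated on $B+y$, and let $$L_{K_n,B}(x)=\frac1{\lambda(K_n(1-c_n))}\int_{K_n(1-c_n)}\mathbf 1\Bigl\{\tau_{\mathbb N(B+y)}\,\frac{\hat\mu_{K_n,B,y}-\hat\mu_{K_n}}{\hat\sigma_{K_n,B,y}}\le x\Bigr\}\,dy,\qquad c_{K_n,B}(q)=\inf\{x:L_{K_n,B}(x)\ge q\}.$$ (A ratio with zero denominator is set to $0$.) Write $J(x)$ for the distribution function of $J$. **Conclusions**, as $n\to\infty$: (i) $L_{K_n,B}(x)\to J(x)$ in probability for every continuity point $x$ of $J(\cdot)$; (ii) if $J(\cdot)$ is continuous, then $\sup_x|L_{K_n,B}(x)-J(x)|\to0$ in probability; (iii) if $0<t<1$ and $J(\cdot)$ is continuous at both ends $\inf\{x:J(x)\ge1-t\}$ and $\sup\{x:J(x)\le1-t\}$ of its set of $(1-t)$-quantiles, then $$\mathbb P\Bigl\{\tau_{\mathbb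 N(K_n)}\frac{\hat\mu_{K_n}-\mu}{\hat\sigma_{K_n}}\le c_{K_n,B}(1-t)\Bigr\}\to1-t,\qquad \mathbb P\Bigl\{\tau_{\Lambda(K_n)}\frac{\hat\mu_{K_n}-\mu}{\hat\sigma_{K_n}}\le c_{K_n,B}(1-t)\Bigr\}\to1-t,$$ and the interval $[\hat\mu_{K_n}-\hat\sigma_{K_n}\tau_{\mathbb N(K_n)}^{-1}c_{K_n,B}(1-t),\infty)$ contains $\mu$ with probability tending to $1-t$. -/

import Mathlib

open MeasureTheory ProbabilityTheory Filter Topology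
open scoped NNReal ENNReal Pointwise

noncomputable section

namespace PoissonSubsampling

/-- `N` is a Poisson random measure with mean measure `Λ`: a random measure, independently
scattered over disjoint Borel sets, with `N A ∼ Poisson (Λ A)` whenever `Λ A < ∞`. -/
structure IsPoissonRandomMeasure {E Ω : Type*} [MeasurableSpace E] [MeasurableSpace Ω]
    (Λ : Measure E) (N : Ω → Measure E) (P : Measure Ω) : Prop where
  measurable : Measurable N
  poisson : ∀ A : Set E, MeasurableSet A → Λ A ≠ ∞ →
    HasLaw (fun ω => N ω A) ((poissonMeasure (Λ A).toNNReal).map (Nat.cast : ℕ → ℝ≥0∞)) P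
  indep : ∀ (k : ℕ) (A : Fin k → Set E), (∀ i, MeasurableSet (A i)) →
    Pairwise (fun i j => Disjoint (A i) (A j)) → iIndepFun (fun i ω => N ω (A i)) P

/-- Strict stationarity: the law of the whole field is invariant under translations. -/
def IsStationary {E Ω : Type*} [Add E] [MeasurableSpace Ω]
    (P : Measure Ω) (Z : E → Ω → ℝ) : Prop :=
  ∀ h : E, P.map (fun ω (t : E) => Z (t + h) ω) = P.map (fun ω (t : E) => Z t ω)

/-- The sigma-algebra generated by the values `Z t`, `t ∈ A`. -/
abbrev fieldSigma {E Ω : Type*} (Z : E → Ω → ℝ) (A : Set E) : MeasurableSpace Ω :=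
  ⨆ t ∈ A, MeasurableSpace.comap (Z t) inferInstance

/-- The strong mixing coefficient of the field `Z` at distance `k` for pairs of translated compact
convex sets of volume at most `l`:
the supremum of `|P (A₁ ∩ A₂) - P A₁ * P A₂|` over compact convex `E₁` of volume at most `l`, over
vectors `h` such that `E₁` and `E₁ + h` are at distance at least `k`, and over events `A₁`, `A₂`
generated by `Z` on `E₁` and on `E₁ + h`. -/
def mixingCoeff {d : ℕ} {Ω : Type*} [MeasurableSpace Ω] (P : Measure Ω)
    (Z : EuclideanSpace ℝ (Fin d) → Ω → ℝ) (k l : ℝ) : ℝ :=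
  sSup {x : ℝ | ∃ (E₁ : Set (EuclideanSpace ℝ (Fin d))) (h : EuclideanSpace ℝ (Fin d))
    (A₁ A₂ : Set Ω),
    IsCompact E₁ ∧ Convex ℝ E₁ ∧ volume.real E₁ ≤ l ∧
    (∀ u ∈ E₁, ∀ v ∈ h +ᵥ E₁, k ≤ dist u v) ∧
    MeasurableSet[fieldSigma Z E₁] A₁ ∧ MeasurableSet[fieldSigma Z (h +ᵥ E₁)] A₂ ∧
    x = |P.real (A₁ ∩ A₂) - P.real A₁ * P.real A₂|}

/-- Slow variation at infinity of a positive measurable function. -/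
structure IsSlowlyVarying (L : ℝ → ℝ) : Prop where
  measurable : Measurable L
  pos : ∀ u : ℝ, 0 < u → 0 < L u
  tendsto : ∀ b : ℝ, 0 < b → Tendsto (fun u => L (b * u) / L u) atTop (𝓝 1)

/-- Convergence in law of the real random variables `T s` to the law `Q` as `s → ∞`. -/
def ConvergesInLaw {Ω : Type*} [MeasurableSpace Ω] (P : Measure Ω) [IsProbabilityMeasure P]
    (T : ℝ → Ω → ℝ) (Q : Measure ℝ) [IsProbabilityMeasure Q] : Prop :=
  TendstoInDistribution T atTop (id : ℝ → ℝ) (fun _ => P) Q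

/-- The number of points of `ν` in `A`. A Poisson random measure takes almost surely a natural
number as value on a given bounded set, and the floor only moves that value to the type `ℕ`. -/
def pointCount {E : Type*} [MeasurableSpace E] (ν : Measure E) (A : Set E) : ℕ :=
  ⌊(ν A).toReal⌋₊

/-- The region `s • K + y`. -/
def region {d : ℕ} (K : Set (EuclideanSpace ℝ (Fin d))) (s : ℝ)
    (y : EuclideanSpace ℝ (Fin d)) : Set (EuclideanSpace ℝ (Fin d)) :=
  y +ᵥ s • K

/-- The marked point configuration `∑ δ_(tᵢ - y, z tᵢ)`, the sum being over the points `tᵢ` of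
`ν` in the region `s • K + y`: the data observed there, with locations taken relative to `y`. -/
def markedData {d : ℕ} (K : Set (EuclideanSpace ℝ (Fin d))) (ν : Measure (EuclideanSpace ℝ (Fin d)))
    (z : EuclideanSpace ℝ (Fin d) → ℝ) (s : ℝ) (y : EuclideanSpace ℝ (Fin d)) :
    Measure (EuclideanSpace ℝ (Fin d) × ℝ) :=
  (ν.restrict (region K s y)).map (fun t => (t - y, z t))

/-- The locations `y ∈ A` for which the translated block `B + y` lies in `A`. -/
def blockLocations {d : ℕ} (A B : Set (EuclideanSpace ℝ (Fin d))) :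
    Set (EuclideanSpace ℝ (Fin d)) :=
  {y | y ∈ A ∧ y +ᵥ B ⊆ A}

/-- The statistic `g` (one function `g s` of the marked configuration for every scale `s`)
evaluated on the data in the region `s • K + y`. The first coordinate of `ω` carries the field,
the second one the point process. -/
def statOn {d : ℕ} {Ω₁ Ω₂ : Type*} (K : Set (EuclideanSpace ℝ (Fin d)))
    (Z : EuclideanSpace ℝ (Fin d) → Ω₁ → ℝ) (N : Ω₂ → Measure (EuclideanSpace ℝ (Fin d)))
    (g : ℝ → Measure (EuclideanSpace ℝ (Fin d) × ℝ) → ℝ)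
    (s : ℝ) (y : EuclideanSpace ℝ (Fin d)) (ω : Ω₁ × Ω₂) : ℝ :=
  g s (markedData K (N ω.2) (fun t => Z t ω.1) s y)

/-- The number of observations in the region `s • K + y`. -/
def countOn {d : ℕ} {Ω₁ Ω₂ : Type*} (K : Set (EuclideanSpace ℝ (Fin d)))
    (N : Ω₂ → Measure (EuclideanSpace ℝ (Fin d)))
    (s : ℝ) (y : EuclideanSpace ℝ (Fin d)) (ω : Ω₁ × Ω₂) : ℕ :=
  pointCount (N ω.2) (region K s y)

/-- The self-normalized subsampling distribution estimator at `x`, built on the region `n • K` and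
the block `c • (n • K) = (c * n) • K`: the proportion of block locations `y` with
`τ_{N(B+y)} (μ̂_{B+y} - μ̂_{K_n}) / σ̂_{B+y} ≤ x`. -/
def subsamplingDist {d : ℕ} {Ω₁ Ω₂ : Type*} (K : Set (EuclideanSpace ℝ (Fin d)))
    (Z : EuclideanSpace ℝ (Fin d) → Ω₁ → ℝ) (N : Ω₂ → Measure (EuclideanSpace ℝ (Fin d)))
    (muHat sigmaHat : ℝ → Measure (EuclideanSpace ℝ (Fin d) × ℝ) → ℝ) (τ : ℝ → ℝ)
    (n : ℕ) (c : ℝ) (x : ℝ) (ω : Ω₁ × Ω₂) : ℝ :=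
  (volume.real (blockLocations ((n : ℝ) • K) (c • ((n : ℝ) • K))))⁻¹ *
    ∫ y in blockLocations ((n : ℝ) • K) (c • ((n : ℝ) • K)),
      Set.indicator
        {y | τ (countOn K N (c * n) y ω) *
          ((statOn K Z N muHat (c * n) y ω - statOn K Z N muHat n 0 ω) /
            statOn K Z N sigmaHat (c * n) y ω) ≤ x}
        (fun _ => (1 : ℝ)) y

/-- The quantile `inf {x : L x ≥ q}` of the subsampling distribution estimator. -/
def subsamplingQuantile {d : ℕ} {Ω₁ Ω₂ : Type*} (K : Set (EuclideanSpace ℝ (Fin d)))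
    (Z : EuclideanSpace ℝ (Fin d) → Ω₁ → ℝ) (N : Ω₂ → Measure (EuclideanSpace ℝ (Fin d)))
    (muHat sigmaHat : ℝ → Measure (EuclideanSpace ℝ (Fin d) × ℝ) → ℝ) (τ : ℝ → ℝ)
    (n : ℕ) (c : ℝ) (q : ℝ) (ω : Ω₁ × Ω₂) : ℝ :=
  sInf {x : ℝ | q ≤ subsamplingDist K Z N muHat sigmaHat τ n c x ω}

end PoissonSubsampling

end

/-!
The estimator is an average over block locations `y` of indicators of
`τ (μ̂_{B+y} - μ̂_{K_n}) / σ̂_{B+y} ≤ x`. It is compared with the same average with the true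
parameter `μ` in place of `μ̂_{K_n}`.

*The ideal average.* Given the point process, an event about the marked configuration in `B + y` is
an event of the field on the convex hull of `B + y`, and the parts of the point process in disjoint
blocks are independent. Hence the covariance of the indicators at `y` and `y'` is at most the mixing
coefficient of the field at distance `‖y - y'‖ - δ(B)` (`abs_cov_localData_le`). Bounding the
covariances at distances up to `2 δ(B)` trivially and integrating the others in polar coordinates,
Chebyshev's inequality shows that the average deviates from its mean by an amount controlled by
`c_n ^ d` and the mixing integral (`measureReal_abs_average_sub_le`). By stationarity of the field
and of the Poisson process the mean is the probability that the studentized statistic on the block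
at the origin is at most `x` (`measureReal_localData_eq`), which converges to `J(x)`.

*The centring.* With `τ = a / b`, replacing `μ̂_{K_n}` by `μ` changes the statistic on `B + y` by
`a_{N(B+y)} / a_{N(K_n)}` times the tight quantity `a_{N(K_n)} (μ̂_{K_n} - μ)`, divided by
`b_{N(B+y)} σ̂_{B+y}`, which is bounded away from zero in probability since `W {0} = 0`. The ratio of
the rates vanishes because the counts concentrate around their means, whose ratio is `c_n ^ d → 0`;
the bound is uniform in `y` (`eventually_measureReal_studentized_sub_le`).

*Conclusions.* Together with `λ(K_n (1 - c_n)) / λ(K_n) → 1`, which uses `λ(∂K) = 0`, this gives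
consistency at continuity points (`tendstoInMeasure_subsampling`). Uniform consistency is Pólya's
argument, and coverage follows since the estimated quantile is trapped, with probability tending to
one, between continuity points of `J` around its interval of quantiles
(`tendsto_measureReal_le_quantile`). The rate may be evaluated at the mean number of points by the
uniform convergence theorem for slowly varying functions (`tendstoInMeasure_rate_sub`). The
one-sided interval contains `μ` exactly when the statistic is at most the quantile, as soon as there
are points and the scale estimate is positive.

*Measurability.* A Poisson random measure as a map into measures need not be finite on bounded sets
for every outcome, while the joint measurability of the marked configuration in location and outcome
rests on finiteness. All integrals over locations therefore use the version `localData`, which is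
measurable and almost surely agrees with the marked configuration at all locations at once.
-/

namespace PoissonSubsampling

/-! ### Measurability of images of random measures -/

/-- A kernel of finite measures without a uniform bound is s-finite: cut the parameter space
according to the integer part of the total mass. -/
theorem isSFiniteKernel_of_isFiniteMeasure {α β : Type*} [MeasurableSpace α] [MeasurableSpace β]
    (κ : Kernel α β) (h : ∀ a, IsFiniteMeasure (κ a)) : IsSFiniteKernel κ := by
  classical
  let s : ℕ → Set α := fun n => {a | κ a Set.univ ∈ Set.Ico (n : ℝ≥0∞) (n + 1)}
  have hs : ∀ n, MeasurableSet (s n) := fun n =>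
    (Kernel.measurable_coe κ MeasurableSet.univ) measurableSet_Ico
  refine ⟨fun n => Kernel.piecewise (hs n) κ 0, fun n => ?_, ?_⟩
  · refine ⟨⟨n + 1, by finiteness, fun a => ?_⟩⟩
    rw [Kernel.piecewise_apply]
    split_ifs with ha
    · exact ha.2.le
    · simp
  · ext a A hA
    rw [Kernel.sum_apply' _ _ hA]
    set m : ℕ := ⌊(κ a Set.univ).toReal⌋₊ with hm
    have key : ∀ n, a ∈ s n ↔ n = m := by
      intro n
      have hfin : κ a Set.univ ≠ ∞ := measure_ne_top _ _
      have h1 : κ a Set.univ = ENNReal.ofReal (κ a Set.univ).toReal :=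
        (ENNReal.ofReal_toReal hfin).symm
      have h2 : (n : ℝ≥0∞) ≤ κ a Set.univ ↔ (n : ℝ) ≤ (κ a Set.univ).toReal := by
        rw [← ENNReal.toReal_le_toReal (by simp) hfin]; simp
      have h3 : κ a Set.univ < (n : ℝ≥0∞) + 1 ↔ (κ a Set.univ).toReal < (n : ℝ) + 1 := by
        rw [← ENNReal.toReal_lt_toReal hfin (by finiteness)]
        norm_cast
      change (n : ℝ≥0∞) ≤ κ a Set.univ ∧ κ a Set.univ < (n : ℝ≥0∞) + 1 ↔ n = m
      rw [h2, h3, hm, eq_comm, Nat.floor_eq_iff ENNReal.toReal_nonneg]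
    rw [tsum_eq_single m]
    · rw [Kernel.piecewise_apply, if_pos ((key m).2 rfl)]
    · intro n hn
      rw [Kernel.piecewise_apply, if_neg (fun h => hn ((key n).1 h))]
      simp

/-- The image, under a map that may depend on the parameter, of the restriction of a random finite
measure to a parameter-dependent set is again a measurable function of the parameter. -/
theorem measurable_map_restrict {α E F : Type*} [MeasurableSpace α] [MeasurableSpace E]
    [MeasurableSpace F] {N : α → Measure E} (hN : Measurable N) (hfin : ∀ a, IsFiniteMeasure (N a))
    {R : Set (α × E)} (hR : MeasurableSet R) {f : α × E → F} (hf : Measurable f) :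
    Measurable fun a => ((N a).restrict {t | (a, t) ∈ R}).map fun t => f (a, t) := by
  let κ : Kernel α E := ⟨N, hN⟩
  have : IsSFiniteKernel κ := isSFiniteKernel_of_isFiniteMeasure κ hfin
  refine Measure.measurable_of_measurable_coe _ fun C hC => ?_
  have h := Kernel.measurable_kernel_prodMk_left (κ := κ) ((hf hC).inter hR)
  convert h using 1
  ext a
  have hfa : Measurable fun t => f (a, t) := hf.comp measurable_prodMk_left
  rw [Measure.map_apply hfa hC, Measure.restrict_apply (hfa hC)]
  rfl

/-! ### Integer-valued measures -/

/-- A finite measure that takes integer values on a generating algebra takes integer values on all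
measurable sets: the sets of integer measure form a Dynkin class. -/
theorem exists_nat_measure_of_generateFrom {E : Type*} {m : MeasurableSpace E} (ν : Measure E)
    [IsFiniteMeasure ν] {S : Set (Set E)} (hS : IsSetAlgebra S)
    (hm : m = MeasurableSpace.generateFrom S) (h : ∀ A ∈ S, ∃ n : ℕ, ν A = n)
    {A : Set E} (hA : MeasurableSet A) : ∃ n : ℕ, ν A = n := by
  obtain ⟨M, hM⟩ := h _ hS.univ_mem
  refine MeasurableSpace.induction_on_inter (C := fun A _ => ∃ n : ℕ, ν A = n) hm
    (fun s hs t ht _ => hS.inter_mem hs ht) ⟨0, by simp⟩ h ?_ ?_ A hA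
  · rintro t ht ⟨n, hn⟩
    refine ⟨M - n, ?_⟩
    rw [measure_compl ht (measure_ne_top _ _), hM, hn, ENNReal.natCast_sub]
  · intro f hd hf hn
    choose k hk using hn
    have hsum : ∑' i, ν (f i) = ν (⋃ i, f i) := (measure_iUnion hd hf).symm
    have hne : ∑' i, ((k i : ℕ) : ℝ≥0∞) ≠ ∞ := by
      simp_rw [← hk]; rw [hsum]; exact measure_ne_top _ _
    -- A convergent series of natural numbers has finitely many nonzero terms.
    have hfs : (Function.support k).Finite := by
      have := ENNReal.finite_const_le_of_tsum_ne_top hne one_ne_zero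
      refine this.subset fun i hi => ?_
      have : 1 ≤ k i := Nat.one_le_iff_ne_zero.2 hi
      simpa using (by exact_mod_cast this : (1 : ℝ≥0∞) ≤ k i)
    refine ⟨∑ i ∈ hfs.toFinset, k i, ?_⟩
    rw [← hsum, tsum_eq_sum (s := hfs.toFinset)]
    · simp [hk]
    · intro i hi
      have : k i = 0 := by simpa using hi
      simp [hk, this]

/-- A finite integer-valued measure is carried by a finite set. -/
theorem exists_finset_measure_compl_eq_zero {E : Type*} [MetricSpace E]
    [SecondCountableTopology E] [MeasurableSpace E] [BorelSpace E] (ν : Measure E)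
    [IsFiniteMeasure ν] (h : ∀ A, MeasurableSet A → ∃ n : ℕ, ν A = n) :
    ∃ S : Finset E, ν (↑S)ᶜ = 0 := by
  have hfin : {x | (1 : ℝ≥0∞) ≤ ν {x}}.Finite :=
    Measure.finite_const_le_meas_of_disjoint_iUnion ν one_pos
      (fun x => MeasurableSet.singleton x)
      (fun x y hxy => Set.disjoint_singleton.2 hxy) (measure_ne_top _ _)
  refine ⟨hfin.toFinset, ?_⟩
  rw [hfin.coe_toFinset]
  -- Off the atoms every point has a neighbourhood of measure less than one, hence of measure zero.
  refine measure_null_of_locally_null _ fun x hx => ?_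
  have hx0 : ν {x} < 1 := not_le.1 hx
  have : ∃ u ∈ 𝓝 x, IsOpen u ∧ ν u < 1 := by
    obtain ⟨u, hxu, huo, hu⟩ := Set.exists_isOpen_lt_of_lt (μ := ν) {x} 1 hx0
    exact ⟨u, huo.mem_nhds (by simpa using hxu), huo, hu⟩
  obtain ⟨u, hu, huo, hlt⟩ := this
  refine ⟨u, mem_nhdsWithin_of_mem_nhds hu, ?_⟩
  obtain ⟨n, hn⟩ := h u huo.measurableSet
  rw [hn] at hlt ⊢
  have : n < 1 := by exact_mod_cast hlt
  simp; omega

/-! ### Independently scattered random measures -/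

/-- The random measure `M` takes independent values on disjoint measurable sets. -/
def IndependentlyScattered {E Ω : Type*} [MeasurableSpace E] [MeasurableSpace Ω]
    (M : Ω → Measure E) (P : Measure Ω) : Prop :=
  ∀ (k : ℕ) (A : Fin k → Set E), (∀ i, MeasurableSet (A i)) →
    Pairwise (fun i j => Disjoint (A i) (A j)) → iIndepFun (fun i ω => M ω (A i)) P

/-- The part of the space on which, among the sets `A i` with `i ∈ I`, exactly those with `i ∈ J`
are present. For `J` running through the subsets of `I` these parts form a partition. -/
def vennPart {ι E : Type*} (A : ι → Set E) (I J : Finset ι) : Set E :=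
  {x | ∀ i ∈ I, x ∈ A i ↔ i ∈ J}

theorem disjoint_vennPart {ι E : Type*} (A : ι → Set E) {I J J' : Finset ι} (hJ : J ⊆ I)
    (hJ' : J' ⊆ I) (h : J ≠ J') : Disjoint (vennPart A I J) (vennPart A I J') := by
  rw [Set.disjoint_left]
  intro x hx hx'
  refine h (Finset.ext fun i => ⟨fun hi => ?_, fun hi => ?_⟩)
  · exact (hx' i (hJ hi)).1 ((hx i (hJ hi)).2 hi)
  · exact (hx i (hJ' hi)).1 ((hx' i (hJ' hi)).2 hi)

section Scattered

variable {E Ω ι : Type*} [MeasurableSpace E] [MeasurableSpace Ω]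

theorem IndependentlyScattered.iIndepFun {M : Ω → Measure E} {P : Measure Ω}
    (hM : IndependentlyScattered M P) {κ : Type*} [Finite κ] (A : κ → Set E)
    (hA : ∀ i, MeasurableSet (A i)) (hd : Pairwise (fun i j => Disjoint (A i) (A j))) :
    iIndepFun (fun i ω => M ω (A i)) P := by
  have := Fintype.ofFinite κ
  let e := Fintype.equivFin κ
  have h := hM _ (fun i => A (e.symm i)) (fun i => hA _)
    (fun i j hij => hd (e.symm.injective.ne hij))
  have h2 := h.precomp e.injective
  simpa using h2

theorem measurableSet_vennPart {A : ι → Set E} (hA : ∀ i, MeasurableSet (A i)) (I J : Finset ι) :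
    MeasurableSet (vennPart A I J) := by
  have : vennPart A I J = ⋂ i ∈ I, {x | x ∈ A i ↔ i ∈ J} := by
    ext x; simp [vennPart]
  rw [this]
  refine Finset.measurableSet_biInter _ fun i _ => ?_
  by_cases h : i ∈ J
  · simpa [h] using hA i
  · simp only [h, iff_false]
    exact (hA i).compl

theorem measure_eq_sum_vennPart [DecidableEq ι] (ν : Measure E) {A : ι → Set E}
    (hA : ∀ i, MeasurableSet (A i)) {I : Finset ι} {i : ι} (hi : i ∈ I)
    (D : Set E) (hD : MeasurableSet D) :
    ν (A i ∩ D) = ∑ J : I.powerset, if i ∈ J.1 then ν (vennPart A I J ∩ D) else 0 := by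
  classical
  rw [← Finset.sum_filter, ← measure_biUnion_finset]
  · congr 1
    ext x
    simp only [Set.mem_inter_iff, Set.mem_iUnion, Finset.mem_filter, Finset.mem_univ, true_and,
      exists_prop]
    constructor
    · rintro ⟨hx, hxD⟩
      refine ⟨⟨I.filter (fun j => x ∈ A j), by simp⟩, by simp [hi, hx], ?_, hxD⟩
      intro j hj
      simp [hj]
    · rintro ⟨J, hJ, hx, hxD⟩
      exact ⟨(hx i hi).2 hJ, hxD⟩
  · intro J _ J' _ h
    exact ((disjoint_vennPart A (Finset.mem_powerset.1 J.2) (Finset.mem_powerset.1 J'.2)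
      (fun h' => h (Subtype.ext h'))).inter_left D).inter_right D
  · intro J _
    exact (measurableSet_vennPart hA I J).inter hD

theorem measurable_measure_pi {M : Ω → Measure E} (hM : Measurable M) {κ : Type*} {A : κ → Set E}
    (hA : ∀ i, MeasurableSet (A i)) : Measurable fun ω i => M ω (A i) :=
  measurable_pi_lambda _ fun i => (Measure.measurable_coe (hA i)).comp hM

/-- The measurable structure on the space of measures is induced by the values on all measurable
sets. -/
theorem measurableSpace_measure_eq_comap :
    (Measure.instMeasurableSpace : MeasurableSpace (Measure E)) =
      MeasurableSpace.comap (fun (ν : Measure E) (A : {A : Set E // MeasurableSet A}) => ν A.1)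
        MeasurableSpace.pi := by
  unfold Measure.instMeasurableSpace MeasurableSpace.pi
  simp only [MeasurableSpace.comap_iSup, MeasurableSpace.comap_comp, Function.comp_def,
    iSup_subtype]
  rfl

/-- The law of an independently scattered random measure is determined by its one-dimensional
marginals. -/
theorem map_eq_map_of_independentlyScattered {P : Measure Ω} [IsProbabilityMeasure P]
    {M₁ M₂ : Ω → Measure E} (hm₁ : Measurable M₁) (hm₂ : Measurable M₂)
    (hM₁ : IndependentlyScattered M₁ P) (hM₂ : IndependentlyScattered M₂ P)
    (h : ∀ A, MeasurableSet A → P.map (fun ω => M₁ ω A) = P.map (fun ω => M₂ ω A)) :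
    P.map M₁ = P.map M₂ := by
  classical
  let ι := {A : Set E // MeasurableSet A}
  let Φ : Measure E → ι → ℝ≥0∞ := fun ν A => ν A.1
  have hΦ : Measurable Φ := measurable_pi_lambda _ fun A => Measure.measurable_coe A.2
  have key : (P.map M₁).map Φ = (P.map M₂).map Φ := by
    refine IsProjectiveLimit.unique (P := fun I => ((P.map M₁).map Φ).map I.restrict)
      (fun I => rfl) (fun I => ?_)
    have hA : ∀ i : ι, MeasurableSet i.1 := fun i => i.2
    let B : I.powerset → Set E := fun J => vennPart (Subtype.val : ι → Set E) I J.1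
    have hB : ∀ J, MeasurableSet (B J) := fun J => measurableSet_vennPart hA I _
    have hBd : Pairwise (fun i j => Disjoint (B i) (B j)) := fun J J' hJ =>
      disjoint_vennPart _ (Finset.mem_powerset.1 J.2) (Finset.mem_powerset.1 J'.2)
        (fun h' => hJ (Subtype.ext h'))
    -- The values on the sets of `I` are sums of the values on the parts of the partition.
    let F : (I.powerset → ℝ≥0∞) → (I → ℝ≥0∞) := fun v i => ∑ J, if i.1 ∈ J.1 then v J else 0
    have hF : Measurable F := by
      refine measurable_pi_lambda _ fun i => Finset.measurable_sum _ fun J _ => ?_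
      split_ifs
      · exact measurable_pi_apply J
      · exact measurable_const
    have hfac : ∀ M : Ω → Measure E, Measurable M → ((P.map M).map Φ).map I.restrict =
        (P.map fun ω J => M ω (B J)).map F := by
      intro M hM
      rw [Measure.map_map (by fun_prop) hΦ, Measure.map_map (by fun_prop) hM,
        Measure.map_map hF (measurable_measure_pi hM hB)]
      congr 1
      ext ω i
      have := measure_eq_sum_vennPart (M ω) hA i.2 Set.univ MeasurableSet.univ
      simpa [F, Φ, B] using this
    rw [hfac M₂ hm₂]
    change _ = ((P.map M₁).map Φ).map I.restrict
    rw [hfac M₁ hm₁]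
    congr 1
    have hpi : ∀ M : Ω → Measure E, Measurable M → IndependentlyScattered M P →
        P.map (fun ω J => M ω (B J)) = Measure.pi fun J => P.map fun ω => M ω (B J) :=
      fun M hm hM => (iIndepFun_iff_map_fun_eq_pi_map fun J =>
        ((Measure.measurable_coe (hB J)).comp hm).aemeasurable).1 (hM.iIndepFun B hB hBd)
    rw [hpi M₁ hm₁ hM₁, hpi M₂ hm₂ hM₂]
    congr 1
    ext1 J
    exact (h _ (hB J)).symm
  ext C hC
  have hC' := hC
  rw [measurableSpace_measure_eq_comap] at hC'
  obtain ⟨C', hC', rfl⟩ := hC'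
  rw [← Measure.map_apply hΦ hC', key, Measure.map_apply hΦ hC']

/-- The restrictions of an independently scattered random measure to two disjoint sets are
independent as random measures. -/
theorem IndependentlyScattered.indepFun_restrict {P : Measure Ω} [IsProbabilityMeasure P]
    {M : Ω → Measure E} (hm : Measurable M) (hM : IndependentlyScattered M P)
    {D D' : Set E} (hD : MeasurableSet D) (hD' : MeasurableSet D') (hdisj : Disjoint D D') :
    IndepFun (fun ω => (M ω).restrict D) (fun ω => (M ω).restrict D') P := by
  classical
  let ι := {A : Set E // MeasurableSet A}
  have hA : ∀ i : ι, MeasurableSet i.1 := fun i => i.2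
  let v : Set E → (I : Finset ι) → Ω → (I → ℝ≥0∞) := fun D I ω i => M ω (i.1.1 ∩ D)
  have hv : ∀ D, MeasurableSet D → ∀ I, Measurable (v D I) := fun D hD I =>
    measurable_measure_pi hm fun i : I => (hA i.1).inter hD
  let m : Set E → Finset ι → MeasurableSpace Ω := fun D I =>
    MeasurableSpace.comap (v D I) inferInstance
  have hmle : ∀ D, MeasurableSet D → ∀ I, m D I ≤ ‹MeasurableSpace Ω› := fun D hD I =>
    (hv D hD I).comap_le
  have hdir : ∀ D, Directed (fun x1 x2 => x1 ≤ x2) (m D) := by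
    intro D I I'
    have hsub : ∀ I I' : Finset ι, I ⊆ I' → m D I ≤ m D I' := by
      intro I I' h
      have : v D I = (fun w : I' → ℝ≥0∞ => fun i : I => w ⟨i.1, h i.2⟩) ∘ v D I' := rfl
      change MeasurableSpace.comap _ _ ≤ _
      rw [this, ← MeasurableSpace.comap_comp]
      refine MeasurableSpace.comap_mono (Measurable.comap_le ?_)
      exact measurable_pi_lambda _ fun i => measurable_pi_apply _
    exact ⟨I ∪ I', hsub _ _ Finset.subset_union_left, hsub _ _ Finset.subset_union_right⟩
  have hgen : ∀ D, MeasurableSet D →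
      MeasurableSpace.comap (fun ω => (M ω).restrict D) inferInstance ≤ ⨆ I, m D I := by
    intro D hD
    rw [← measurable_iff_comap_le]
    refine @Measure.measurable_of_measurable_coe _ _ _ (⨆ I, m D I) _ fun A hA => ?_
    have h1 : Measurable[m D {⟨A, hA⟩}] fun ω => M ω (A ∩ D) := by
      have h2 : Measurable[m D {⟨A, hA⟩}] (v D {⟨A, hA⟩}) := comap_measurable _
      exact (measurable_pi_apply (⟨⟨A, hA⟩, by simp⟩ : ({⟨A, hA⟩} : Finset ι))).comp h2
    simp_rw [Measure.restrict_apply hA]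
    exact h1.mono (le_iSup (m D) _) le_rfl
  -- For finitely many sets, cut `D` and `D'` into disjoint parts and group the independent values.
  have hfin : ∀ I I', Indep (m D I) (m D' I') P := by
    intro I I'
    change Indep (MeasurableSpace.comap _ _) (MeasurableSpace.comap _ _) P
    rw [← IndepFun_iff_Indep]
    let B : I.powerset ⊕ I'.powerset → Set E :=
      Sum.elim (fun J => vennPart (Subtype.val : ι → Set E) I J.1 ∩ D)
        (fun J => vennPart (Subtype.val : ι → Set E) I' J.1 ∩ D')
    have hB : ∀ J, MeasurableSet (B J) := by
      rintro (J | J)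
      · exact (measurableSet_vennPart hA I _).inter hD
      · exact (measurableSet_vennPart hA I' _).inter hD'
    have hBd : Pairwise (fun i j => Disjoint (B i) (B j)) := by
      rintro (J | J) (J' | J') hJ
      · exact ((disjoint_vennPart _ (Finset.mem_powerset.1 J.2) (Finset.mem_powerset.1 J'.2)
          (fun h' => hJ (congrArg _ (Subtype.ext h')))).inter_left D).inter_right D
      · exact (hdisj.mono Set.inter_subset_right Set.inter_subset_right)
      · exact (hdisj.symm.mono Set.inter_subset_right Set.inter_subset_right)
      · exact ((disjoint_vennPart _ (Finset.mem_powerset.1 J.2) (Finset.mem_powerset.1 J'.2)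
          (fun h' => hJ (congrArg _ (Subtype.ext h')))).inter_left D').inter_right D'
    have hind := hM.iIndepFun B hB hBd
    have hST : Disjoint
        ((Finset.univ : Finset I.powerset).map (Function.Embedding.inl (β := I'.powerset)))
        ((Finset.univ : Finset I'.powerset).map Function.Embedding.inr) := by
      rw [Finset.disjoint_left]; simp
    have h2 := hind.indepFun_finset _ _ hST
      (fun J => (Measure.measurable_coe (hB J)).comp hm)
    let F : (((Finset.univ : Finset I.powerset).map
        (Function.Embedding.inl (β := I'.powerset)) : Finset _) → ℝ≥0∞) → (I → ℝ≥0∞) :=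
      fun w i => ∑ J : I.powerset, if i.1 ∈ J.1 then w ⟨Sum.inl J, by simp⟩ else 0
    let F' : (((Finset.univ : Finset I'.powerset).map
        (Function.Embedding.inr (α := I.powerset)) : Finset _) → ℝ≥0∞) → (I' → ℝ≥0∞) :=
      fun w i => ∑ J : I'.powerset, if i.1 ∈ J.1 then w ⟨Sum.inr J, by simp⟩ else 0
    have hF : Measurable F := by
      refine measurable_pi_lambda _ fun i => Finset.measurable_sum _ fun J _ => ?_
      split_ifs
      · exact measurable_pi_apply _
      · exact measurable_const
    have hF' : Measurable F' := by
      refine measurable_pi_lambda _ fun i => Finset.measurable_sum _ fun J _ => ?_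
      split_ifs
      · exact measurable_pi_apply _
      · exact measurable_const
    have h3 := h2.comp hF hF'
    have e1 : v D I = F ∘ fun ω (J : ((Finset.univ : Finset I.powerset).map
        (Function.Embedding.inl (β := I'.powerset)) : Finset _)) => M ω (B J.1) := by
      ext ω i
      exact measure_eq_sum_vennPart (M ω) hA i.2 D hD
    have e2 : v D' I' = F' ∘ fun ω (J : ((Finset.univ : Finset I'.powerset).map
        (Function.Embedding.inr (α := I.powerset)) : Finset _)) => M ω (B J.1) := by
      ext ω i
      exact measure_eq_sum_vennPart (M ω) hA i.2 D' hD'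
    rw [e1, e2]
    exact h3
  have h1 : ∀ I', Indep (⨆ I, m D I) (m D' I') P := fun I' =>
    indep_iSup_of_directed_le (fun I => hfin I I') (hmle D hD) (hmle D' hD' I') (hdir D)
  have h2 : Indep (⨆ I, m D' I) (⨆ I, m D I) P :=
    indep_iSup_of_directed_le (fun I' => (h1 I').symm) (hmle D' hD') (iSup_le (hmle D hD)) (hdir D')
  rw [IndepFun_iff_Indep]
  exact indep_of_indep_of_le_left (indep_of_indep_of_le_right h2.symm (hgen D' hD')) (hgen D hD)

end Scattered

/-! ### Local finiteness and integrality of the Poisson process -/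

/-- The measure itself if it is finite, and zero otherwise. -/
noncomputable def finitePart {E : Type*} [MeasurableSpace E] (ν : Measure E) : Measure E :=
  open Classical in if ν Set.univ < ∞ then ν else 0

theorem finitePart_of_lt_top {E : Type*} [MeasurableSpace E] {ν : Measure E}
    (h : ν Set.univ < ∞) : finitePart ν = ν := by
  simp [finitePart, h]

instance isFiniteMeasure_finitePart {E : Type*} [MeasurableSpace E] (ν : Measure E) :
    IsFiniteMeasure (finitePart ν) := by
  unfold finitePart
  split_ifs with h
  · exact ⟨h⟩
  · infer_instance

theorem measurable_finitePart {E : Type*} [MeasurableSpace E] :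
    Measurable (finitePart : Measure E → Measure E) := by
  classical
  unfold finitePart
  exact Measurable.ite (measurableSet_lt (Measure.measurable_coe MeasurableSet.univ)
    measurable_const) measurable_id measurable_const

theorem measurable_restrict_measure {E : Type*} [MeasurableSpace E] {D : Set E}
    (hD : MeasurableSet D) : Measurable fun ν : Measure E => ν.restrict D := by
  refine Measure.measurable_of_measurable_coe _ fun A hA => ?_
  simp_rw [Measure.restrict_apply hA]
  exact Measure.measurable_coe (hA.inter hD)

theorem IsPoissonRandomMeasure.ae_exists_nat {E Ω : Type*} [MeasurableSpace E]
    [MeasurableSpace Ω] {Λ : Measure E} {N : Ω → Measure E} {P : Measure Ω}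
    (hN : IsPoissonRandomMeasure Λ N P) {A : Set E} (hA : MeasurableSet A) (hΛ : Λ A ≠ ∞) :
    ∀ᵐ ω ∂P, ∃ n : ℕ, N ω A = n := by
  have h := hN.poisson A hA hΛ
  have hmeas : MeasurableSet (Set.range (Nat.cast : ℕ → ℝ≥0∞)) :=
    (Set.countable_range _).measurableSet
  have h2 : ∀ᵐ x ∂(P.map fun ω => N ω A), x ∈ Set.range (Nat.cast : ℕ → ℝ≥0∞) := by
    rw [h.map_eq]
    refine (ae_map_iff (measurable_of_countable _).aemeasurable hmeas).2 ?_
    exact Eventually.of_forall fun n => ⟨n, rfl⟩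
  filter_upwards [ae_of_ae_map h.aemeasurable h2] with ω hω
  obtain ⟨n, hn⟩ := hω
  exact ⟨n, hn.symm⟩

/-- Almost surely, the restriction of a Poisson process to a set of finite mean measure is carried
by finitely many points. -/
theorem IsPoissonRandomMeasure.ae_exists_finset {E Ω : Type*} [MetricSpace E]
    [SecondCountableTopology E] [MeasurableSpace E] [BorelSpace E]
    [MeasurableSpace Ω] {Λ : Measure E} {N : Ω → Measure E} {P : Measure Ω}
    (hN : IsPoissonRandomMeasure Λ N P) {D : Set E} (hD : MeasurableSet D) (hΛ : Λ D ≠ ∞) :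
    ∀ᵐ ω ∂P, N ω D < ∞ ∧ ∃ S : Finset E, (N ω).restrict D (↑S)ᶜ = 0 := by
  let C : Set (Set E) := generateSetAlgebra (MeasurableSpace.countableGeneratingSet E)
  have hC : C.Countable := countable_generateSetAlgebra
    (MeasurableSpace.countable_countableGeneratingSet)
  have hgen : ‹MeasurableSpace E› = MeasurableSpace.generateFrom C := by
    rw [generateFrom_generateSetAlgebra_eq, MeasurableSpace.generateFrom_countableGeneratingSet]
  have hCm : ∀ A ∈ C, MeasurableSet A := fun A hA => by
    rw [hgen]; exact MeasurableSpace.measurableSet_generateFrom hA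
  have h1 : ∀ᵐ ω ∂P, ∀ A ∈ C, ∃ n : ℕ, (N ω).restrict D A = n := by
    rw [ae_ball_iff hC]
    intro A hA
    simp_rw [Measure.restrict_apply (hCm A hA)]
    exact hN.ae_exists_nat ((hCm A hA).inter hD)
      (ne_top_of_le_ne_top hΛ (measure_mono Set.inter_subset_right))
  filter_upwards [h1, hN.ae_exists_nat hD hΛ] with ω hω hfin
  obtain ⟨n, hn⟩ := hfin
  have hlt : N ω D < ∞ := by rw [hn]; simp
  have : IsFiniteMeasure ((N ω).restrict D) := ⟨by simpa using hlt⟩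
  exact ⟨hlt, exists_finset_measure_compl_eq_zero _ fun A hA =>
    exists_nat_measure_of_generateFrom _ isSetAlgebra_generateSetAlgebra hgen hω hA⟩

/-! ### The law of the marked configuration -/

section Data

variable {d : ℕ} {Ω₁ Ω₂ : Type*} [MeasurableSpace Ω₁] [MeasurableSpace Ω₂]

local notation "𝔼" => EuclideanSpace ℝ (Fin d)

theorem measurableSet_region {K : Set 𝔼} (hK : MeasurableSet K) (s : ℝ) (y : 𝔼) :
    MeasurableSet (region K s y) :=
  (hK.const_smul₀ s).const_vadd y

theorem mem_region {K : Set 𝔼} {s : ℝ} {y t : 𝔼} : t ∈ region K s y ↔ t - y ∈ s • K := by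
  rw [region, Set.mem_vadd_set_iff_neg_vadd_mem, vadd_eq_add, neg_add_eq_sub]

theorem measurableSet_region_prod {K : Set 𝔼} (hK : MeasurableSet K) (s : ℝ) :
    MeasurableSet {p : 𝔼 × 𝔼 | p.2 ∈ region K s p.1} := by
  simp_rw [mem_region]
  exact (measurable_snd.sub measurable_fst) (hK.const_smul₀ s)

theorem markedData_restrict (K : Set 𝔼) (ν : Measure 𝔼) (z : 𝔼 → ℝ) {s : ℝ} {y : 𝔼}
    {D : Set 𝔼} (hD : region K s y ⊆ D) :
    markedData K (ν.restrict D) z s y = markedData K ν z s y := by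
  rw [markedData, markedData, Measure.restrict_restrict_of_subset hD]

theorem measurable_markedData {K : Set 𝔼} (hK : MeasurableSet K) {Z : 𝔼 → Ω₁ → ℝ}
    (hZ : Measurable (Function.uncurry Z)) (s : ℝ) :
    Measurable fun q : (𝔼 × Ω₁) × Measure 𝔼 =>
      markedData K (finitePart q.2) (fun t => Z t q.1.2) s q.1.1 := by
  have hR : MeasurableSet {p : ((𝔼 × Ω₁) × Measure 𝔼) × 𝔼 | p.2 ∈ region K s p.1.1.1} := by
    have hg : Measurable fun p : ((𝔼 × Ω₁) × Measure 𝔼) × 𝔼 => (p.1.1.1, p.2) := by fun_prop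
    exact hg (measurableSet_region_prod hK s)
  have hf : Measurable fun p : ((𝔼 × Ω₁) × Measure 𝔼) × 𝔼 =>
      (p.2 - p.1.1.1, Z p.2 p.1.1.2) := by
    refine Measurable.prodMk (by fun_prop) ?_
    have hg : Measurable fun p : ((𝔼 × Ω₁) × Measure 𝔼) × 𝔼 => (p.2, p.1.1.2) := by fun_prop
    exact hZ.comp hg
  exact measurable_map_restrict (measurable_finitePart.comp measurable_snd)
    (fun q => isFiniteMeasure_finitePart q.2) hR hf

/-- The configuration of marked points carried by a finite set of points is a finite sum of Dirac
masses. -/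
theorem markedData_eq_sum {K : Set 𝔼} (hK : MeasurableSet K) {ν : Measure 𝔼} {z : 𝔼 → ℝ}
    (hz : Measurable z) (s : ℝ) (y : 𝔼) {S : Finset 𝔼} (hS : ν (↑S)ᶜ = 0)
    [DecidablePred (· ∈ region K s y)] :
    markedData K ν z s y =
      ∑ x ∈ S with x ∈ region K s y, ν {x} • Measure.dirac (x - y, z x) := by
  classical
  have hf : Measurable fun t : 𝔼 => (t - y, z t) := by fun_prop
  have hR := measurableSet_region hK s y
  ext C hC
  rw [markedData, Measure.map_apply hf hC, Measure.restrict_apply (hf hC), Measure.coe_finsetSum,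
    Finset.sum_apply, ← measure_inter_conull hS]
  have : (fun t : 𝔼 => (t - y, z t)) ⁻¹' C ∩ region K s y ∩ ↑S =
      ↑((S.filter (· ∈ region K s y)).filter fun t => (t - y, z t) ∈ C) := by
    ext t; simp; tauto
  rw [this, ← sum_measure_singleton, Finset.sum_filter]
  refine Finset.sum_congr rfl fun x _ => ?_
  rw [Measure.smul_apply, Measure.dirac_apply' _ hC, Set.indicator_apply]
  simp

theorem measurable_sum_dirac {α : Type*} {mα : MeasurableSpace α} (S : Finset 𝔼)
    (w : 𝔼 → ℝ≥0∞) (y : 𝔼) {z : α → 𝔼 → ℝ} (hz : ∀ x ∈ S, Measurable fun a => z a x) :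
    Measurable fun a => ∑ x ∈ S, w x • Measure.dirac (x - y, z a x) := by
  refine Measure.measurable_of_measurable_coe _ fun C hC => ?_
  simp_rw [Measure.coe_finsetSum, Finset.sum_apply, Measure.smul_apply, smul_eq_mul]
  refine Finset.measurable_sum _ fun x hx => Measurable.const_mul ?_ _
  have : Measurable fun a => (x - y, z a x) := measurable_const.prodMk (hz x hx)
  exact (Measure.measurable_coe hC).comp (Measure.measurable_dirac.comp this)

theorem measurable_section {Z : 𝔼 → Ω₁ → ℝ} (hZ : Measurable (Function.uncurry Z)) (ω : Ω₁) :
    Measurable fun t => Z t ω := by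
  have hg : Measurable fun t : 𝔼 => (t, ω) := by fun_prop
  exact hZ.comp hg

theorem measurable_marginal {Z : 𝔼 → Ω₁ → ℝ} (hZ : Measurable (Function.uncurry Z)) (t : 𝔼) :
    Measurable (Z t) := hZ.comp measurable_prodMk_left

/-- An event about the marked configuration on a region, for a fixed finite set of points, only
depends on the field on that region. -/
theorem measurableSet_fieldSigma_markedData {K : Set 𝔼} (hK : MeasurableSet K)
    {Z : 𝔼 → Ω₁ → ℝ} (hZ : Measurable (Function.uncurry Z)) {ν : Measure 𝔼} {S : Finset 𝔼}
    (hS : ν (↑S)ᶜ = 0) {s : ℝ} {y : 𝔼} {A : Set 𝔼} (hA : region K s y ⊆ A)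
    {𝒜 : Set (Measure (𝔼 × ℝ))} (h𝒜 : MeasurableSet 𝒜) :
    MeasurableSet[fieldSigma Z A] {ω | markedData K ν (fun t => Z t ω) s y ∈ 𝒜} := by
  classical
  have heq : (fun ω => markedData K ν (fun t => Z t ω) s y) = fun ω =>
      ∑ x ∈ S with x ∈ region K s y, ν {x} • Measure.dirac (x - y, Z x ω) := by
    ext1 ω
    exact markedData_eq_sum hK (measurable_section hZ ω) s y hS
  have hm : Measurable[fieldSigma Z A] fun ω => markedData K ν (fun t => Z t ω) s y := by
    rw [heq]
    refine @measurable_sum_dirac d Ω₁ (fieldSigma Z A) _ (fun x => ν {x}) y (fun ω x => Z x ω)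
      fun x hx => ?_
    refine Measurable.mono (comap_measurable (Z x)) ?_ le_rfl
    exact le_iSup₂_of_le x (hA (Finset.mem_filter.1 hx).2) le_rfl
  exact hm h𝒜

theorem map_sub_markedData {K : Set 𝔼} (hK : MeasurableSet K) (ν : Measure 𝔼) {z : 𝔼 → ℝ}
    (hz : Measurable z) (s : ℝ) (y : 𝔼) :
    markedData K (ν.map (· - y)) (fun t => z (t + y)) s 0 = markedData K ν z s y := by
  have hsub : Measurable fun t : 𝔼 => t - y := by fun_prop
  rw [markedData, markedData, Measure.restrict_map hsub (measurableSet_region hK s 0),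
    Measure.map_map (by fun_prop) hsub]
  have h1 : (fun t : 𝔼 => t - y) ⁻¹' region K s 0 = region K s y := by
    ext t; simp only [Set.mem_preimage, mem_region, sub_zero]
  have h2 : (fun t : 𝔼 => (t - 0, z (t + y))) ∘ (fun t => t - y) = fun t => (t - y, z t) := by
    ext1 t; simp
  rw [h1, h2]

/-- For a fixed finite configuration of points, shifting the observation region is the same as
shifting the points, by stationarity of the field. -/
theorem measure_markedData_shift {K : Set 𝔼} (hK : MeasurableSet K) {P₁ : Measure Ω₁}
    {Z : 𝔼 → Ω₁ → ℝ} (hZ : Measurable (Function.uncurry Z)) (hstat : IsStationary P₁ Z)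
    {ν : Measure 𝔼} {S : Finset 𝔼} (hS : ν (↑S)ᶜ = 0) (s : ℝ) (y : 𝔼)
    {𝒜 : Set (Measure (𝔼 × ℝ))} (h𝒜 : MeasurableSet 𝒜) :
    P₁ {ω | markedData K ν (fun t => Z t ω) s y ∈ 𝒜} =
      P₁ {ω | markedData K (ν.map (· - y)) (fun t => Z t ω) s 0 ∈ 𝒜} := by
  classical
  have hsub : Measurable fun t : 𝔼 => t - y := by fun_prop
  set ν' := ν.map (· - y) with hν'
  let S' : Finset 𝔼 := S.image (· - y)
  have hS' : ν' (↑S')ᶜ = 0 := by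
    rw [hν', Measure.map_apply hsub S'.measurableSet.compl]
    refine measure_mono_null (t := (↑S)ᶜ) (fun t ht htS => ht ?_) hS
    exact Finset.mem_coe.2 (Finset.mem_image_of_mem _ htS)
  let Ψ : (𝔼 → ℝ) → Measure (𝔼 × ℝ) := fun z =>
    ∑ x ∈ S' with x ∈ region K s 0, ν' {x} • Measure.dirac (x - 0, z x)
  have hΨ : Measurable Ψ := measurable_sum_dirac _ _ _ fun x _ => measurable_pi_apply x
  have h1 : ∀ ω, markedData K ν (fun t => Z t ω) s y = Ψ (fun t => Z (t + y) ω) := fun ω => by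
    have hz : Measurable fun t => Z (t + y) ω :=
      (measurable_section hZ ω).comp (measurable_id.add_const y)
    rw [← map_sub_markedData hK ν (measurable_section hZ ω) s y]
    exact markedData_eq_sum hK hz s 0 hS'
  have h2 : ∀ ω, markedData K ν' (fun t => Z t ω) s 0 = Ψ (fun t => Z t ω) := fun ω =>
    markedData_eq_sum hK (measurable_section hZ ω) s 0 hS'
  simp_rw [h1, h2]
  have e1 : Measurable fun ω (t : 𝔼) => Z (t + y) ω :=
    measurable_pi_lambda _ fun t => measurable_marginal hZ _
  have e2 : Measurable fun ω (t : 𝔼) => Z t ω :=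
    measurable_pi_lambda _ fun t => measurable_marginal hZ _
  have := hstat y
  calc P₁ {ω | Ψ (fun t => Z (t + y) ω) ∈ 𝒜}
      = P₁.map (fun ω (t : 𝔼) => Z (t + y) ω) (Ψ ⁻¹' 𝒜) := by
        rw [Measure.map_apply e1 (hΨ h𝒜)]; rfl
    _ = P₁ {ω | Ψ (fun t => Z t ω) ∈ 𝒜} := by
        rw [this, Measure.map_apply e2 (hΨ h𝒜)]; rfl

end Data

/-! ### Stationarity and mixing of the block statistics -/

section Blocks

variable {d : ℕ} {Ω₁ Ω₂ : Type*} [MeasurableSpace Ω₁] [MeasurableSpace Ω₂]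

local notation "𝔼" => EuclideanSpace ℝ (Fin d)

/-- The marked configuration on `s • K + y`, computed from the points in a window `D` only and set
to zero if that window has infinitely many points. Unlike `markedData` it is measurable in the
location and the outcome together; it agrees with `markedData` almost surely, simultaneously for
all regions in `D`. -/
noncomputable def localData (K : Set 𝔼) (Z : 𝔼 → Ω₁ → ℝ) (N : Ω₂ → Measure 𝔼) (s : ℝ) (D : Set 𝔼)
    (q : 𝔼 × (Ω₁ × Ω₂)) : Measure (𝔼 × ℝ) :=
  markedData K (finitePart ((N q.2.2).restrict D)) (fun t => Z t q.2.1) s q.1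

theorem measurable_localData {K : Set 𝔼} (hK : MeasurableSet K) {Z : 𝔼 → Ω₁ → ℝ}
    (hZ : Measurable (Function.uncurry Z)) {N : Ω₂ → Measure 𝔼} (hN : Measurable N) (s : ℝ)
    {D : Set 𝔼} (hD : MeasurableSet D) : Measurable (localData K Z N s D) := by
  have hg : Measurable fun q : 𝔼 × (Ω₁ × Ω₂) => ((q.1, q.2.1), (N q.2.2).restrict D) := by
    refine Measurable.prodMk (by fun_prop) ?_
    exact (measurable_restrict_measure hD).comp (hN.comp (by fun_prop))
  exact (measurable_markedData hK hZ s).comp hg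

theorem measurable_localData_right {K : Set 𝔼} (hK : MeasurableSet K) {Z : 𝔼 → Ω₁ → ℝ}
    (hZ : Measurable (Function.uncurry Z)) {N : Ω₂ → Measure 𝔼} (hN : Measurable N) (s : ℝ)
    {D : Set 𝔼} (hD : MeasurableSet D) (y : 𝔼) :
    Measurable fun ω => localData K Z N s D (y, ω) :=
  (measurable_localData hK hZ hN s hD).comp measurable_prodMk_left

theorem localData_eq {Ω₁ Ω₂ : Type*} {K : Set 𝔼} {Z : 𝔼 → Ω₁ → ℝ} {N : Ω₂ → Measure 𝔼} {s : ℝ}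
    {D : Set 𝔼} {q : 𝔼 × (Ω₁ × Ω₂)} (hfin : N q.2.2 D < ∞) (hD : region K s q.1 ⊆ D) :
    localData K Z N s D q = markedData K (N q.2.2) (fun t => Z t q.2.1) s q.1 := by
  rw [localData, finitePart_of_lt_top (by simpa using hfin), markedData_restrict _ _ _ hD]

theorem smul_volume_ne_top (r : ℝ≥0) {A : Set 𝔼} (hA : volume A ≠ ∞) :
    (r • (volume : Measure 𝔼)) A ≠ ∞ := by
  rw [Measure.smul_apply]
  exact ENNReal.nnreal_smul_ne_top hA

theorem volume_region_ne_top {K : Set 𝔼} (hK : Bornology.IsBounded K) (s : ℝ) (y : 𝔼) :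
    volume (region K s y) ≠ ∞ :=
  ((hK.smul₀ s).vadd y).measure_lt_top.ne

theorem region_eq_vadd (K : Set 𝔼) (s : ℝ) (y : 𝔼) : region K s y = y +ᵥ region K s 0 := by
  simp [region]

/-- Shifting the part of a Poisson process in the region `s • K + y` back by `y` yields the law of
its part in `s • K`. -/
theorem map_restrict_region_shift {K : Set 𝔼} (hK : MeasurableSet K)
    (hKb : Bornology.IsBounded K) {P₂ : Measure Ω₂} [IsProbabilityMeasure P₂] {r : ℝ≥0}
    {N : Ω₂ → Measure 𝔼} (hN : IsPoissonRandomMeasure (r • (volume : Measure 𝔼)) N P₂)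
    (s : ℝ) (y : 𝔼) :
    P₂.map (fun ω => ((N ω).restrict (region K s y)).map (· - y)) =
      P₂.map (fun ω => (N ω).restrict (region K s 0)) := by
  have hsub : Measurable fun t : 𝔼 => t - y := by fun_prop
  have hR := measurableSet_region hK s y
  have hR0 := measurableSet_region hK s 0
  have hpre : ∀ A : Set 𝔼, (fun t : 𝔼 => t - y) ⁻¹' A ∩ region K s y = y +ᵥ (A ∩ region K s 0) := by
    intro A
    rw [Set.vadd_set_inter, region_eq_vadd K s y]
    congr 1
    ext t
    rw [Set.mem_vadd_set_iff_neg_vadd_mem, vadd_eq_add, neg_add_eq_sub, Set.mem_preimage]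
  have h1 : ∀ ω A, MeasurableSet A →
      ((N ω).restrict (region K s y)).map (· - y) A = N ω (y +ᵥ (A ∩ region K s 0)) := by
    intro ω A hA
    rw [Measure.map_apply hsub hA, Measure.restrict_apply (hsub hA), hpre]
  have h2 : ∀ ω A, MeasurableSet A →
      (N ω).restrict (region K s 0) A = N ω (A ∩ region K s 0) := fun ω A hA =>
    Measure.restrict_apply hA
  refine map_eq_map_of_independentlyScattered
    ((Measure.measurable_map _ hsub).comp ((measurable_restrict_measure hR).comp hN.measurable))
    ((measurable_restrict_measure hR0).comp hN.measurable) ?_ ?_ ?_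
  · intro k A hA hd
    have e : (fun i ω => ((N ω).restrict (region K s y)).map (· - y) (A i)) =
        fun i ω => N ω (y +ᵥ (A i ∩ region K s 0)) := by
      ext i ω; exact h1 ω _ (hA i)
    rw [e]
    refine hN.indep k _ (fun i => ((hA i).inter hR0).const_vadd y) fun i j hij => ?_
    refine Set.disjoint_left.2 ?_
    rintro _ ⟨t, ht, rfl⟩ ht'
    rw [Set.vadd_mem_vadd_set_iff] at ht'
    exact Set.disjoint_left.1 (hd hij) ht.1 ht'.1
  · intro k A hA hd
    have e : (fun i ω => (N ω).restrict (region K s 0) (A i)) =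
        fun i ω => N ω (A i ∩ region K s 0) := by
      ext i ω; exact h2 ω _ (hA i)
    rw [e]
    exact hN.indep k _ (fun i => (hA i).inter hR0) fun i j hij =>
      ((hd hij).inter_left _).inter_right _
  · intro A hA
    simp_rw [fun ω => h1 ω A hA, fun ω => h2 ω A hA]
    have hv : (r • (volume : Measure 𝔼)) (y +ᵥ (A ∩ region K s 0)) =
        (r • (volume : Measure 𝔼)) (A ∩ region K s 0) := by
      rw [Measure.smul_apply, Measure.smul_apply, measure_vadd]
    have hfin : (r • (volume : Measure 𝔼)) (A ∩ region K s 0) ≠ ∞ :=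
      smul_volume_ne_top r
        (ne_top_of_le_ne_top (volume_region_ne_top hKb s 0) (measure_mono Set.inter_subset_right))
    rw [(hN.poisson _ (hA.inter hR0) hfin).map_eq,
      (hN.poisson _ ((hA.inter hR0).const_vadd y) (hv ▸ hfin)).map_eq, hv]

/-- The marked configurations on all translates of a region have the same law. -/
theorem measure_localData_mem {K : Set 𝔼} (hK : MeasurableSet K)
    (hKb : Bornology.IsBounded K) {P₁ : Measure Ω₁} [IsProbabilityMeasure P₁]
    {P₂ : Measure Ω₂} [IsProbabilityMeasure P₂] {Z : 𝔼 → Ω₁ → ℝ}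
    (hZ : Measurable (Function.uncurry Z)) (hstat : IsStationary P₁ Z) {r : ℝ≥0}
    {N : Ω₂ → Measure 𝔼} (hN : IsPoissonRandomMeasure (r • (volume : Measure 𝔼)) N P₂)
    {s : ℝ} {y : 𝔼} {D : Set 𝔼} (hD : MeasurableSet D) (hDfin : volume D ≠ ∞)
    (hyD : region K s y ⊆ D) {𝒜 : Set (Measure (𝔼 × ℝ))} (h𝒜 : MeasurableSet 𝒜) :
    (P₁.prod P₂) {ω | localData K Z N s D (y, ω) ∈ 𝒜} =
      ∫⁻ ν, P₁ {ω | markedData K (finitePart ν) (fun t => Z t ω) s 0 ∈ 𝒜}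
        ∂(P₂.map fun ω => (N ω).restrict (region K s 0)) := by
  have hsub : Measurable fun t : 𝔼 => t - y := by fun_prop
  have hR := measurableSet_region hK s y
  have hG : Measurable fun ν : Measure 𝔼 =>
      P₁ {ω | markedData K (finitePart ν) (fun t => Z t ω) s 0 ∈ 𝒜} := by
    have hg : Measurable fun p : Ω₁ × Measure 𝔼 => (((0 : 𝔼), p.1), p.2) := by fun_prop
    exact measurable_measure_prodMk_right (((measurable_markedData hK hZ s).comp hg) h𝒜)
  have hshift : Measurable fun ω => ((N ω).restrict (region K s y)).map (· - y) :=
    (Measure.measurable_map _ hsub).comp ((measurable_restrict_measure hR).comp hN.measurable)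
  have hmem : MeasurableSet {ω | localData K Z N s D (y, ω) ∈ 𝒜} :=
    (measurable_localData_right hK hZ hN.measurable s hD y) h𝒜
  rw [← map_restrict_region_shift hK hKb hN s y, lintegral_map hG hshift,
    Measure.prod_apply_symm hmem]
  refine lintegral_congr_ae ?_
  filter_upwards [hN.ae_exists_finset hD (smul_volume_ne_top r hDfin)] with ω₂ hω
  obtain ⟨hfin, S, hS⟩ := hω
  have hfinR : (N ω₂).restrict (region K s y) Set.univ < ∞ := by
    rw [Measure.restrict_apply_univ]
    exact (measure_mono hyD).trans_lt hfin
  have hS' : (N ω₂).restrict (region K s y) (↑S)ᶜ = 0 :=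
    le_antisymm ((Measure.restrict_mono hyD le_rfl _).trans hS.le) zero_le
  have h1 : ∀ ω₁, localData K Z N s D (y, (ω₁, ω₂)) =
      markedData K ((N ω₂).restrict (region K s y)) (fun t => Z t ω₁) s y := fun ω₁ => by
    rw [localData_eq (q := (y, (ω₁, ω₂))) hfin hyD, markedData_restrict _ _ _ subset_rfl]
  rw [finitePart_of_lt_top (by rwa [Measure.map_apply hsub MeasurableSet.univ, Set.preimage_univ]),
    ← measure_markedData_shift hK hZ hstat hS' s y h𝒜]
  congr 1
  ext ω₁
  exact iff_of_eq (congrArg (· ∈ 𝒜) (h1 ω₁))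

theorem measure_localData_mem_eq {K : Set 𝔼} (hK : MeasurableSet K)
    (hKb : Bornology.IsBounded K) {P₁ : Measure Ω₁} [IsProbabilityMeasure P₁]
    {P₂ : Measure Ω₂} [IsProbabilityMeasure P₂] {Z : 𝔼 → Ω₁ → ℝ}
    (hZ : Measurable (Function.uncurry Z)) (hstat : IsStationary P₁ Z) {r : ℝ≥0}
    {N : Ω₂ → Measure 𝔼} (hN : IsPoissonRandomMeasure (r • (volume : Measure 𝔼)) N P₂)
    {s : ℝ} {y y' : 𝔼} {D D' : Set 𝔼} (hD : MeasurableSet D) (hDfin : volume D ≠ ∞)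
    (hyD : region K s y ⊆ D) (hD' : MeasurableSet D') (hDfin' : volume D' ≠ ∞)
    (hyD' : region K s y' ⊆ D') {𝒜 : Set (Measure (𝔼 × ℝ))} (h𝒜 : MeasurableSet 𝒜) :
    (P₁.prod P₂) {ω | localData K Z N s D (y, ω) ∈ 𝒜} =
      (P₁.prod P₂) {ω | localData K Z N s D' (y', ω) ∈ 𝒜} := by
  rw [measure_localData_mem hK hKb hZ hstat hN hD hDfin hyD h𝒜,
    measure_localData_mem hK hKb hZ hstat hN hD' hDfin' hyD' h𝒜]

/-! ### Properties of the mixing coefficient -/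

theorem abs_measureReal_inter_sub_le_one {Ω : Type*} [MeasurableSpace Ω] (P : Measure Ω)
    [IsProbabilityMeasure P] (A B : Set Ω) :
    |P.real (A ∩ B) - P.real A * P.real B| ≤ 1 := by
  have h1 : P.real (A ∩ B) ≤ 1 := measureReal_le_one
  have h2 : P.real A ≤ 1 := measureReal_le_one
  have h3 : P.real B ≤ 1 := measureReal_le_one
  have h4 : 0 ≤ P.real (A ∩ B) := measureReal_nonneg
  have h5 : 0 ≤ P.real A := measureReal_nonneg
  have h6 : 0 ≤ P.real B := measureReal_nonneg
  rw [abs_le]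
  constructor <;> nlinarith

theorem bddAbove_mixing (P : Measure Ω₁) [IsProbabilityMeasure P] (Z : 𝔼 → Ω₁ → ℝ) (k l : ℝ) :
    BddAbove {x : ℝ | ∃ (E₁ : Set 𝔼) (h : 𝔼) (A₁ A₂ : Set Ω₁),
      IsCompact E₁ ∧ Convex ℝ E₁ ∧ volume.real E₁ ≤ l ∧
      (∀ u ∈ E₁, ∀ v ∈ h +ᵥ E₁, k ≤ dist u v) ∧
      MeasurableSet[fieldSigma Z E₁] A₁ ∧ MeasurableSet[fieldSigma Z (h +ᵥ E₁)] A₂ ∧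
      x = |P.real (A₁ ∩ A₂) - P.real A₁ * P.real A₂|} := by
  refine ⟨1, ?_⟩
  rintro x ⟨E₁, h, A₁, A₂, -, -, -, -, -, -, rfl⟩
  exact abs_measureReal_inter_sub_le_one P _ _

theorem le_mixingCoeff (P : Measure Ω₁) [IsProbabilityMeasure P] (Z : 𝔼 → Ω₁ → ℝ) {k l : ℝ}
    {E₁ : Set 𝔼} {h : 𝔼} {A₁ A₂ : Set Ω₁} (hc : IsCompact E₁) (hconv : Convex ℝ E₁)
    (hl : volume.real E₁ ≤ l) (hk : ∀ u ∈ E₁, ∀ v ∈ h +ᵥ E₁, k ≤ dist u v)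
    (hA₁ : MeasurableSet[fieldSigma Z E₁] A₁) (hA₂ : MeasurableSet[fieldSigma Z (h +ᵥ E₁)] A₂) :
    |P.real (A₁ ∩ A₂) - P.real A₁ * P.real A₂| ≤ mixingCoeff P Z k l :=
  le_csSup (bddAbove_mixing P Z k l) ⟨E₁, h, A₁, A₂, hc, hconv, hl, hk, hA₁, hA₂, rfl⟩

theorem mixingCoeff_nonneg (P : Measure Ω₁) (Z : 𝔼 → Ω₁ → ℝ) (k l : ℝ) :
    0 ≤ mixingCoeff P Z k l := by
  refine Real.sSup_nonneg ?_
  rintro x ⟨E₁, h, A₁, A₂, -, -, -, -, -, -, rfl⟩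
  exact abs_nonneg _

theorem mixingCoeff_le_one (P : Measure Ω₁) [IsProbabilityMeasure P] (Z : 𝔼 → Ω₁ → ℝ) (k l : ℝ) :
    mixingCoeff P Z k l ≤ 1 := by
  refine Real.sSup_le ?_ zero_le_one
  rintro x ⟨E₁, h, A₁, A₂, -, -, -, -, -, -, rfl⟩
  exact abs_measureReal_inter_sub_le_one P _ _

theorem antitone_mixingCoeff (P : Measure Ω₁) [IsProbabilityMeasure P] (Z : 𝔼 → Ω₁ → ℝ) (l : ℝ) :
    Antitone fun k => mixingCoeff P Z k l := by
  intro k k' hk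
  refine Real.sSup_le ?_ (mixingCoeff_nonneg _ _ _ _)
  rintro x ⟨E₁, h, A₁, A₂, h1, h2, h3, h4, h5, h6, rfl⟩
  exact le_mixingCoeff P Z h1 h2 h3 (fun u hu v hv => hk.trans (h4 u hu v hv)) h5 h6

theorem measureReal_prod_eq_integral {P₁ : Measure Ω₁} [IsProbabilityMeasure P₁]
    {P₂ : Measure Ω₂} [IsProbabilityMeasure P₂] {A : Set (Ω₁ × Ω₂)} (hA : MeasurableSet A) :
    (P₁.prod P₂).real A = ∫ ω₂, P₁.real ((fun ω₁ => (ω₁, ω₂)) ⁻¹' A) ∂P₂ := by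
  simp_rw [measureReal_def]
  rw [Measure.prod_apply_symm hA, integral_toReal]
  · exact (measurable_measure_prodMk_right hA).aemeasurable
  · exact Eventually.of_forall fun ω => measure_lt_top _ _

/-- The covariance of two events about the configurations on two translates of a region is
controlled by the mixing coefficient of the field: given the point process the two events belong
to the field on the two regions, and the parts of the point process in the two disjoint regions
are independent. -/
theorem abs_cov_localData_le {K : Set 𝔼} (hK : MeasurableSet K)
    (hKb : Bornology.IsBounded K) {P₁ : Measure Ω₁} [IsProbabilityMeasure P₁]
    {P₂ : Measure Ω₂} [IsProbabilityMeasure P₂] {Z : 𝔼 → Ω₁ → ℝ}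
    (hZ : Measurable (Function.uncurry Z)) {r : ℝ≥0}
    {N : Ω₂ → Measure 𝔼} (hN : IsPoissonRandomMeasure (r • (volume : Measure 𝔼)) N P₂)
    {s : ℝ} {y y' : 𝔼} {D : Set 𝔼} (hD : MeasurableSet D) (hDfin : volume D ≠ ∞)
    (hyD : region K s y ⊆ D) (hyD' : region K s y' ⊆ D) {k : ℝ} (hk0 : 0 < k)
    (hk : k + Metric.diam (s • K) ≤ dist y y')
    {𝒜 : Set (Measure (𝔼 × ℝ))} (h𝒜 : MeasurableSet 𝒜) :
    |(P₁.prod P₂).real {ω | localData K Z N s D (y, ω) ∈ 𝒜 ∧ localData K Z N s D (y', ω) ∈ 𝒜} -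
      (P₁.prod P₂).real {ω | localData K Z N s D (y, ω) ∈ 𝒜} *
      (P₁.prod P₂).real {ω | localData K Z N s D (y', ω) ∈ 𝒜}| ≤
    mixingCoeff P₁ Z k (volume.real (convexHull ℝ (s • K))) := by
  classical
  have hsKb : Bornology.IsBounded (s • K) := hKb.smul₀ s
  set C : Set 𝔼 := closure (convexHull ℝ (s • K)) with hC
  have hCb : Bornology.IsBounded C := (isBounded_convexHull.2 hsKb).closure
  have hCc : IsCompact C := Metric.isCompact_of_isClosed_isBounded isClosed_closure hCb
  have hCconv : Convex ℝ C := (convex_convexHull ℝ _).closure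
  have hCdiam : Metric.diam C = Metric.diam (s • K) := by
    rw [hC, Metric.diam_closure, convexHull_diam]
  have hCvol : volume.real C = volume.real (convexHull ℝ (s • K)) := by
    rw [measureReal_def, measureReal_def]
    congr 1
    refine le_antisymm ?_ (measure_mono subset_closure)
    rw [hC, closure_eq_self_union_frontier]
    refine (measure_union_le _ _).trans ?_
    rw [(convex_convexHull ℝ _).addHaar_frontier volume, add_zero]
  -- The closed convex hull has the same diameter and volume as the convex hull, so that it is an
  -- admissible set in the definition of the mixing coefficient.
  have hsub : s • K ⊆ C := (subset_convexHull ℝ _).trans subset_closure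
  let E₁ : Set 𝔼 := y +ᵥ C
  have hE₁ : region K s y ⊆ E₁ := Set.vadd_set_mono hsub
  have hE₂eq : (y' - y) +ᵥ E₁ = y' +ᵥ C := by
    simp only [E₁]
    rw [vadd_vadd, sub_add_cancel]
  have hE₂ : region K s y' ⊆ (y' - y) +ᵥ E₁ := by
    rw [hE₂eq]; exact Set.vadd_set_mono hsub
  have hdist : ∀ u ∈ E₁, ∀ v ∈ (y' - y) +ᵥ E₁, k ≤ dist u v := by
    rw [hE₂eq]
    rintro _ ⟨u, hu, rfl⟩ _ ⟨v, hv, rfl⟩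
    have h1 : dist u v ≤ Metric.diam (s • K) := by
      rw [← hCdiam]; exact Metric.dist_le_diam_of_mem hCb hu hv
    simp only [vadd_eq_add]
    have h2 : dist y y' ≤ dist (y + u) (y' + v) + dist u v := by
      rw [dist_eq_norm, dist_eq_norm, dist_eq_norm]
      have : y - y' = (y + u - (y' + v)) - (u - v) := by abel
      rw [this]
      exact norm_sub_le _ _
    linarith
  have hdisj : Disjoint (region K s y) (region K s y') := by
    rw [Set.disjoint_left]
    intro t ht ht'
    have := hdist t (hE₁ ht) t (hE₂ ht')
    rw [dist_self] at this
    linarith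
  have hmeas : ∀ y, MeasurableSet {ω | localData K Z N s D (y, ω) ∈ 𝒜} := fun y =>
    (measurable_localData_right hK hZ hN.measurable s hD y) h𝒜
  -- The conditional probability of the event at `y`, as a function of the points in the region.
  let G : 𝔼 → Measure 𝔼 → ℝ := fun y ν =>
    P₁.real {ω | markedData K (finitePart ν) (fun t => Z t ω) s y ∈ 𝒜}
  have hG : ∀ y, Measurable (G y) := by
    intro y
    have hg : Measurable fun p : Ω₁ × Measure 𝔼 => ((y, p.1), p.2) := by fun_prop
    exact (measurable_measure_prodMk_right
      (((measurable_markedData hK hZ s).comp hg) h𝒜)).ennreal_toReal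
  let p : 𝔼 → Ω₂ → ℝ := fun y ω₂ => P₁.real {ω₁ | localData K Z N s D (y, (ω₁, ω₂)) ∈ 𝒜}
  have hae := hN.ae_exists_finset hD (smul_volume_ne_top r hDfin)
  have hpG : ∀ y, region K s y ⊆ D →
      p y =ᵐ[P₂] fun ω => G y ((N ω).restrict (region K s y)) := by
    intro y hy
    filter_upwards [hae] with ω hω
    simp only [p, G]
    rw [finitePart_of_lt_top
      (by rw [Measure.restrict_apply_univ]; exact (measure_mono hy).trans_lt hω.1)]
    congr 1
    ext ω₁
    simp only [Set.mem_ofPred_eq]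
    rw [localData_eq (q := (y, (ω₁, ω))) hω.1 hy, markedData_restrict _ _ _ subset_rfl]
  have hNr : ∀ y, Measurable fun ω => (N ω).restrict (region K s y) := fun y =>
    (measurable_restrict_measure (measurableSet_region hK s y)).comp hN.measurable
  have hind : IndepFun (fun ω => G y ((N ω).restrict (region K s y)))
      (fun ω => G y' ((N ω).restrict (region K s y'))) P₂ :=
    (IndependentlyScattered.indepFun_restrict hN.measurable hN.indep (measurableSet_region hK s y)
      (measurableSet_region hK s y') hdisj).comp (hG y) (hG y')
  -- The conditional probabilities are uncorrelated, so only the conditional covariance remains.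
  have hprod : ∫ ω, p y ω * p y' ω ∂P₂ = (∫ ω, p y ω ∂P₂) * ∫ ω, p y' ω ∂P₂ := by
    rw [integral_congr_ae (hpG y hyD), integral_congr_ae (hpG y' hyD'),
      ← hind.integral_fun_mul_eq_mul_integral ((hG y).comp (hNr y)).aestronglyMeasurable
        ((hG y').comp (hNr y')).aestronglyMeasurable]
    exact integral_congr_ae ((hpG y hyD).mul (hpG y' hyD'))
  have hpm : ∀ y, Measurable (p y) := fun y =>
    (measurable_measure_prodMk_right (hmeas y)).ennreal_toReal
  have hp1 : ∀ y ω, ‖p y ω‖ ≤ 1 := fun y ω => by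
    rw [Real.norm_of_nonneg measureReal_nonneg]; exact measureReal_le_one
  have hint2 : Integrable (fun ω => p y ω * p y' ω) P₂ := by
    refine Integrable.of_bound ((hpm y).mul (hpm y')).aestronglyMeasurable 1
      (Eventually.of_forall fun ω => ?_)
    rw [norm_mul]
    exact mul_le_one₀ (hp1 y ω) (norm_nonneg _) (hp1 y' ω)
  let p2 : Ω₂ → ℝ := fun ω₂ => P₁.real {ω₁ | localData K Z N s D (y, (ω₁, ω₂)) ∈ 𝒜 ∧
    localData K Z N s D (y', (ω₁, ω₂)) ∈ 𝒜}
  have hmeas2 : MeasurableSet {ω | localData K Z N s D (y, ω) ∈ 𝒜 ∧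
    localData K Z N s D (y', ω) ∈ 𝒜} := (hmeas y).inter (hmeas y')
  have hint1 : Integrable p2 P₂ := by
    refine Integrable.of_bound
      (measurable_measure_prodMk_right hmeas2).ennreal_toReal.aestronglyMeasurable 1
      (Eventually.of_forall fun ω => ?_)
    rw [Real.norm_of_nonneg measureReal_nonneg]; exact measureReal_le_one
  rw [measureReal_prod_eq_integral (hmeas y), measureReal_prod_eq_integral (hmeas y'),
    measureReal_prod_eq_integral hmeas2]
  change |∫ ω, p2 ω ∂P₂ - (∫ ω, p y ω ∂P₂) * ∫ ω, p y' ω ∂P₂| ≤ _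
  rw [← hprod, ← integral_sub hint1 hint2, ← Real.norm_eq_abs]
  have := norm_integral_le_of_norm_le_const (μ := P₂) (f := fun ω => p2 ω - p y ω * p y' ω)
    (C := mixingCoeff P₁ Z k (volume.real (convexHull ℝ (s • K)))) ?_
  · simpa using this
  filter_upwards [hae] with ω hω
  obtain ⟨hfin, S, hS⟩ := hω
  have heq : ∀ y, region K s y ⊆ D → ∀ ω₁, localData K Z N s D (y, (ω₁, ω)) =
      markedData K ((N ω).restrict D) (fun t => Z t ω₁) s y := fun y hy ω₁ => by
    rw [localData_eq (q := (y, (ω₁, ω))) hfin hy, markedData_restrict _ _ _ hy]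
  have e1 : MeasurableSet[fieldSigma Z E₁] {ω₁ | localData K Z N s D (y, (ω₁, ω)) ∈ 𝒜} := by
    simp_rw [heq y hyD]
    exact measurableSet_fieldSigma_markedData hK hZ hS hE₁ h𝒜
  have e2 : MeasurableSet[fieldSigma Z ((y' - y) +ᵥ E₁)]
      {ω₁ | localData K Z N s D (y', (ω₁, ω)) ∈ 𝒜} := by
    simp_rw [heq y' hyD']
    exact measurableSet_fieldSigma_markedData hK hZ hS hE₂ h𝒜
  rw [Real.norm_eq_abs]
  refine le_mixingCoeff P₁ Z (E₁ := E₁) (hCc.vadd y) (hCconv.vadd y) ?_ hdist e1 e2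
  rw [← hCvol, measureReal_def, measure_vadd, ← measureReal_def]

end Blocks

/-! ### Second moments of spatial averages -/

/-- The second moment of a spatial average is the average of the covariances. -/
theorem integral_sq_integral_le {X Ω : Type*} [MeasurableSpace X] [MeasurableSpace Ω]
    (m : Measure X) [IsFiniteMeasure m] (P : Measure Ω) [IsProbabilityMeasure P]
    {f : X × Ω → ℝ} (hf : Measurable f) (hf1 : ∀ q, |f q| ≤ 1) {C : X × X → ℝ}
    (hC : Integrable C (m.prod m))
    (hfC : ∀ᵐ z ∂(m.prod m), ∫ ω, f (z.1, ω) * f (z.2, ω) ∂P ≤ C z) :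
    ∫ ω, (∫ x, f (x, ω) ∂m) ^ 2 ∂P ≤ ∫ z, C z ∂(m.prod m) := by
  have hint : Integrable (Function.uncurry fun (ω : Ω) (z : X × X) => f (z.1, ω) * f (z.2, ω))
      (P.prod (m.prod m)) := by
    refine Integrable.of_bound (Measurable.aestronglyMeasurable ?_) 1
      (Eventually.of_forall fun q => ?_)
    · exact (hf.comp (by fun_prop : Measurable fun q : Ω × (X × X) => (q.2.1, q.1))).mul
        (hf.comp (by fun_prop : Measurable fun q : Ω × (X × X) => (q.2.2, q.1)))
    · simp only [Function.uncurry, norm_mul, Real.norm_eq_abs]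
      exact mul_le_one₀ (hf1 _) (abs_nonneg _) (hf1 _)
  have h1 : ∀ ω, (∫ x, f (x, ω) ∂m) ^ 2 = ∫ z : X × X, f (z.1, ω) * f (z.2, ω) ∂(m.prod m) :=
    fun ω => by
      rw [integral_prod_mul (fun x => f (x, ω)) fun x => f (x, ω), sq]
  simp_rw [h1]
  rw [integral_integral_swap hint]
  exact integral_mono_ae hint.integral_prod_right hC hfC

section Euclidean

variable {d : ℕ}

local notation "𝔼" => EuclideanSpace ℝ (Fin d)

/-- The double integral over `A` of a radial function of the difference is at most the volume of
`A` times its integral over the whole space. -/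
theorem integral_prod_norm_sub_le {A : Set 𝔼} (hA : volume A ≠ ∞) {φ : ℝ → ℝ}
    (hφm : Measurable φ) (hφ0 : ∀ k, 0 ≤ φ k) {M : ℝ} (hφM : ∀ k, φ k ≤ M)
    (hint : Integrable fun h : 𝔼 => φ ‖h‖) :
    Integrable (fun z : 𝔼 × 𝔼 => φ ‖z.2 - z.1‖)
      ((volume.restrict A).prod (volume.restrict A)) ∧
    ∫ z : 𝔼 × 𝔼, φ ‖z.2 - z.1‖ ∂((volume.restrict A).prod (volume.restrict A)) ≤
      volume.real A * ∫ h : 𝔼, φ ‖h‖ := by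
  have : IsFiniteMeasure (volume.restrict A) := ⟨by simpa using hA.lt_top⟩
  have h1 : Integrable (fun z : 𝔼 × 𝔼 => φ ‖z.2 - z.1‖)
      ((volume.restrict A).prod (volume.restrict A)) := by
    refine Integrable.of_bound (Measurable.aestronglyMeasurable ?_) M
      (Eventually.of_forall fun z => ?_)
    · exact hφm.comp (by fun_prop)
    · rw [Real.norm_of_nonneg (hφ0 _)]; exact hφM _
  refine ⟨h1, ?_⟩
  rw [integral_prod _ h1]
  have h2 : ∀ y : 𝔼, ∫ y' in A, φ ‖y' - y‖ ≤ ∫ h : 𝔼, φ ‖h‖ := by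
    intro y
    rw [← integral_sub_right_eq_self (fun h : 𝔼 => φ ‖h‖) y]
    exact integral_mono_measure Measure.restrict_le_self (Eventually.of_forall fun _ => hφ0 _)
      (hint.comp_sub_right y)
  calc ∫ y in A, ∫ y' in A, φ ‖y' - y‖ ≤ ∫ _ in A, ∫ h : 𝔼, φ ‖h‖ := by
        refine integral_mono h1.integral_prod_left (integrable_const _) fun y => h2 y
    _ = volume.real A * ∫ h : 𝔼, φ ‖h‖ := by
        rw [setIntegral_const, smul_eq_mul]

/-- Polar coordinates for a decreasing profile `α` cut off at `b`, with a core of radius `δ` on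
which the trivial bound `1` is used. -/
theorem integral_profile_norm (hd : 0 < d) {α : ℝ → ℝ} (hα : Antitone α) (hα0 : ∀ k, 0 ≤ α k)
    (hα1 : ∀ k, α k ≤ 1) {δ b : ℝ} (hδ : 0 ≤ δ) (hb : 0 ≤ b) :
    Integrable (fun h : 𝔼 => (Set.Iic δ).indicator 1 ‖h‖ +
      (Set.Iic b).indicator (fun k => α (k / 2)) ‖h‖) ∧
    ∫ h : 𝔼, ((Set.Iic δ).indicator 1 ‖h‖ + (Set.Iic b).indicator (fun k => α (k / 2)) ‖h‖) ≤
      volume.real (Metric.ball (0 : 𝔼) 1) *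
        (δ ^ d + d * 2 ^ d * ∫ k in (0 : ℝ)..b, k ^ (d - 1) * α k) := by
  classical
  have : Nonempty (Fin d) := ⟨⟨0, hd⟩⟩
  have hαm : Measurable fun k => α (k / 2) :=
    (hα.comp_monotone fun a b h => div_le_div_of_nonneg_right h zero_le_two).measurable
  have hcut : ∀ (c : ℝ) (g : ℝ → ℝ), Measurable g → (∀ k, ‖g k‖ ≤ 1) →
      Integrable fun h : 𝔼 => (Set.Iic c).indicator g ‖h‖ := by
    intro c g hg hg1
    have : (fun h : 𝔼 => (Set.Iic c).indicator g ‖h‖) =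
        (Metric.closedBall (0 : 𝔼) c).indicator fun h => g ‖h‖ := by
      ext h
      simp only [Set.indicator_apply, Set.mem_Iic, mem_closedBall_zero_iff]
    rw [this, integrable_indicator_iff Metric.isClosed_closedBall.measurableSet]
    have : IsFiniteMeasure (volume.restrict (Metric.closedBall (0 : 𝔼) c)) :=
      ⟨by simpa using measure_closedBall_lt_top⟩
    exact Integrable.of_bound (hg.comp measurable_norm).aestronglyMeasurable 1
      (Eventually.of_forall fun h => hg1 _)
  have h1 := hcut δ 1 measurable_const (by simp)
  have h2 := hcut b (fun k => α (k / 2)) hαm fun k => by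
    rw [Real.norm_of_nonneg (hα0 _)]; exact hα1 _
  refine ⟨h1.add h2, ?_⟩
  rw [integral_add h1 h2, mul_add]
  refine add_le_add (le_of_eq ?_) ?_
  · have : (fun h : 𝔼 => (Set.Iic δ).indicator (1 : ℝ → ℝ) ‖h‖) =
        (Metric.closedBall (0 : 𝔼) δ).indicator 1 := by
      ext h
      simp only [Set.indicator_apply, Set.mem_Iic, mem_closedBall_zero_iff, Pi.one_apply]
    rw [this, integral_indicator_one Metric.isClosed_closedBall.measurableSet, measureReal_def,
      Measure.addHaar_closedBall _ _ hδ, ENNReal.toReal_mul, ENNReal.toReal_ofReal (by positivity),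
      mul_comm, measureReal_def, finrank_euclideanSpace_fin]
  · rw [integral_fun_norm_addHaar volume ((Set.Iic b).indicator fun k => α (k / 2)),
      finrank_euclideanSpace_fin, nsmul_eq_mul, smul_eq_mul]
    have e1 : ∫ k in Set.Ioi (0 : ℝ), k ^ (d - 1) • (Set.Iic b).indicator (fun k => α (k / 2)) k =
        ∫ k in (0 : ℝ)..b, k ^ (d - 1) * α (k / 2) := by
      rw [intervalIntegral.integral_of_le hb, ← Set.Ioi_inter_Iic, Set.inter_comm,
        ← Measure.restrict_restrict measurableSet_Iic, ← integral_indicator measurableSet_Iic]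
      refine integral_congr_ae (Eventually.of_forall fun k => ?_)
      simp only [Set.indicator_apply, smul_eq_mul, mul_ite, mul_zero]
    have e2 : ∫ k in (0 : ℝ)..b, k ^ (d - 1) * α (k / 2) =
        2 ^ d * ∫ k in (0 : ℝ)..b / 2, k ^ (d - 1) * α k := by
      have h := intervalIntegral.integral_comp_div (a := 0) (b := b) (c := 2)
        (fun k => (2 * k) ^ (d - 1) * α k) two_ne_zero
      have h3 : ∀ k : ℝ, 2 * (k / 2) = k := fun k => by ring
      simp only [h3, zero_div] at h
      rw [h, smul_eq_mul, ← intervalIntegral.integral_const_mul,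
        ← intervalIntegral.integral_const_mul]
      refine intervalIntegral.integral_congr fun k _ => ?_
      obtain ⟨e, rfl⟩ : ∃ e, d = e + 1 := ⟨d - 1, by omega⟩
      simp only [Nat.add_sub_cancel]
      ring
    have e3 : ∫ k in (0 : ℝ)..b / 2, k ^ (d - 1) * α k ≤ ∫ k in (0 : ℝ)..b, k ^ (d - 1) * α k := by
      refine intervalIntegral.integral_mono_interval le_rfl (by positivity) (by linarith) ?_ ?_
      · refine (ae_restrict_mem measurableSet_Ioc).mono fun k hk => ?_
        exact mul_nonneg (pow_nonneg hk.1.le _) (hα0 k)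
      · exact (hα.intervalIntegrable).continuousOn_mul (by fun_prop)
    rw [e1, e2]
    have hv : 0 ≤ volume.real (Metric.ball (0 : 𝔼) 1) := measureReal_nonneg
    calc (d : ℝ) * (volume.real (Metric.ball (0 : 𝔼) 1) •
          (2 ^ d * ∫ k in (0 : ℝ)..b / 2, k ^ (d - 1) * α k))
        = volume.real (Metric.ball (0 : 𝔼) 1) *
          (d * 2 ^ d * ∫ k in (0 : ℝ)..b / 2, k ^ (d - 1) * α k) := by
            rw [smul_eq_mul]; ring
      _ ≤ _ := by gcongr

end Euclidean

/-! ### Slowly varying functions -/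

/-- Karamata's uniform convergence theorem near `1`. In logarithmic scale the differences
`h (x + s) - h x` tend to zero pointwise in `s`, hence in measure on `[0, 2]`; comparing the base
points `x` and `x + u` at a common good value of the third point gives uniformity in `u`. -/
theorem IsSlowlyVarying.tendsto_near_one {L : ℝ → ℝ} (hL : IsSlowlyVarying L) :
    Tendsto (fun p : ℝ × ℝ => L (p.1 * p.2) / L p.2) (𝓝 1 ×ˢ atTop) (𝓝 1) := by
  refine Filter.tendsto_of_seq_tendsto fun q hq => ?_
  have hb : Tendsto (fun n => (q n).1) atTop (𝓝 1) := tendsto_fst.comp hq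
  have hv : Tendsto (fun n => (q n).2) atTop atTop := tendsto_snd.comp hq
  let h : ℝ → ℝ := fun x => Real.log (L (Real.exp x))
  have hh : Measurable h := Real.measurable_log.comp (hL.measurable.comp Real.measurable_exp)
  let x : ℕ → ℝ := fun n => Real.log (q n).2
  let u : ℕ → ℝ := fun n => Real.log (q n).1
  have hx : Tendsto x atTop atTop := Real.tendsto_log_atTop.comp hv
  have hu : Tendsto u atTop (𝓝 0) := by
    have := (Real.continuousAt_log one_ne_zero).tendsto.comp hb
    rwa [Real.log_one] at this
  have hpt : ∀ w : ℕ → ℝ, Tendsto w atTop atTop → ∀ s : ℝ,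
      Tendsto (fun n => h (w n + s) - h (w n)) atTop (𝓝 0) := by
    intro w hw s
    have h1 := (hL.tendsto (Real.exp s) (Real.exp_pos s)).comp (Real.tendsto_exp_atTop.comp hw)
    have h2 := (Real.continuousAt_log one_ne_zero).tendsto.comp h1
    rw [Real.log_one] at h2
    refine h2.congr fun n => ?_
    simp only [Function.comp_apply, h]
    rw [Real.log_div (hL.pos _ (by positivity)).ne' (hL.pos _ (Real.exp_pos _)).ne',
      ← Real.exp_add, add_comm s]
  have hmeas : ∀ w : ℕ → ℝ, Tendsto w atTop atTop → ∀ ε : ℝ, 0 < ε → Tendsto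
      (fun n => volume (Set.Icc (0 : ℝ) 2 ∩ {s | ε ≤ |h (w n + s) - h (w n)|})) atTop (𝓝 0) := by
    intro w hw ε hε
    have hm : ∀ n, Measurable fun s => h (w n + s) - h (w n) := fun n =>
      (hh.comp (measurable_const_add _)).sub_const _
    have h1 : TendstoInMeasure (volume.restrict (Set.Icc (0 : ℝ) 2))
        (fun n s => h (w n + s) - h (w n)) atTop fun _ => 0 :=
      tendstoInMeasure_of_tendsto_ae (fun n => (hm n).aestronglyMeasurable)
        (Eventually.of_forall fun s => hpt w hw s)
    rw [tendstoInMeasure_iff_dist] at h1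
    refine (h1 ε hε).congr fun n => ?_
    rw [Measure.restrict_apply' measurableSet_Icc, Set.inter_comm]
    congr 2
    ext s
    simp
  have hxu : Tendsto (fun n => x n + u n) atTop atTop := hx.atTop_add hu
  have key : Tendsto (fun n => h (x n + u n) - h (x n)) atTop (𝓝 0) := by
    rw [Metric.tendsto_atTop']
    intro ε hε
    have e1 := (hmeas x hx (ε / 2) (by positivity)).eventually_lt_const
      (by simp : (0 : ℝ≥0∞) < ENNReal.ofReal (1 / 2))
    have e2 := (hmeas _ hxu (ε / 2) (by positivity)).eventually_lt_const
      (by simp : (0 : ℝ≥0∞) < ENNReal.ofReal (1 / 2))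
    have e3 : ∀ᶠ n in atTop, |u n| < 1 := by
      have := hu.abs
      rw [abs_zero] at this
      exact this.eventually_lt_const one_pos
    obtain ⟨n₀, hn₀⟩ := ((e1.and e2).and e3).exists_forall_of_atTop
    refine ⟨n₀, fun n hn => ?_⟩
    obtain ⟨⟨h1, h2⟩, h3⟩ := hn₀ n hn.le
    set B₁ := Set.Icc (0 : ℝ) 2 ∩ {s | ε / 2 ≤ |h (x n + s) - h (x n)|} with hB₁
    set B₂ := Set.Icc (0 : ℝ) 2 ∩ {s | ε / 2 ≤ |h (x n + u n + s) - h (x n + u n)|} with hB₂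
    -- The two intervals `[0, 2]` and `u + [0, 2]` share an interval of length at least `1`.
    let I : Set ℝ := Set.Icc (max 0 (u n)) (max 0 (u n) + 1)
    have hI : volume I = ENNReal.ofReal 1 := by
      rw [Real.volume_Icc]; congr 1; ring
    have hlt : volume (B₁ ∪ (u n +ᵥ B₂)) < volume I := by
      refine (measure_union_le _ _).trans_lt ?_
      rw [measure_vadd, hI, show (1 : ℝ) = 1 / 2 + 1 / 2 by norm_num,
        ENNReal.ofReal_add (by norm_num) (by norm_num)]
      exact ENNReal.add_lt_add h1 h2
    obtain ⟨s, hsI, hs⟩ : ∃ s ∈ I, s ∉ B₁ ∪ (u n +ᵥ B₂) := by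
      by_contra hcon
      push Not at hcon
      exact absurd (measure_mono (show I ⊆ _ from hcon)) (not_le.2 hlt)
    have hs1 : s ∉ B₁ := fun hh => hs (Or.inl hh)
    have hs2 : s - u n ∉ B₂ := fun hh => hs (Or.inr ⟨_, hh, by simp⟩)
    have habs := abs_lt.1 h3
    have hsI' : max 0 (u n) ≤ s ∧ s ≤ max 0 (u n) + 1 := hsI
    have hm0 : 0 ≤ max 0 (u n) := le_max_left _ _
    have hm1 : u n ≤ max 0 (u n) := le_max_right _ _
    have hm2 : max 0 (u n) ≤ 1 := max_le zero_le_one habs.2.le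
    have hm3 : max 0 (u n) ≤ u n + 1 := max_le (by linarith) (by linarith)
    have g1 : |h (x n + s) - h (x n)| < ε / 2 := by
      by_contra hcon
      exact hs1 ⟨⟨by linarith, by linarith⟩, not_lt.1 hcon⟩
    have g2 : |h (x n + u n + (s - u n)) - h (x n + u n)| < ε / 2 := by
      by_contra hcon
      exact hs2 ⟨⟨by linarith, by linarith⟩, not_lt.1 hcon⟩
    rw [show x n + u n + (s - u n) = x n + s by ring] at g2
    rw [Real.dist_eq, sub_zero]
    rw [abs_lt] at g1 g2 ⊢
    constructor <;> linarith
  have hexp := (Real.continuous_exp.tendsto 0).comp key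
  rw [Real.exp_zero] at hexp
  refine hexp.congr' ?_
  filter_upwards [hb.eventually_const_lt zero_lt_one, hv.eventually_gt_atTop 0] with n hn1 hn2
  simp only [Function.comp_apply, h, x, u]
  rw [Real.exp_sub, Real.exp_add, Real.exp_log hn1, Real.exp_log hn2,
    Real.exp_log (hL.pos _ (mul_pos hn2 hn1)), Real.exp_log (hL.pos _ hn2), mul_comm (q n).2]

/-- A regularly varying rate changes by a factor tending to one if its argument does, uniformly. -/
theorem tendsto_rate_ratio {τ ℓ : ℝ → ℝ} {β : ℝ} (hℓ : IsSlowlyVarying ℓ)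
    (hτ : ∀ u : ℝ, 0 < u → τ u = u ^ β * ℓ u) :
    Tendsto (fun p : ℝ × ℝ => τ p.2 / τ (p.1 * p.2)) (𝓝 1 ×ˢ atTop) (𝓝 1) := by
  have h1 : Tendsto (fun p : ℝ × ℝ => p.1 ^ β) (𝓝 1 ×ˢ atTop) (𝓝 1) := by
    have := (Real.continuousAt_rpow_const 1 β (Or.inl one_ne_zero)).tendsto
    rw [Real.one_rpow] at this
    exact this.comp tendsto_fst
  have h2 := (h1.mul hℓ.tendsto_near_one).inv₀ (by norm_num)
  rw [mul_one, inv_one] at h2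
  refine h2.congr' ?_
  filter_upwards [tendsto_fst.eventually (eventually_gt_nhds zero_lt_one),
    tendsto_snd.eventually (eventually_gt_atTop (0 : ℝ))] with p hp1 hp2
  have e := hℓ.pos p.2 hp2
  have e' := hℓ.pos _ (mul_pos hp1 hp2)
  rw [hτ _ hp2, hτ _ (mul_pos hp1 hp2), Real.mul_rpow hp1.le hp2.le]
  have := Real.rpow_pos_of_pos hp1 β
  have := Real.rpow_pos_of_pos hp2 β
  field_simp

/-! ### Concentration of the number of points -/

theorem integral_sq_sub_poissonMeasure (r : ℝ≥0) :
    Integrable (fun n : ℕ => ((n : ℝ) - r) ^ 2) (poissonMeasure r) ∧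
      ∫ n : ℕ, ((n : ℝ) - r) ^ 2 ∂(poissonMeasure r) = r := by
  let w : ℕ → ℝ := fun n => Real.exp (-r) * r ^ n / (n.factorial : ℝ)
  have h0 : HasSum w 1 := hasSum_one_poissonMeasure r
  have hw : ∀ n : ℕ, w (n + 1) * (n + 1 : ℕ) = r * w n := by
    intro n
    simp only [w, Nat.factorial_succ]
    have : (n.factorial : ℝ) ≠ 0 := by positivity
    push_cast
    field_simp
    ring
  have h1 : HasSum (fun n => w n * n) r := by
    rw [← hasSum_nat_add_iff' 1]
    simp only [hw]
    simpa using h0.mul_left (r : ℝ)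
  have h2 : HasSum (fun n => w n * (n : ℝ) ^ 2) (r * (r + 1)) := by
    rw [← hasSum_nat_add_iff' 1]
    have e : ∀ n : ℕ, w (n + 1) * ((n + 1 : ℕ) : ℝ) ^ 2 = r * (w n * n + w n) := by
      intro n
      rw [sq, ← mul_assoc, hw]
      push_cast; ring
    simp only [e]
    simpa using (h1.add h0).mul_left (r : ℝ)
  have h3 : HasSum (fun n => w n * ((n : ℝ) - r) ^ 2) r := by
    have := (h2.sub (h1.mul_left (2 * r : ℝ))).add (h0.mul_left ((r : ℝ) ^ 2))
    convert! this using 1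
    · ext n; ring
    · ring
  have hint : Integrable (fun n : ℕ => ((n : ℝ) - r) ^ 2) (poissonMeasure r) := by
    rw [integrable_poissonMeasure_iff]
    refine h3.summable.congr fun n => ?_
    rw [Real.norm_of_nonneg (sq_nonneg _)]
  refine ⟨hint, ?_⟩
  rw [integral_poissonMeasure]
  exact h3.tsum_eq

theorem hasLaw_pointCount {E Ω : Type*} [MeasurableSpace E] [MeasurableSpace Ω] {Λ : Measure E}
    {N : Ω → Measure E} {P : Measure Ω} (hN : IsPoissonRandomMeasure Λ N P) {A : Set E}
    (hA : MeasurableSet A) (hΛ : Λ A ≠ ∞) :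
    HasLaw (fun ω => pointCount (N ω) A) (poissonMeasure (Λ A).toNNReal) P := by
  have h := hN.poisson A hA hΛ
  have hg : Measurable fun x : ℝ≥0∞ => ⌊x.toReal⌋₊ :=
    Nat.measurable_floor.comp ENNReal.measurable_toReal
  refine ⟨hg.comp_aemeasurable h.aemeasurable, ?_⟩
  have e : (fun ω => pointCount (N ω) A) = (fun x : ℝ≥0∞ => ⌊x.toReal⌋₊) ∘ fun ω => N ω A := rfl
  rw [e, ← AEMeasurable.map_map_of_aemeasurable hg.aemeasurable h.aemeasurable, h.map_eq]
  rw [Measure.map_map hg (measurable_of_countable _)]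
  have : (fun x : ℝ≥0∞ => ⌊x.toReal⌋₊) ∘ (Nat.cast : ℕ → ℝ≥0∞) = id := by
    ext n; simp
  rw [this, Measure.map_id]

/-- Chebyshev's inequality for the number of points, whose variance equals its mean. -/
theorem measureReal_pointCount_le {E Ω : Type*} [MeasurableSpace E] [MeasurableSpace Ω]
    {Λ : Measure E} {N : Ω → Measure E} {P : Measure Ω} [IsProbabilityMeasure P]
    (hN : IsPoissonRandomMeasure Λ N P) {A : Set E}
    (hA : MeasurableSet A) (hΛ : Λ A ≠ ∞) (hpos : 0 < Λ.real A) {δ : ℝ} (hδ : 0 < δ) :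
    P.real {ω | δ * Λ.real A ≤ |(pointCount (N ω) A : ℝ) - Λ.real A|} ≤
      1 / (δ ^ 2 * Λ.real A) := by
  have h := hasLaw_pointCount hN hA hΛ
  obtain ⟨hint, hval⟩ := integral_sq_sub_poissonMeasure (Λ A).toNNReal
  have hr : (((Λ A).toNNReal : ℝ≥0) : ℝ) = Λ.real A := rfl
  rw [hr] at hint hval
  have h1 := mul_meas_ge_le_integral_of_nonneg (Eventually.of_forall fun n => sq_nonneg _) hint
    ((δ * Λ.real A) ^ 2)
  rw [hval] at h1
  have h2 : P.real {ω | δ * Λ.real A ≤ |(pointCount (N ω) A : ℝ) - Λ.real A|} =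
      (poissonMeasure (Λ A).toNNReal).real
        {n : ℕ | (δ * Λ.real A) ^ 2 ≤ ((n : ℝ) - Λ.real A) ^ 2} := by
    rw [← h.map_eq]
    generalize Λ.real A = V at hpos
    rw [measureReal_def, measureReal_def,
      Measure.map_apply_of_aemeasurable h.aemeasurable .of_discrete]
    congr 2
    ext ω
    change δ * V ≤ |(pointCount (N ω) A : ℝ) - V| ↔
      (δ * V) ^ 2 ≤ ((pointCount (N ω) A : ℝ) - V) ^ 2
    rw [sq_le_sq, abs_of_pos (mul_pos hδ hpos)]
  rw [h2, le_div_iff₀ (by positivity)]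
  have : (poissonMeasure (Λ A).toNNReal).real
      {n : ℕ | (δ * Λ.real A) ^ 2 ≤ ((n : ℝ) - Λ.real A) ^ 2} * (δ ^ 2 * Λ.real A) * Λ.real A ≤
      1 * Λ.real A := by
    linarith
  exact le_of_mul_le_mul_right this hpos

/-! ### Distribution functions -/

/-- A monotone function with values in `[0, 1]` that is close to a continuous distribution function
at finitely many suitable points is close to it everywhere. -/
theorem exists_finset_forall_abs_sub_le {G : ℝ → ℝ} (hG : Continuous G) (hmono : Monotone G)
    (hbot : Tendsto G atBot (𝓝 0)) (htop : Tendsto G atTop (𝓝 1)) {ε : ℝ} (hε : 0 < ε) :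
    ∃ t : Finset ℝ, ∀ L : ℝ → ℝ, Monotone L → (∀ x, 0 ≤ L x) → (∀ x, L x ≤ 1) →
      (∀ x ∈ t, |L x - G x| ≤ ε) → ∀ x, |L x - G x| ≤ 2 * ε := by
  obtain ⟨m, hm⟩ := exists_nat_gt (1 / ε)
  have hm0 : (0 : ℝ) < m := lt_trans (by positivity) hm
  have hmε : 1 / (m : ℝ) < ε := by
    rw [div_lt_iff₀ hm0]; rw [div_lt_iff₀ hε] at hm; linarith
  have hG0 : ∀ x, 0 ≤ G x := fun x => hmono.le_of_tendsto hbot x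
  have hG1 : ∀ x, G x ≤ 1 := fun x => hmono.ge_of_tendsto htop x
  have hex : ∀ j : ℕ, 0 < j → j < m → ∃ x, G x = j / m := by
    intro j hj hjm
    have hj' : (0 : ℝ) < j := by exact_mod_cast hj
    have hjm' : (j : ℝ) < m := by exact_mod_cast hjm
    refine mem_range_of_exists_le_of_exists_ge hG ?_ ?_
    · exact ((hbot.eventually_lt_const (div_pos hj' hm0)).exists).imp fun _ h => h.le
    · exact ((htop.eventually_const_lt ((div_lt_one hm0).2 hjm')).exists).imp fun _ h => h.le
  choose! p hp using hex
  refine ⟨(Finset.range m).image p, fun L hL hL0 hL1 hclose x => ?_⟩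
  have hcl : ∀ j : ℕ, 0 < j → j < m → |L (p j) - j / m| ≤ ε := fun j hj hjm => by
    rw [← hp j hj hjm]
    exact hclose _ (Finset.mem_image_of_mem p (Finset.mem_range.2 hjm))
  rw [abs_le]
  constructor
  · -- The largest grid value strictly below `G x`.
    set i : ℕ := ⌈(m : ℝ) * G x⌉₊ with hi
    have him : i ≤ m := by
      rw [hi, Nat.ceil_le]; exact mul_le_of_le_one_right hm0.le (hG1 x)
    have hle : (m : ℝ) * G x ≤ i := Nat.le_ceil _
    rcases Nat.lt_or_ge 1 i with h1 | h1
    · obtain ⟨j, hj⟩ : ∃ j, i = j + 1 := ⟨i - 1, by omega⟩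
      have hjlt : (j : ℝ) < m * G x := Nat.lt_ceil.1 (by omega)
      have hlt : G (p j) < G x := by
        rw [hp j (by omega) (by omega), div_lt_iff₀ hm0]; linarith
      have hpx : p j ≤ x := (hmono.reflect_lt hlt).le
      have := (abs_le.1 (hcl j (by omega) (by omega))).1
      have hLx := hL hpx
      rw [hj] at hle
      push_cast at hle
      have : G x ≤ j / m + 1 / m := by
        rw [← add_div, le_div_iff₀ hm0]; linarith
      linarith
    · have : (i : ℝ) ≤ 1 := by exact_mod_cast h1
      have : G x ≤ 1 / m := by
        rw [le_div_iff₀ hm0]; linarith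
      have := hL0 x
      linarith
  · set i : ℕ := ⌊(m : ℝ) * G x⌋₊ with hi
    have hle : (i : ℝ) ≤ m * G x := Nat.floor_le (mul_nonneg hm0.le (hG0 x))
    have hlt : (m : ℝ) * G x < i + 1 := Nat.lt_floor_add_one _
    have hi1 : ((i + 1 : ℕ) : ℝ) / m ≤ G x + 1 / m := by
      rw [div_le_iff₀ hm0, add_mul, div_mul_cancel₀ _ hm0.ne']; push_cast; linarith
    rcases Nat.lt_or_ge (i + 1) m with h1 | h1
    · have hlt' : G x < G (p (i + 1)) := by
        rw [hp _ (by omega) h1, lt_div_iff₀ hm0]; push_cast; linarith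
      have hLx := hL (hmono.reflect_lt hlt').le
      have := (abs_le.1 (hcl (i + 1) (by omega) h1)).2
      linarith
    · have : (1 : ℝ) ≤ ((i + 1 : ℕ) : ℝ) / m := by
        rw [one_le_div hm0]; exact_mod_cast h1
      have := hL1 x
      linarith

theorem sInf_quantile_mem_Icc {L : ℝ → ℝ} (hL : Monotone L) {q x₁ x₂ : ℝ} (h₁ : L x₁ < q)
    (h₂ : q ≤ L x₂) : sInf {x | q ≤ L x} ∈ Set.Icc x₁ x₂ := by
  have hlb : x₁ ∈ lowerBounds {x | q ≤ L x} := fun x hx =>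
    (hL.reflect_lt (h₁.trans_le hx)).le
  exact ⟨le_csInf ⟨x₂, h₂⟩ hlb, csInf_le ⟨x₁, hlb⟩ h₂⟩

theorem exists_continuousAt_mem_Ioo {G : ℝ → ℝ} (hG : Monotone G) {a b : ℝ} (hab : a < b) :
    ∃ x ∈ Set.Ioo a b, ContinuousAt G x := by
  by_contra hcon
  push Not at hcon
  have hc : (Set.Ioo a b).Countable :=
    hG.countable_not_continuousAt.mono fun x hx => hcon x hx
  exact (Cardinal.mk_Ioo_real hab ▸ Cardinal.aleph0_lt_continuum).not_ge
    (Cardinal.le_aleph0_iff_set_countable.2 hc)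

/-! ### Convergence in law -/

section Law

variable {Ω ι : Type*} [MeasurableSpace Ω] {P : Measure Ω} [IsProbabilityMeasure P]
  {T : ι → Ω → ℝ} {F : Filter ι} {Q : Measure ℝ} [IsProbabilityMeasure Q]

theorem tendsto_measureReal_le_of_continuousAt
    (h : TendstoInDistribution T F (id : ℝ → ℝ) (fun _ => P) Q) {x : ℝ}
    (hx : ContinuousAt (cdf Q) x) :
    Tendsto (fun i => P.real {ω | T i ω ≤ x}) F (𝓝 (cdf Q x)) := by
  have hQx : Q {x} = 0 := by
    conv_lhs => rw [← measure_cdf Q]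
    rw [StieltjesFunction.measure_singleton, ENNReal.ofReal_eq_zero]
    rw [leftLim_eq_of_tendsto (hx.tendsto.mono_left nhdsWithin_le_nhds)]
    simp
  have h1 := ProbabilityMeasure.tendsto_measure_of_null_frontier_of_tendsto' h.tendsto
    (E := Set.Iic x) (by simpa [frontier_Iic] using hQx)
  simp only [ProbabilityMeasure.coe_mk, Measure.map_id] at h1
  have h2 := (ENNReal.tendsto_toReal (measure_ne_top _ _)).comp h1
  rw [cdf_eq_real]
  convert! h2 using 1
  · ext i
    simp only [Function.comp_apply]
    rw [Measure.map_apply_of_aemeasurable (h.forall_aemeasurable i) measurableSet_Iic]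
    rfl

theorem eventually_measureReal_lt_of_isClosed
    (h : TendstoInDistribution T F (id : ℝ → ℝ) (fun _ => P) Q) {C : Set ℝ} (hC : IsClosed C)
    {ε : ℝ} (hε : Q.real C < ε) :
    ∀ᶠ i in F, P.real {ω | T i ω ∈ C} < ε := by
  have h1 := ProbabilityMeasure.limsup_measure_closed_le_of_tendsto h.tendsto hC
  have h2 : Q C < ENNReal.ofReal ε := by
    rw [measureReal_def] at hε
    rwa [← ENNReal.ofReal_toReal (measure_ne_top Q C),
      ENNReal.ofReal_lt_ofReal_iff (ENNReal.toReal_nonneg.trans_lt hε)]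
  have h3 := eventually_lt_of_limsup_lt (h1.trans_lt (by simpa using h2))
  filter_upwards [h3] with i hi
  simp only [ProbabilityMeasure.coe_mk] at hi
  rw [Measure.map_apply_of_aemeasurable (h.forall_aemeasurable i) hC.measurableSet] at hi
  rw [measureReal_def]
  have hε0 : 0 < ε := measureReal_nonneg.trans_lt hε
  rw [← ENNReal.toReal_ofReal hε0.le]
  exact (ENNReal.toReal_lt_toReal (measure_ne_top _ _) (by simp)).2 hi

end Law

/-! ### Averages over block locations -/

section Averages

variable {X Ω : Type*} [MeasurableSpace X] [MeasurableSpace Ω]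

theorem integral_measureReal_section_comm (m : Measure X) [IsFiniteMeasure m] (P : Measure Ω)
    [IsFiniteMeasure P] {B : Set (X × Ω)} (hB : MeasurableSet B) :
    ∫ ω, m.real {x | (x, ω) ∈ B} ∂P = ∫ x, P.real {ω | (x, ω) ∈ B} ∂m := by
  have h1 : Measurable fun ω => m {x | (x, ω) ∈ B} := measurable_measure_prodMk_right hB
  have h2 : Measurable fun x => P {ω | (x, ω) ∈ B} := measurable_measure_prodMk_left hB
  simp_rw [measureReal_def]
  rw [integral_toReal h1.aemeasurable (Eventually.of_forall fun _ => measure_lt_top _ _),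
    integral_toReal h2.aemeasurable (Eventually.of_forall fun _ => measure_lt_top _ _)]
  congr 1
  exact (Measure.prod_apply_symm hB).symm.trans (Measure.prod_apply hB)

theorem measurable_measureReal_section (m : Measure X) [IsFiniteMeasure m]
    {B : Set (X × Ω)} (hB : MeasurableSet B) : Measurable fun ω => m.real {x | (x, ω) ∈ B} :=
  (measurable_measure_prodMk_right hB).ennreal_toReal

/-- If every section of `B` has small probability, then with high probability `B` occupies a small
part of the locations. -/
theorem measureReal_le_measureReal_section (m : Measure X) [IsFiniteMeasure m] (P : Measure Ω)
    [IsProbabilityMeasure P] {B : Set (X × Ω)} (hB : MeasurableSet B) {ε η : ℝ}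
    (hm : 0 < m.real Set.univ) (hη : 0 < η) (h : ∀ᵐ x ∂m, P.real {ω | (x, ω) ∈ B} ≤ ε) :
    P.real {ω | η * m.real Set.univ ≤ m.real {x | (x, ω) ∈ B}} ≤ ε / η := by
  have hint : Integrable (fun ω => m.real {x | (x, ω) ∈ B}) P :=
    Integrable.of_bound (measurable_measureReal_section m hB).aestronglyMeasurable
      (m.real Set.univ) (Eventually.of_forall fun ω => by
        rw [Real.norm_of_nonneg measureReal_nonneg]
        exact measureReal_mono (Set.subset_univ _))
  have h1 := mul_meas_ge_le_integral_of_nonneg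
    (Eventually.of_forall fun ω => measureReal_nonneg) hint (η * m.real Set.univ)
  rw [integral_measureReal_section_comm m P hB] at h1
  have h2 : ∫ x, P.real {ω | (x, ω) ∈ B} ∂m ≤ ∫ _, ε ∂m := by
    refine integral_mono_of_nonneg (Eventually.of_forall fun _ => measureReal_nonneg)
      (integrable_const _) h
  rw [integral_const, smul_eq_mul] at h2
  rw [le_div_iff₀ hη]
  have h3 := h1.trans h2
  have h4 : (P.real {ω | η * m.real Set.univ ≤ m.real {x | (x, ω) ∈ B}} * η) * m.real Set.univ ≤
      ε * m.real Set.univ := by linarith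
  exact le_of_mul_le_mul_right h4 hm

/-- Chebyshev's inequality for the proportion of locations at which an event occurs. -/
theorem measureReal_abs_section_sub_le (m : Measure X) [IsFiniteMeasure m] (P : Measure Ω)
    [IsProbabilityMeasure P] {B : Set (X × Ω)} (hB : MeasurableSet B) {p η : ℝ}
    (hp0 : 0 ≤ p) (hp1 : p ≤ 1) (hm : 0 < m.real Set.univ) (hη : 0 < η)
    (hp : ∀ᵐ x ∂m, P.real {ω | (x, ω) ∈ B} = p) {C : X × X → ℝ} (hC : Integrable C (m.prod m))
    (hcov : ∀ᵐ z ∂(m.prod m),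
      P.real {ω | (z.1, ω) ∈ B ∧ (z.2, ω) ∈ B} -
        P.real {ω | (z.1, ω) ∈ B} * P.real {ω | (z.2, ω) ∈ B} ≤ C z) :
    P.real {ω | η ≤ |(m.real Set.univ)⁻¹ * m.real {x | (x, ω) ∈ B} - p|} ≤
      (∫ z, C z ∂(m.prod m)) / (η * m.real Set.univ) ^ 2 := by
  let f : X × Ω → ℝ := fun q => B.indicator 1 q - p
  have hf : Measurable f := (measurable_const.indicator hB).sub_const p
  have hsec : ∀ x, MeasurableSet {ω | (x, ω) ∈ B} := fun x => measurable_prodMk_left hB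
  have hf1 : ∀ q, |f q| ≤ 1 := by
    intro q
    by_cases hq : q ∈ B
    · simp only [f, Set.indicator_of_mem hq, Pi.one_apply]
      rw [abs_le]; constructor <;> linarith
    · simp only [f, Set.indicator_of_notMem hq]
      rw [abs_le]; constructor <;> linarith
  have hfC : ∀ᵐ z ∂(m.prod m), ∫ ω, f (z.1, ω) * f (z.2, ω) ∂P ≤ C z := by
    have hp₁ : ∀ᵐ z ∂(m.prod m), P.real {ω | (z.1, ω) ∈ B} = p :=
      Measure.quasiMeasurePreserving_fst.ae hp
    have hp₂ : ∀ᵐ z ∂(m.prod m), P.real {ω | (z.2, ω) ∈ B} = p :=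
      Measure.quasiMeasurePreserving_snd.ae hp
    filter_upwards [hp₁, hp₂, hcov] with z hz₁ hz₂ hz
    refine le_trans (le_of_eq ?_) hz
    have hi : ∀ x, Integrable ({ω | (x, ω) ∈ B}.indicator (1 : Ω → ℝ)) P := fun x =>
      (integrable_const (1 : ℝ)).indicator (hsec x)
    have hi2 : Integrable (({ω | (z.1, ω) ∈ B ∧ (z.2, ω) ∈ B}).indicator (1 : Ω → ℝ)) P :=
      (integrable_const (1 : ℝ)).indicator ((hsec _).inter (hsec _))
    have e : ∀ ω, f (z.1, ω) * f (z.2, ω) =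
        ({ω | (z.1, ω) ∈ B ∧ (z.2, ω) ∈ B}).indicator (1 : Ω → ℝ) ω -
          p * {ω | (z.1, ω) ∈ B}.indicator (1 : Ω → ℝ) ω -
          p * {ω | (z.2, ω) ∈ B}.indicator (1 : Ω → ℝ) ω + p * p := by
      intro ω
      by_cases h1 : (z.1, ω) ∈ B <;> by_cases h2 : (z.2, ω) ∈ B <;>
        simp [f, h1, h2, Set.indicator] <;> ring
    simp_rw [e]
    have hsplit : ∀ g₀ g₁ g₂ : Ω → ℝ, Integrable g₀ P → Integrable g₁ P → Integrable g₂ P →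
        ∫ ω, (g₀ ω - p * g₁ ω - p * g₂ ω + p * p) ∂P =
          ∫ ω, g₀ ω ∂P - p * ∫ ω, g₁ ω ∂P - p * ∫ ω, g₂ ω ∂P + p * p := by
      intro g₀ g₁ g₂ h₀ h₁ h₂
      have h₁' := h₁.const_mul p
      have h₂' := h₂.const_mul p
      rw [integral_add (f := fun ω => g₀ ω - p * g₁ ω - p * g₂ ω) ((h₀.sub h₁').sub h₂')
        (integrable_const _), integral_sub (f := fun ω => g₀ ω - p * g₁ ω) (h₀.sub h₁') h₂',
        integral_sub h₀ h₁', integral_const_mul, integral_const_mul]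
      simp
    have hinter : ∫ ω, ({ω | (z.1, ω) ∈ B ∧ (z.2, ω) ∈ B}).indicator (1 : Ω → ℝ) ω ∂P =
        P.real {ω | (z.1, ω) ∈ B ∧ (z.2, ω) ∈ B} :=
      integral_indicator_one ((hsec _).inter (hsec _))
    rw [hsplit _ _ _ hi2 (hi _) (hi _), integral_indicator_one (hsec _),
      integral_indicator_one (hsec _), hinter, hz₁, hz₂]
    ring
  have h1 := integral_sq_integral_le m P hf hf1 hC hfC
  have hxsec : ∀ ω, MeasurableSet {x | (x, ω) ∈ B} := fun ω => measurable_prodMk_right hB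
  have h2 : ∀ ω, ∫ x, f (x, ω) ∂m = m.real {x | (x, ω) ∈ B} - p * m.real Set.univ := by
    intro ω
    have e : ∀ x, f (x, ω) = {x | (x, ω) ∈ B}.indicator (1 : X → ℝ) x - p := fun x => rfl
    simp_rw [e]
    have hi : Integrable ({x | (x, ω) ∈ B}.indicator (1 : X → ℝ)) m :=
      (integrable_const (1 : ℝ)).indicator (hxsec ω)
    rw [integral_sub hi (integrable_const _), integral_indicator_one (hxsec ω), integral_const,
      smul_eq_mul, mul_comm p]
  simp_rw [h2] at h1
  have hint : Integrable (fun ω => (m.real {x | (x, ω) ∈ B} - p * m.real Set.univ) ^ 2) P := by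
    refine Integrable.of_bound
      (((measurable_measureReal_section m hB).sub_const _).pow_const 2).aestronglyMeasurable
      (m.real Set.univ ^ 2) (Eventually.of_forall fun ω => ?_)
    rw [Real.norm_of_nonneg (sq_nonneg _), sq_le_sq, abs_of_pos hm, abs_le]
    have h3 : 0 ≤ m.real {x | (x, ω) ∈ B} := measureReal_nonneg
    have h4 : m.real {x | (x, ω) ∈ B} ≤ m.real Set.univ := measureReal_mono (Set.subset_univ _)
    constructor <;> nlinarith
  have h3 := mul_meas_ge_le_integral_of_nonneg (Eventually.of_forall fun ω => sq_nonneg _) hint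
    ((η * m.real Set.univ) ^ 2)
  rw [le_div_iff₀ (by positivity), mul_comm]
  refine le_trans (le_of_eq ?_) (h3.trans h1)
  congr 2
  ext ω
  change η ≤ |(m.real Set.univ)⁻¹ * m.real {x | (x, ω) ∈ B} - p| ↔
    (η * m.real Set.univ) ^ 2 ≤ (m.real {x | (x, ω) ∈ B} - p * m.real Set.univ) ^ 2
  rw [sq_le_sq, abs_of_pos (mul_pos hη hm)]
  have e : m.real {x | (x, ω) ∈ B} - p * m.real Set.univ =
      ((m.real Set.univ)⁻¹ * m.real {x | (x, ω) ∈ B} - p) * m.real Set.univ := by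
    field_simp
  rw [e, abs_mul, abs_of_pos hm, mul_le_mul_iff_left₀ hm]

end Averages

section Blocks

variable {d : ℕ} {Ω₁ Ω₂ : Type*} [MeasurableSpace Ω₁] [MeasurableSpace Ω₂]

local notation "𝔼" => EuclideanSpace ℝ (Fin d)

/-- The proportion of locations in `A` at which the block configuration has a given property
concentrates around the probability of that property, with an error governed by the mixing
integral. -/
theorem measureReal_abs_average_sub_le (hd : 0 < d) {K : Set 𝔼} (hK : MeasurableSet K)
    (hKb : Bornology.IsBounded K) {P₁ : Measure Ω₁} [IsProbabilityMeasure P₁]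
    {P₂ : Measure Ω₂} [IsProbabilityMeasure P₂] {Z : 𝔼 → Ω₁ → ℝ}
    (hZ : Measurable (Function.uncurry Z)) {r : ℝ≥0}
    {N : Ω₂ → Measure 𝔼} (hN : IsPoissonRandomMeasure (r • (volume : Measure 𝔼)) N P₂)
    {s : ℝ} {A D : Set 𝔼} (hA : MeasurableSet A) (hAb : Bornology.IsBounded A)
    (hApos : 0 < volume.real A) (hD : MeasurableSet D) (hDfin : volume D ≠ ∞)
    (hAD : ∀ y ∈ A, region K s y ⊆ D) {𝒜 : Set (Measure (𝔼 × ℝ))} (h𝒜 : MeasurableSet 𝒜)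
    {p : ℝ} (hp : ∀ y ∈ A, (P₁.prod P₂).real {ω | localData K Z N s D (y, ω) ∈ 𝒜} = p)
    {η : ℝ} (hη : 0 < η) :
    (P₁.prod P₂).real {ω | η ≤ |(volume.real A)⁻¹ *
        (volume.restrict A).real {y | localData K Z N s D (y, ω) ∈ 𝒜} - p|} ≤
      (η ^ 2)⁻¹ * volume.real (Metric.ball (0 : 𝔼) 1) * ((volume.real A)⁻¹ *
        ((2 * Metric.diam (s • K)) ^ d + d * 2 ^ d * ∫ k in (0 : ℝ)..Metric.diam A,
          k ^ (d - 1) * mixingCoeff P₁ Z k (volume.real (convexHull ℝ (s • K))))) := by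
  set l := volume.real (convexHull ℝ (s • K))
  set δ := Metric.diam (s • K) with hδ
  set Δ := Metric.diam A with hΔ
  set V := volume.real A with hV
  have hAfin : volume A ≠ ∞ := hAb.measure_lt_top.ne
  have : IsFiniteMeasure (volume.restrict A) := ⟨by simpa using hAfin.lt_top⟩
  have hVm : (volume.restrict A).real Set.univ = V := by
    rw [measureReal_restrict_apply_univ]
  let α : ℝ → ℝ := fun k => mixingCoeff P₁ Z k l
  have hα : Antitone α := antitone_mixingCoeff P₁ Z l
  have hα0 : ∀ k, 0 ≤ α k := fun k => mixingCoeff_nonneg P₁ Z k l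
  have hα1 : ∀ k, α k ≤ 1 := fun k => mixingCoeff_le_one P₁ Z k l
  have hαm : Measurable fun k => α (k / 2) :=
    (hα.comp_monotone fun a b h => div_le_div_of_nonneg_right h zero_le_two).measurable
  -- Bound for the covariance at distance `k`: trivial up to `2 * δ`, and beyond that mixing at
  -- distance `k - δ ≥ k / 2`.
  let φ : ℝ → ℝ := fun k => (Set.Iic (2 * δ)).indicator 1 k +
    (Set.Iic Δ).indicator (fun k => α (k / 2)) k
  have hφm : Measurable φ := (measurable_const.indicator measurableSet_Iic).add
    (hαm.indicator measurableSet_Iic)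
  have hφ1 : ∀ k, 0 ≤ (Set.Iic (2 * δ)).indicator (1 : ℝ → ℝ) k := fun k =>
    Set.indicator_nonneg (fun _ _ => zero_le_one) k
  have hφ2 : ∀ k, 0 ≤ (Set.Iic Δ).indicator (fun k => α (k / 2)) k := fun k =>
    Set.indicator_nonneg (fun _ _ => hα0 _) k
  have hφ0 : ∀ k, 0 ≤ φ k := fun k => add_nonneg (hφ1 k) (hφ2 k)
  have hφM : ∀ k, φ k ≤ 2 := by
    intro k
    have h1 : (Set.Iic (2 * δ)).indicator (1 : ℝ → ℝ) k ≤ 1 :=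
      Set.indicator_le' (fun _ _ => le_rfl) (fun _ _ => zero_le_one) k
    have h2 : (Set.Iic Δ).indicator (fun k => α (k / 2)) k ≤ 1 :=
      Set.indicator_apply_le' (fun _ => hα1 _) fun _ => zero_le_one
    change _ + _ ≤ _
    linarith
  obtain ⟨hφint, hφle⟩ := integral_profile_norm (d := d) hd hα hα0 hα1
    (mul_nonneg zero_le_two Metric.diam_nonneg : 0 ≤ 2 * δ) (Metric.diam_nonneg : 0 ≤ Δ)
  obtain ⟨hCint, hCle⟩ := integral_prod_norm_sub_le hAfin hφm hφ0 hφM hφint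
  have hB : MeasurableSet {q : 𝔼 × (Ω₁ × Ω₂) | localData K Z N s D q ∈ 𝒜} :=
    (measurable_localData hK hZ hN.measurable s hD) h𝒜
  have hae : ∀ᵐ y ∂(volume.restrict A), y ∈ A := ae_restrict_mem hA
  have hae2 : ∀ᵐ z ∂((volume.restrict A).prod (volume.restrict A)), z.1 ∈ A ∧ z.2 ∈ A :=
    (Measure.quasiMeasurePreserving_fst.ae hae).and (Measure.quasiMeasurePreserving_snd.ae hae)
  obtain ⟨y₀, hy₀⟩ : A.Nonempty := by
    rw [Set.nonempty_iff_ne_empty]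
    rintro rfl
    simp [hV] at hApos
  have hmain := measureReal_abs_section_sub_le (volume.restrict A) (P₁.prod P₂) hB
    (p := p) (η := η) (hp y₀ hy₀ ▸ measureReal_nonneg) (hp y₀ hy₀ ▸ measureReal_le_one)
    (by rw [hVm]; exact hApos) hη (hae.mono fun y hy => hp y hy) hCint
    (hae2.mono fun z hz => ?_)
  · rw [hVm] at hmain
    refine hmain.trans ?_
    have h1 := hCle.trans (mul_le_mul_of_nonneg_left hφle measureReal_nonneg)
    refine (div_le_div_of_nonneg_right h1 (by positivity)).trans (le_of_eq ?_)
    change V * (volume.real (Metric.ball (0 : 𝔼) 1) * ((2 * δ) ^ d + d * 2 ^ d *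
      ∫ k in (0 : ℝ)..Δ, k ^ (d - 1) * α k)) / (η * V) ^ 2 =
      (η ^ 2)⁻¹ * volume.real (Metric.ball (0 : 𝔼) 1) * (V⁻¹ * ((2 * δ) ^ d + d * 2 ^ d *
        ∫ k in (0 : ℝ)..Δ, k ^ (d - 1) * α k))
    generalize (2 * δ) ^ d + d * 2 ^ d * ∫ k in (0 : ℝ)..Δ, k ^ (d - 1) * α k = I
    field_simp
  · refine (le_abs_self _).trans ?_
    have hkΔ : ‖z.2 - z.1‖ ≤ Δ := by
      rw [← dist_eq_norm]; exact Metric.dist_le_diam_of_mem hAb hz.2 hz.1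
    by_cases hk : ‖z.2 - z.1‖ ≤ 2 * δ
    · refine (abs_measureReal_inter_sub_le_one (P₁.prod P₂) {ω | localData K Z N s D (z.1, ω) ∈ 𝒜}
        {ω | localData K Z N s D (z.2, ω) ∈ 𝒜}).trans ?_
      have : φ ‖z.2 - z.1‖ = 1 + (Set.Iic Δ).indicator (fun k => α (k / 2)) ‖z.2 - z.1‖ := by
        simp only [φ]
        rw [Set.indicator_of_mem (show ‖z.2 - z.1‖ ∈ Set.Iic (2 * δ) from hk), Pi.one_apply]
      rw [this]
      linarith [hφ2 ‖z.2 - z.1‖]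
    · have hk' := not_le.1 hk
      have hδ0 : 0 ≤ δ := Metric.diam_nonneg
      have h1 := abs_cov_localData_le hK hKb (P₁ := P₁) hZ hN hD hDfin (hAD _ hz.1) (hAD _ hz.2)
        (k := ‖z.2 - z.1‖ / 2) (by linarith) (by rw [dist_comm, dist_eq_norm, ← hδ]; linarith) h𝒜
      refine h1.trans ?_
      have : φ ‖z.2 - z.1‖ = (Set.Iic (2 * δ)).indicator 1 ‖z.2 - z.1‖ + α (‖z.2 - z.1‖ / 2) := by
        simp only [φ]
        rw [Set.indicator_of_mem (show ‖z.2 - z.1‖ ∈ Set.Iic Δ from hkΔ)]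
      rw [this]
      linarith [hφ1 ‖z.2 - z.1‖]

end Blocks

/-! ### Consistency and coverage from convergence of averages -/

theorem tendsto_zero_of_forall_eventually_le {ι : Type*} {F : Filter ι} {f : ι → ℝ}
    (h0 : ∀ i, 0 ≤ f i) (h : ∀ ε : ℝ, 0 < ε → ∀ᶠ i in F, f i ≤ ε) : Tendsto f F (𝓝 0) := by
  rw [Metric.tendsto_nhds]
  intro ε hε
  filter_upwards [h (ε / 2) (by positivity)] with i hi
  rw [Real.dist_eq, sub_zero, abs_of_nonneg (h0 i)]
  linarith

theorem measureReal_le_of_ae_imp {Ω : Type*} [MeasurableSpace Ω] (P : Measure Ω)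
    [IsFiniteMeasure P] {A B : Set Ω} (h : ∀ᵐ ω ∂P, ω ∈ A → ω ∈ B) : P.real A ≤ P.real B :=
  ENNReal.toReal_mono (measure_ne_top _ _) (measure_mono_ae h)

section Averages

variable {X Ω : Type*} [MeasurableSpace X] [MeasurableSpace Ω]

/-- Consistency of a subsampling estimator. The sets `A n` carry all candidate locations, the
sets `S n` the admissible ones; `T` are the statistics entering the estimator and `R` the ideal
ones, centred at the true parameter. Bounding both the estimator and its complement from above
only uses `S n ⊆ A n`, so that the sets `S n` need not be measurable. -/
theorem tendstoInMeasure_subsampling (P : Measure Ω) [IsProbabilityMeasure P]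
    (m : Measure X) {A S : ℕ → Set X} (hA : ∀ n, MeasurableSet (A n)) (hfin : ∀ n, m (A n) ≠ ∞)
    (hSA : ∀ n, S n ⊆ A n)
    (hρ : Tendsto (fun n => m.real (A n) / m.real (S n)) atTop (𝓝 1))
    {T R : ℕ → X × Ω → ℝ} (hT : ∀ n, Measurable (T n)) (hR : ∀ n, Measurable (R n))
    {G : ℝ → ℝ} (hG : Monotone G) {x : ℝ} (hx : ContinuousAt G x)
    (hTR : ∀ δ : ℝ, 0 < δ → ∀ ε : ℝ, 0 < ε → ∀ᶠ n in atTop, ∀ y ∈ A n,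
      P.real {ω | δ < |T n (y, ω) - R n (y, ω)|} ≤ ε)
    (hU : ∀ x', ContinuousAt G x' → ∀ η : ℝ, 0 < η → Tendsto (fun n => P.real
      {ω | η ≤ |(m.real (A n))⁻¹ * (m.restrict (A n)).real {y | R n (y, ω) ≤ x'} - G x'|})
      atTop (𝓝 0))
    {L : ℕ → Ω → ℝ} (hL : ∀ᶠ n in atTop, ∀ᵐ ω ∂P, L n ω =
      (m.real (S n))⁻¹ * m.real ({y | T n (y, ω) ≤ x} ∩ S n)) :
    TendstoInMeasure P L atTop (fun _ => G x) := by
  rw [tendstoInMeasure_iff_measureReal_dist]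
  intro ε hε
  obtain ⟨δ₀, hδ₀, hclose⟩ := Metric.continuousAt_iff.1 hx (ε / 8) (by positivity)
  obtain ⟨x₁, hx₁, hc₁⟩ := exists_continuousAt_mem_Ioo hG (show x - δ₀ < x by linarith)
  obtain ⟨x₂, hx₂, hc₂⟩ := exists_continuousAt_mem_Ioo hG (show x < x + δ₀ by linarith)
  have hG₁ : |G x₁ - G x| < ε / 8 := hclose (by
    rw [Real.dist_eq, abs_lt]; constructor <;> linarith [hx₁.1, hx₁.2])
  have hG₂ : |G x₂ - G x| < ε / 8 := hclose (by
    rw [Real.dist_eq, abs_lt]; constructor <;> linarith [hx₂.1, hx₂.2])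
  obtain ⟨δ, hδ, hδ₁, hδ₂⟩ : ∃ δ, 0 < δ ∧ x₁ + δ ≤ x ∧ x + δ ≤ x₂ :=
    ⟨min (x - x₁) (x₂ - x), lt_min (by linarith [hx₁.2]) (by linarith [hx₂.1]),
      by linarith [min_le_left (x - x₁) (x₂ - x)], by linarith [min_le_right (x - x₁) (x₂ - x)]⟩
  have hup : ∀ᶠ n in atTop, m.real (A n) / m.real (S n) * (G x + 3 * ε / 8) < G x + ε := by
    have := hρ.mul_const (G x + 3 * ε / 8)
    exact this.eventually_lt_const (by linarith)
  have hlow : ∀ᶠ n in atTop,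
      m.real (A n) / m.real (S n) * (1 - G x + 3 * ε / 8) < 1 - G x + ε := by
    have := hρ.mul_const (1 - G x + 3 * ε / 8)
    exact this.eventually_lt_const (by linarith)
  refine tendsto_zero_of_forall_eventually_le (fun _ => measureReal_nonneg) fun e he => ?_
  filter_upwards [hup, hlow, hL, hρ.eventually_const_lt zero_lt_one,
    hTR δ hδ (e / 3 * (ε / 8)) (by positivity),
    (hU x₁ hc₁ (ε / 8) (by positivity)).eventually_lt_const (show (0 : ℝ) < e / 3 by positivity),
    (hU x₂ hc₂ (ε / 8) (by positivity)).eventually_lt_const (show (0 : ℝ) < e / 3 by positivity)]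
    with n hup hlow hL hρn hTR hB₁ hB₂
  have hSpos : 0 < m.real (S n) := by
    rcases eq_or_lt_of_le (measureReal_nonneg : 0 ≤ m.real (S n)) with h | h
    · rw [← h, div_zero] at hρn; exact absurd hρn (lt_irrefl _)
    · exact h
  have hApos : 0 < m.real (A n) := (div_pos_iff_of_pos_right hSpos).1 hρn
  have hSfin : m (S n) ≠ ∞ := ne_top_of_le_ne_top (hfin n) (measure_mono (hSA n))
  have : IsFiniteMeasure (m.restrict (A n)) := ⟨by simpa using (hfin n).lt_top⟩
  have hVm : (m.restrict (A n)).real Set.univ = m.real (A n) := measureReal_restrict_apply_univ _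
  let B : Set (X × Ω) := {q | δ < |T n q - R n q|}
  have hB : MeasurableSet B := measurableSet_lt measurable_const ((hT n).sub (hR n)).abs
  have hB₃ := measureReal_le_measureReal_section (m.restrict (A n)) P hB (η := ε / 8)
    (by rw [hVm]; exact hApos) (by positivity)
    ((ae_restrict_mem (hA n)).mono fun y hy => hTR y hy)
  rw [hVm, mul_div_assoc, div_self (by positivity), mul_one] at hB₃
  set E₁ := {ω | ε / 8 ≤
    |(m.real (A n))⁻¹ * (m.restrict (A n)).real {y | R n (y, ω) ≤ x₁} - G x₁|}
  set E₂ := {ω | ε / 8 ≤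
    |(m.real (A n))⁻¹ * (m.restrict (A n)).real {y | R n (y, ω) ≤ x₂} - G x₂|}
  set E₃ := {ω | ε / 8 * m.real (A n) ≤ (m.restrict (A n)).real {x | (x, ω) ∈ B}}
  have hsub : P.real {ω | ε ≤ dist (L n ω) (G x)} ≤ P.real (E₁ ∪ E₂ ∪ E₃) := by
    refine measureReal_le_of_ae_imp P ?_
    filter_upwards [hL] with ω hLω hω
    by_contra hnot
    have hn₁ : ω ∉ E₁ := fun h => hnot (Or.inl (Or.inl h))
    have hn₂ : ω ∉ E₂ := fun h => hnot (Or.inl (Or.inr h))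
    have hn₃ : ω ∉ E₃ := fun h => hnot (Or.inr h)
    have hu₁ : |(m.real (A n))⁻¹ * (m.restrict (A n)).real {y | R n (y, ω) ≤ x₁} - G x₁| <
      ε / 8 := not_le.1 hn₁
    have hu₂ : |(m.real (A n))⁻¹ * (m.restrict (A n)).real {y | R n (y, ω) ≤ x₂} - G x₂| <
      ε / 8 := not_le.1 hn₂
    have hu₃ : (m.restrict (A n)).real {x | (x, ω) ∈ B} < ε / 8 * m.real (A n) := not_le.1 hn₃
    have hTω : Measurable fun y => T n (y, ω) := (hT n).comp measurable_prodMk_right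
    have hRω : Measurable fun y => R n (y, ω) := (hR n).comp measurable_prodMk_right
    -- Measures of sections over the admissible locations are bounded by those over all locations.
    have hmono : ∀ C : Set X, MeasurableSet C → m.real (C ∩ S n) ≤ (m.restrict (A n)).real C := by
      intro C hC
      rw [measureReal_restrict_apply hC]
      exact measureReal_mono (Set.inter_subset_inter_right C (hSA n))
        (ne_top_of_le_ne_top (hfin n) (measure_mono Set.inter_subset_right))
    have hTm : MeasurableSet {y | T n (y, ω) ≤ x} := measurableSet_le hTω measurable_const
    have hRm : ∀ c, MeasurableSet {y | R n (y, ω) ≤ c} := fun c =>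
      measurableSet_le hRω measurable_const
    have hupper : m.real ({y | T n (y, ω) ≤ x} ∩ S n) ≤ m.real (A n) * (G x + 3 * ε / 8) := by
      have h1 : (m.restrict (A n)).real {y | T n (y, ω) ≤ x} ≤
          (m.restrict (A n)).real {y | R n (y, ω) ≤ x₂} +
            (m.restrict (A n)).real {y | (y, ω) ∈ B} := by
        refine (measureReal_mono ?_).trans (measureReal_union_le _ _)
        intro y hy
        have hy' : T n (y, ω) ≤ x := hy
        by_cases hb : (y, ω) ∈ B
        · exact Or.inr hb
        · have hb' : |T n (y, ω) - R n (y, ω)| ≤ δ := not_lt.1 hb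
          refine Or.inl (show R n (y, ω) ≤ x₂ from ?_)
          linarith [(abs_le.1 hb').1]
      have h2 : (m.restrict (A n)).real {y | R n (y, ω) ≤ x₂} ≤
          m.real (A n) * (G x₂ + ε / 8) := by
        have := (abs_lt.1 hu₂).2
        rw [sub_lt_iff_lt_add', inv_mul_lt_iff₀ hApos] at this
        exact this.le
      have h3 : m.real (A n) * G x₂ ≤ m.real (A n) * (G x + ε / 8) :=
        mul_le_mul_of_nonneg_left (by linarith [(abs_lt.1 hG₂).2]) hApos.le
      linarith [hmono _ hTm]
    have hlower : m.real (S n) - m.real ({y | T n (y, ω) ≤ x} ∩ S n) ≤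
        m.real (A n) * (1 - G x + 3 * ε / 8) := by
      have h0 : m.real (S n) ≤ m.real ({y | T n (y, ω) ≤ x} ∩ S n) +
          m.real ({y | T n (y, ω) ≤ x}ᶜ ∩ S n) := by
        refine (measureReal_mono (fun y hy => ?_) (measure_union_ne_top
          (ne_top_of_le_ne_top hSfin (measure_mono Set.inter_subset_right))
          (ne_top_of_le_ne_top hSfin (measure_mono Set.inter_subset_right)))).trans
          (measureReal_union_le _ _)
        by_cases h : y ∈ {y | T n (y, ω) ≤ x}
        · exact Or.inl ⟨h, hy⟩
        · exact Or.inr ⟨h, hy⟩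
      have h1 : (m.restrict (A n)).real {y | T n (y, ω) ≤ x}ᶜ ≤
          (m.restrict (A n)).real {y | R n (y, ω) ≤ x₁}ᶜ +
            (m.restrict (A n)).real {y | (y, ω) ∈ B} := by
        refine (measureReal_mono ?_).trans (measureReal_union_le _ _)
        intro y hy
        have hy' : x < T n (y, ω) := not_le.1 hy
        by_cases hb : (y, ω) ∈ B
        · exact Or.inr hb
        · have hb' : |T n (y, ω) - R n (y, ω)| ≤ δ := not_lt.1 hb
          refine Or.inl (show ¬ (R n (y, ω) ≤ x₁) from ?_)
          rw [not_le]
          linarith [(abs_le.1 hb').2]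
      have h2 : (m.restrict (A n)).real {y | R n (y, ω) ≤ x₁}ᶜ ≤
          m.real (A n) * (1 - G x₁ + ε / 8) := by
        rw [measureReal_compl (hRm x₁), hVm]
        have := (abs_lt.1 hu₁).1
        rw [lt_sub_iff_add_lt, lt_inv_mul_iff₀ hApos] at this
        linarith
      have h3 : m.real (A n) * (- G x₁) ≤ m.real (A n) * (- G x + ε / 8) :=
        mul_le_mul_of_nonneg_left (by linarith [(abs_lt.1 hG₁).1]) hApos.le
      linarith [hmono _ hTm.compl]
    have hLu : L n ω < G x + ε := by
      refine lt_of_le_of_lt ?_ hup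
      rw [hLω, div_mul_eq_mul_div, inv_mul_eq_div]
      exact div_le_div_of_nonneg_right hupper hSpos.le
    have hLl : 1 - L n ω < 1 - G x + ε := by
      refine lt_of_le_of_lt ?_ hlow
      rw [hLω, div_mul_eq_mul_div, inv_mul_eq_div, one_sub_div hSpos.ne']
      exact div_le_div_of_nonneg_right hlower hSpos.le
    have hω' : ε ≤ |L n ω - G x| := hω
    rcases le_abs'.1 hω' with h | h <;> linarith
  have h1 := measureReal_union_le (μ := P) (E₁ ∪ E₂) E₃
  have h2 := measureReal_union_le (μ := P) E₁ E₂
  linarith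

end Averages

section Conclusions

variable {Ω : Type*} [MeasurableSpace Ω] {P : Measure Ω} [IsProbabilityMeasure P]
  {J : Measure ℝ} {L : ℕ → ℝ → Ω → ℝ}

/-- Pólya's theorem in probability. -/
theorem tendstoInMeasure_iSup_abs_sub
    (hmono : ∀ n, ∀ᵐ ω ∂P, Monotone (fun x => L n x ω) ∧ ∀ x, 0 ≤ L n x ω ∧ L n x ω ≤ 1)
    (hcons : ∀ x, ContinuousAt (cdf J) x →
      TendstoInMeasure P (fun n ω => L n x ω) atTop (fun _ => cdf J x))
    (hJ : Continuous (cdf J)) :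
    TendstoInMeasure P (fun n ω => ⨆ x : ℝ, |L n x ω - cdf J x|) atTop (fun _ => (0 : ℝ)) := by
  rw [tendstoInMeasure_iff_measureReal_dist]
  intro ε hε
  obtain ⟨t, ht⟩ := exists_finset_forall_abs_sub_le hJ (monotone_cdf J) (tendsto_cdf_atBot J)
    (tendsto_cdf_atTop J) (show (0 : ℝ) < ε / 4 by positivity)
  have h0 : Tendsto (fun n => ∑ x ∈ t, P.real {ω | ε / 4 ≤ dist (L n x ω) (cdf J x)}) atTop
      (𝓝 0) := by
    have := tendsto_finsetSum t fun x _ =>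
      (tendstoInMeasure_iff_measureReal_dist.1 (hcons x hJ.continuousAt)) (ε / 4) (by positivity)
    simpa using this
  refine squeeze_zero (fun _ => measureReal_nonneg) (fun n => ?_) h0
  refine le_trans ?_ (measureReal_biUnion_finset_le (μ := P) t
    fun x => {ω | ε / 4 ≤ dist (L n x ω) (cdf J x)})
  refine measureReal_le_of_ae_imp P ?_
  filter_upwards [hmono n] with ω hω hεω
  by_contra hnot
  have hclose : ∀ x ∈ t, |L n x ω - cdf J x| ≤ ε / 4 := by
    intro x hx
    by_contra hcon
    exact hnot (Set.mem_biUnion hx (not_le.1 hcon).le)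
  have h1 := ht (fun x => L n x ω) hω.1 (fun x => (hω.2 x).1) (fun x => (hω.2 x).2) hclose
  have h2 : (⨆ x : ℝ, |L n x ω - cdf J x|) ≤ 2 * (ε / 4) := ciSup_le h1
  have h3 : 0 ≤ ⨆ x : ℝ, |L n x ω - cdf J x| := Real.iSup_nonneg fun x => abs_nonneg _
  have h4 : ε ≤ dist (⨆ x : ℝ, |L n x ω - cdf J x|) 0 := hεω
  rw [Real.dist_eq, sub_zero, abs_of_nonneg h3] at h4
  linarith

/-- Below the smallest and above the largest `q`-quantile, a distribution function differs strictly
from `q`; at the two end points it equals `q` if it is continuous there. -/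
theorem cdf_quantile_ends {q : ℝ} (hq0 : 0 < q) (hq1 : q < 1)
    (hlo : ContinuousAt (cdf J) (sInf {x : ℝ | q ≤ cdf J x}))
    (hhi : ContinuousAt (cdf J) (sSup {x : ℝ | cdf J x ≤ q})) :
    (cdf J (sInf {x : ℝ | q ≤ cdf J x}) = q ∧ ∀ x < sInf {x : ℝ | q ≤ cdf J x}, cdf J x < q) ∧
    (cdf J (sSup {x : ℝ | cdf J x ≤ q}) = q ∧ ∀ x > sSup {x : ℝ | cdf J x ≤ q}, q < cdf J x) := by
  have hmono := monotone_cdf J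
  obtain ⟨xa, hxa⟩ := ((tendsto_cdf_atBot J).eventually_lt_const hq0).exists
  obtain ⟨xb, hxb⟩ := ((tendsto_cdf_atTop J).eventually_const_lt hq1).exists
  have hbb : BddBelow {x : ℝ | q ≤ cdf J x} :=
    ⟨xa, fun x hx => (hmono.reflect_lt (hxa.trans_le hx)).le⟩
  have hba : BddAbove {x : ℝ | cdf J x ≤ q} :=
    ⟨xb, fun x hx => (hmono.reflect_lt (lt_of_le_of_lt hx hxb)).le⟩
  have h1 : ∀ x < sInf {x : ℝ | q ≤ cdf J x}, cdf J x < q := by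
    intro x hx
    by_contra hcon
    exact absurd (csInf_le hbb (not_lt.1 hcon)) (not_le.2 hx)
  have h2 : ∀ x > sSup {x : ℝ | cdf J x ≤ q}, q < cdf J x := by
    intro x hx
    by_contra hcon
    exact absurd (le_csSup hba (not_lt.1 hcon)) (not_le.2 hx)
  have h3 : ∀ x > sInf {x : ℝ | q ≤ cdf J x}, q ≤ cdf J x := by
    intro x hx
    obtain ⟨z, hz, hzx⟩ := exists_lt_of_csInf_lt ⟨xb, hxb.le⟩ hx
    exact le_trans hz (hmono hzx.le)
  have h4 : ∀ x < sSup {x : ℝ | cdf J x ≤ q}, cdf J x ≤ q := by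
    intro x hx
    obtain ⟨z, hz, hzx⟩ := exists_lt_of_lt_csSup ⟨xa, hxa.le⟩ hx
    exact le_trans (hmono hzx.le) hz
  have hle : ∀ c, ContinuousAt (cdf J) c → (∀ x < c, cdf J x ≤ q) → cdf J c ≤ q := by
    intro c hc h
    exact le_of_tendsto (hc.tendsto.mono_left nhdsWithin_le_nhds : Tendsto _ (𝓝[<] c) _)
      (eventually_mem_nhdsWithin.mono h)
  have hge : ∀ c, ContinuousAt (cdf J) c → (∀ x > c, q ≤ cdf J x) → q ≤ cdf J c := by
    intro c hc h
    exact ge_of_tendsto (hc.tendsto.mono_left nhdsWithin_le_nhds : Tendsto _ (𝓝[>] c) _)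
      (eventually_mem_nhdsWithin.mono h)
  exact ⟨⟨le_antisymm (hle _ hlo fun x hx => (h1 x hx).le) (hge _ hlo h3), h1⟩,
    ⟨le_antisymm (hle _ hhi h4) (hge _ hhi fun x hx => (h2 x hx).le), h2⟩⟩

/-- Asymptotic coverage: a statistic with limit law `J` falls below the estimated `q`-quantile with
probability tending to `q`. -/
theorem tendsto_measureReal_le_quantile [IsProbabilityMeasure J]
    (hmono : ∀ n, ∀ᵐ ω ∂P, Monotone (fun x => L n x ω) ∧ ∀ x, 0 ≤ L n x ω ∧ L n x ω ≤ 1)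
    (hcons : ∀ x, ContinuousAt (cdf J) x →
      TendstoInMeasure P (fun n ω => L n x ω) atTop (fun _ => cdf J x))
    {T : ℕ → Ω → ℝ} (hT : TendstoInDistribution T atTop (id : ℝ → ℝ) (fun _ => P) J)
    {q : ℝ} (hq0 : 0 < q) (hq1 : q < 1)
    (hlo : ContinuousAt (cdf J) (sInf {x : ℝ | q ≤ cdf J x}))
    (hhi : ContinuousAt (cdf J) (sSup {x : ℝ | cdf J x ≤ q})) :
    Tendsto (fun n => P.real {ω | T n ω ≤ sInf {x | q ≤ L n x ω}}) atTop (𝓝 q) := by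
  obtain ⟨⟨hlo1, hlo2⟩, ⟨hhi1, hhi2⟩⟩ := cdf_quantile_ends hq0 hq1 hlo hhi
  set lo := sInf {x : ℝ | q ≤ cdf J x}
  set hi := sSup {x : ℝ | cdf J x ≤ q}
  rw [Metric.tendsto_nhds]
  intro ε hε
  obtain ⟨δ₁, hδ₁, hc₁⟩ := Metric.continuousAt_iff.1 hlo (ε / 3) (by positivity)
  obtain ⟨δ₂, hδ₂, hc₂⟩ := Metric.continuousAt_iff.1 hhi (ε / 3) (by positivity)
  obtain ⟨x₁, hx₁, hcx₁⟩ :=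
    exists_continuousAt_mem_Ioo (monotone_cdf J) (show lo - δ₁ < lo by linarith)
  obtain ⟨x₂, hx₂, hcx₂⟩ :=
    exists_continuousAt_mem_Ioo (monotone_cdf J) (show hi < hi + δ₂ by linarith)
  have hG₁ : |cdf J x₁ - q| < ε / 3 := hlo1 ▸ hc₁ (by
    rw [Real.dist_eq, abs_lt]; constructor <;> linarith [hx₁.1, hx₁.2])
  have hG₂ : |cdf J x₂ - q| < ε / 3 := hhi1 ▸ hc₂ (by
    rw [Real.dist_eq, abs_lt]; constructor <;> linarith [hx₂.1, hx₂.2])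
  have hlt₁ : cdf J x₁ < q := hlo2 x₁ hx₁.2
  have hlt₂ : q < cdf J x₂ := hhi2 x₂ hx₂.1
  have hT₁ := (tendsto_measureReal_le_of_continuousAt hT hcx₁).eventually_const_lt
    (show cdf J x₁ - ε / 3 < cdf J x₁ by linarith)
  have hT₂ := (tendsto_measureReal_le_of_continuousAt hT hcx₂).eventually_lt_const
    (show cdf J x₂ < cdf J x₂ + ε / 3 by linarith)
  have hL₁ := ((tendstoInMeasure_iff_measureReal_dist.1 (hcons x₁ hcx₁)) (q - cdf J x₁)
    (by linarith)).eventually_lt_const (show (0 : ℝ) < ε / 6 by positivity)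
  have hL₂ := ((tendstoInMeasure_iff_measureReal_dist.1 (hcons x₂ hcx₂)) (cdf J x₂ - q)
    (by linarith)).eventually_lt_const (show (0 : ℝ) < ε / 6 by positivity)
  filter_upwards [hT₁, hT₂, hL₁, hL₂] with n hT₁ hT₂ hL₁ hL₂
  set E₁ := {ω | q - cdf J x₁ ≤ dist (L n x₁ ω) (cdf J x₁)} with hE₁
  set E₂ := {ω | cdf J x₂ - q ≤ dist (L n x₂ ω) (cdf J x₂)} with hE₂
  have hquant : ∀ᵐ ω ∂P, ω ∉ E₁ ∪ E₂ → sInf {x | q ≤ L n x ω} ∈ Set.Icc x₁ x₂ := by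
    filter_upwards [hmono n] with ω hω hnot
    have hn₁ : dist (L n x₁ ω) (cdf J x₁) < q - cdf J x₁ := not_le.1 fun h => hnot (Or.inl h)
    have hn₂ : dist (L n x₂ ω) (cdf J x₂) < cdf J x₂ - q := not_le.1 fun h => hnot (Or.inr h)
    rw [Real.dist_eq, abs_lt] at hn₁ hn₂
    exact sInf_quantile_mem_Icc hω.1 (by linarith [hn₁.2]) (by linarith [hn₂.1])
  have hE : P.real (E₁ ∪ E₂) < ε / 3 := by
    have := measureReal_union_le (μ := P) E₁ E₂
    linarith
  have hup : P.real {ω | T n ω ≤ sInf {x | q ≤ L n x ω}} ≤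
      P.real ({ω | T n ω ≤ x₂} ∪ (E₁ ∪ E₂)) := by
    refine measureReal_le_of_ae_imp P ?_
    filter_upwards [hquant] with ω hω hTω
    by_cases h : ω ∈ E₁ ∪ E₂
    · exact Or.inr h
    · exact Or.inl (le_trans hTω (hω h).2)
  have hlow : P.real {ω | T n ω ≤ x₁} ≤
      P.real ({ω | T n ω ≤ sInf {x | q ≤ L n x ω}} ∪ (E₁ ∪ E₂)) := by
    refine measureReal_le_of_ae_imp P ?_
    filter_upwards [hquant] with ω hω hTω
    by_cases h : ω ∈ E₁ ∪ E₂
    · exact Or.inr h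
    · exact Or.inl (le_trans hTω (hω h).1)
  have h1 := measureReal_union_le (μ := P) {ω | T n ω ≤ x₂} (E₁ ∪ E₂)
  have h2 := measureReal_union_le (μ := P) {ω | T n ω ≤ sInf {x | q ≤ L n x ω}} (E₁ ∪ E₂)
  rw [abs_lt] at hG₁ hG₂
  rw [Real.dist_eq, abs_lt]
  constructor <;> linarith [hG₁.1, hG₂.2]

theorem tendsto_measureReal_of_iff {A B E : ℕ → Set Ω} {p : ℝ}
    (hA : Tendsto (fun n => P.real (A n)) atTop (𝓝 p))
    (hE : Tendsto (fun n => P.real (E n)) atTop (𝓝 0))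
    (h : ∀ n, ∀ ω, ω ∉ E n → (ω ∈ A n ↔ ω ∈ B n)) :
    Tendsto (fun n => P.real (B n)) atTop (𝓝 p) := by
  have h1 : ∀ n, |P.real (B n) - P.real (A n)| ≤ P.real (E n) := by
    intro n
    have e1 : P.real (B n) ≤ P.real (A n) + P.real (E n) := by
      refine (measureReal_mono fun ω hω => ?_).trans (measureReal_union_le _ _)
      by_cases hE : ω ∈ E n
      · exact Or.inr hE
      · exact Or.inl ((h n ω hE).2 hω)
    have e2 : P.real (A n) ≤ P.real (B n) + P.real (E n) := by
      refine (measureReal_mono fun ω hω => ?_).trans (measureReal_union_le _ _)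
      by_cases hE : ω ∈ E n
      · exact Or.inr hE
      · exact Or.inl ((h n ω hE).1 hω)
    rw [abs_le]; constructor <;> linarith
  have h2 : Tendsto (fun n => P.real (B n) - P.real (A n)) atTop (𝓝 0) :=
    squeeze_zero_norm h1 hE
  simpa using h2.add hA

end Conclusions

/-! ### Admissible block locations -/

section Geometry

variable {d : ℕ}

local notation "𝔼" => EuclideanSpace ℝ (Fin d)

theorem blockLocations_subset (A B : Set 𝔼) : blockLocations A B ⊆ A := fun _ h => h.1

theorem blockLocations_smul {t : ℝ} (ht : t ≠ 0) (A B : Set 𝔼) :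
    blockLocations (t • A) (t • B) = t • blockLocations A B := by
  ext y
  obtain ⟨x, rfl⟩ : ∃ x, y = t • x := ⟨t⁻¹ • y, by rw [smul_smul, mul_inv_cancel₀ ht, one_smul]⟩
  rw [Set.smul_mem_smul_set_iff₀ ht]
  change t • x ∈ t • A ∧ t • x +ᵥ t • B ⊆ t • A ↔ x ∈ A ∧ x +ᵥ B ⊆ A
  have h : t • x +ᵥ t • B = t • (x +ᵥ B) := by
    ext z
    constructor
    · rintro ⟨_, ⟨w, hw, rfl⟩, rfl⟩
      exact ⟨x + w, ⟨w, hw, rfl⟩, by simp [smul_add]⟩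
    · rintro ⟨_, ⟨w, hw, rfl⟩, rfl⟩
      exact ⟨t • w, ⟨w, hw, rfl⟩, by simp [smul_add]⟩
  rw [h, Set.smul_mem_smul_set_iff₀ ht, Set.smul_set_subset_smul_set_iff₀ ht]

theorem volume_real_smul {t : ℝ} (ht : 0 ≤ t) (A : Set 𝔼) :
    volume.real (t • A) = t ^ d * volume.real A := by
  rw [measureReal_def, Measure.addHaar_smul, finrank_euclideanSpace_fin, ENNReal.toReal_mul,
    abs_of_nonneg (pow_nonneg ht d), ENNReal.toReal_ofReal (pow_nonneg ht d), measureReal_def]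

/-- Asymptotically, all locations in a set with null boundary are admissible for small blocks:
every interior point is. -/
theorem tendsto_volume_blockLocations {K : Set 𝔼}
    (hKb : Bornology.IsBounded K) (hfront : volume (frontier K) = 0) {c : ℕ → ℝ}
    (hc0 : ∀ n, 0 ≤ c n) (hc : Tendsto c atTop (𝓝 0)) :
    Tendsto (fun n => volume.real (blockLocations K (c n • K))) atTop (𝓝 (volume.real K)) := by
  obtain ⟨M, hM⟩ := hKb.exists_norm_le
  have hfin : volume K ≠ ∞ := hKb.measure_lt_top.ne
  have hint : volume (interior K) = volume K := by
    refine le_antisymm (measure_mono interior_subset) ?_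
    calc volume K ≤ volume (closure K) := measure_mono subset_closure
      _ = volume (interior K ∪ frontier K) := by rw [closure_eq_interior_union_frontier]
      _ ≤ volume (interior K) + volume (frontier K) := measure_union_le _ _
      _ = volume (interior K) := by rw [hfront, add_zero]
  let G : ℕ → Set 𝔼 := fun j => {y | ENNReal.ofReal (1 / (j + 1)) < Metric.infEDist y Kᶜ}
  have hGmono : Monotone G := by
    intro i j hij y hy
    refine lt_of_le_of_lt (ENNReal.ofReal_le_ofReal ?_) hy
    exact one_div_le_one_div_of_le (by positivity) (by exact_mod_cast Nat.succ_le_succ hij)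
  have hGU : ⋃ j, G j = interior K := by
    ext y
    rw [Set.mem_iUnion]
    have hy : y ∈ interior K ↔ 0 < Metric.infEDist y Kᶜ := by
      rw [pos_iff_ne_zero, ne_eq, ← Metric.mem_closure_iff_infEDist_zero, closure_compl,
        Set.mem_compl_iff, not_not]
    rw [hy]
    constructor
    · rintro ⟨j, hj⟩
      exact zero_le.trans_lt hj
    · intro hpos
      have hlim : Tendsto (fun j : ℕ => ENNReal.ofReal (1 / ((j : ℝ) + 1))) atTop (𝓝 0) := by
        have := ENNReal.tendsto_ofReal tendsto_one_div_add_atTop_nhds_zero_nat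
        rwa [ENNReal.ofReal_zero] at this
      exact (hlim.eventually_lt_const hpos).exists
  have hlim : Tendsto (fun j => volume.real (G j)) atTop (𝓝 (volume.real K)) := by
    have h1 := tendsto_measure_iUnion_atTop (μ := (volume : Measure 𝔼)) hGmono
    rw [hGU, hint] at h1
    exact (ENNReal.tendsto_toReal hfin).comp h1
  have hle : ∀ n, volume.real (blockLocations K (c n • K)) ≤ volume.real K := fun n =>
    measureReal_mono (blockLocations_subset _ _) hfin
  rw [tendsto_order]
  refine ⟨fun v hv => ?_, fun v hv => Eventually.of_forall fun n => (hle n).trans_lt hv⟩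
  obtain ⟨j, hj⟩ := (hlim.eventually_const_lt hv).exists
  have hcM : Tendsto (fun n => c n * M) atTop (𝓝 0) := by
    simpa using hc.mul_const M
  filter_upwards [hcM.eventually_lt_const (show (0 : ℝ) < 1 / (j + 1) by positivity)] with n hn
  refine hj.trans_le (measureReal_mono (fun y hy => ?_)
    (ne_top_of_le_ne_top hfin (measure_mono (blockLocations_subset _ _))))
  have hball : ∀ z, dist y z ≤ 1 / (j + 1) → z ∈ K := by
    intro z hz
    by_contra hzK
    have h1 : Metric.infEDist y Kᶜ ≤ edist y z := Metric.infEDist_le_edist_of_mem hzK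
    rw [edist_dist] at h1
    exact absurd (h1.trans (ENNReal.ofReal_le_ofReal hz)) (not_le.2 hy)
  refine ⟨hball y (by rw [dist_self]; positivity), ?_⟩
  rintro _ ⟨_, ⟨k, hk, rfl⟩, rfl⟩
  refine hball _ ?_
  simp only [vadd_eq_add, dist_self_add_right, norm_smul, Real.norm_eq_abs, abs_of_nonneg (hc0 n)]
  exact (mul_le_mul_of_nonneg_left (hM k hk) (hc0 n)).trans hn.le

theorem tendsto_volume_ratio_blockLocations {K : Set 𝔼}
    (hKb : Bornology.IsBounded K) (hpos : 0 < volume K) (hfront : volume (frontier K) = 0)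
    {c : ℕ → ℝ} (hc0 : ∀ n, 0 ≤ c n) (hc : Tendsto c atTop (𝓝 0)) :
    Tendsto (fun n : ℕ => volume.real ((n : ℝ) • K) /
      volume.real (blockLocations ((n : ℝ) • K) (c n • ((n : ℝ) • K)))) atTop (𝓝 1) := by
  have hV : volume.real K ≠ 0 :=
    (ENNReal.toReal_pos hpos.ne' hKb.measure_lt_top.ne).ne'
  have h := (tendsto_const_nhds (x := volume.real K)).div
    (tendsto_volume_blockLocations hKb hfront hc0 hc) hV
  rw [div_self hV] at h
  refine h.congr' ?_
  filter_upwards [eventually_gt_atTop 0] with n hn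
  have hn' : (0 : ℝ) < n := by exact_mod_cast hn
  rw [smul_comm (c n) (n : ℝ) K, blockLocations_smul hn'.ne', volume_real_smul hn'.le,
    volume_real_smul hn'.le, mul_div_mul_left _ _ (by positivity)]
  rfl

/-- A ball containing the region `n • K` and all blocks located in it. -/
theorem exists_window {K : Set 𝔼} (hKb : Bornology.IsBounded K) :
    ∃ M : ℝ, ∀ n : ℕ, ∀ c : ℝ, c ∈ Set.Ioo (0 : ℝ) 1 →
      region K n 0 ⊆ Metric.closedBall 0 (n * M) ∧
      ∀ y ∈ (n : ℝ) • K, region K (c * n) y ⊆ Metric.closedBall 0 (n * M) := by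
  obtain ⟨M, hM⟩ := hKb.exists_norm_le
  have hn : ∀ n : ℕ, ∀ k ∈ K, (n : ℝ) * ‖k‖ ≤ n * M := fun n k hk =>
    mul_le_mul_of_nonneg_left (hM k hk) (Nat.cast_nonneg n)
  refine ⟨2 * M, fun n c hc => ⟨?_, ?_⟩⟩
  · rintro _ ⟨_, ⟨k, hk, rfl⟩, rfl⟩
    rw [mem_closedBall_zero_iff]
    simp only [vadd_eq_add, zero_add, norm_smul, Real.norm_natCast]
    have h1 := hn n k hk
    have h2 : 0 ≤ (n : ℝ) * ‖k‖ := by positivity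
    linarith
  · rintro _ ⟨k', hk', rfl⟩ _ ⟨_, ⟨k, hk, rfl⟩, rfl⟩
    rw [mem_closedBall_zero_iff]
    simp only [vadd_eq_add]
    refine (norm_add_le _ _).trans ?_
    rw [norm_smul, norm_smul, norm_mul, Real.norm_natCast, Real.norm_of_nonneg hc.1.le]
    have h1 := hn n k hk
    have h2 := hn n k' hk'
    have h3 : 0 ≤ (n : ℝ) * ‖k‖ := by positivity
    have h4 : c * n * ‖k‖ ≤ n * ‖k‖ := by
      rw [mul_assoc]; exact mul_le_of_le_one_left h3 hc.2.le
    linarith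

end Geometry

/-! ### Statistics of a marked configuration -/

section Statistics

variable {d : ℕ} {Ω₁ Ω₂ : Type*} [MeasurableSpace Ω₁] [MeasurableSpace Ω₂]

local notation "𝔼" => EuclideanSpace ℝ (Fin d)

/-- The number of points of a marked configuration. -/
noncomputable def configCount {F : Type*} [MeasurableSpace F] (M : Measure F) : ℕ :=
  pointCount M Set.univ

theorem measurable_configCount {F : Type*} [MeasurableSpace F] :
    Measurable (configCount : Measure F → ℕ) :=
  Nat.measurable_floor.comp
    (ENNReal.measurable_toReal.comp (Measure.measurable_coe MeasurableSet.univ))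

theorem configCount_markedData {K : Set 𝔼} {z : 𝔼 → ℝ} (hz : Measurable z) (ν : Measure 𝔼) (s : ℝ)
    (y : 𝔼) : configCount (markedData K ν z s y) = pointCount ν (region K s y) := by
  rw [configCount, pointCount, pointCount, markedData, Measure.map_apply (by fun_prop)
    MeasurableSet.univ, Set.preimage_univ, Measure.restrict_apply_univ]

/-- The studentized statistic of a marked configuration, centred at `θ`. -/
noncomputable def studentized (muHat sigmaHat : ℝ → Measure (𝔼 × ℝ) → ℝ) (τ : ℝ → ℝ) (s : ℝ)
    (θ : ℝ) (M : Measure (𝔼 × ℝ)) : ℝ :=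
  τ (configCount M) * ((muHat s M - θ) / sigmaHat s M)

theorem measurable_comp_configCount {F : Type*} [MeasurableSpace F] (f : ℕ → ℝ) :
    Measurable fun M : Measure F => f (configCount M) :=
  (measurable_of_countable f).comp measurable_configCount

theorem measurable_studentized {X : Type*} [MeasurableSpace X]
    {muHat sigmaHat : ℝ → Measure (𝔼 × ℝ) → ℝ} (hmu : ∀ s, Measurable (muHat s))
    (hsigma : ∀ s, Measurable (sigmaHat s)) (τ : ℝ → ℝ) (s : ℝ) {θ : X → ℝ} (hθ : Measurable θ)
    {M : X → Measure (𝔼 × ℝ)} (hM : Measurable M) :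
    Measurable fun x => studentized muHat sigmaHat τ s (θ x) (M x) := by
  have h1 : Measurable fun x => τ (configCount (M x)) :=
    (measurable_comp_configCount fun n => τ n).comp hM
  exact h1.mul ((((hmu s).comp hM).sub hθ).div ((hsigma s).comp hM))

theorem ae_prod_of_ae_right {P₁ : Measure Ω₁} {P₂ : Measure Ω₂} [SFinite P₂]
    {p : Ω₂ → Prop} (h : ∀ᵐ ω ∂P₂, p ω) : ∀ᵐ ω ∂(P₁.prod P₂), p ω.2 :=
  Measure.quasiMeasurePreserving_snd.ae h

/-- Almost surely, the configurations in all regions contained in a bounded window are given by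
`localData`. -/
theorem ae_markedData_eq_localData (K : Set 𝔼) (Z : 𝔼 → Ω₁ → ℝ) {P₁ : Measure Ω₁}
    {P₂ : Measure Ω₂} [SFinite P₂] {r : ℝ≥0}
    {N : Ω₂ → Measure 𝔼} (hN : IsPoissonRandomMeasure (r • (volume : Measure 𝔼)) N P₂)
    {D : Set 𝔼} (hD : MeasurableSet D) (hDfin : volume D ≠ ∞) :
    ∀ᵐ ω ∂(P₁.prod P₂), ∀ s y, region K s y ⊆ D →
      markedData K (N ω.2) (fun t => Z t ω.1) s y = localData K Z N s D (y, ω) := by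
  filter_upwards [ae_prod_of_ae_right
    (hN.ae_exists_finset hD (smul_volume_ne_top r hDfin))] with ω hω s y hy
  exact (localData_eq (q := (y, ω)) hω.1 hy).symm

theorem countOn_eq {Ω₂ : Type*} {K : Set 𝔼} {Z : 𝔼 → Ω₁ → ℝ} (hZ : Measurable (Function.uncurry Z))
    (N : Ω₂ → Measure 𝔼) (s : ℝ) (y : 𝔼) (ω : Ω₁ × Ω₂) :
    countOn K N s y ω = configCount (markedData K (N ω.2) (fun t => Z t ω.1) s y) :=
  (configCount_markedData (measurable_section hZ ω.1) _ _ _).symm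

/-- The law of a functional of the configuration in a region does not depend on the location of the
region. -/
theorem measureReal_localData_eq {K : Set 𝔼} (hK : MeasurableSet K)
    (hKb : Bornology.IsBounded K) {P₁ : Measure Ω₁} [IsProbabilityMeasure P₁]
    {P₂ : Measure Ω₂} [IsProbabilityMeasure P₂] {Z : 𝔼 → Ω₁ → ℝ}
    (hZ : Measurable (Function.uncurry Z)) (hstat : IsStationary P₁ Z) {r : ℝ≥0}
    {N : Ω₂ → Measure 𝔼} (hN : IsPoissonRandomMeasure (r • (volume : Measure 𝔼)) N P₂)
    {s : ℝ} {y : 𝔼} {D : Set 𝔼} (hD : MeasurableSet D) (hDfin : volume D ≠ ∞)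
    (hyD : region K s y ⊆ D) {𝒜 : Set (Measure (𝔼 × ℝ))} (h𝒜 : MeasurableSet 𝒜) :
    (P₁.prod P₂).real {ω | localData K Z N s D (y, ω) ∈ 𝒜} =
      (P₁.prod P₂).real {ω | markedData K (N ω.2) (fun t => Z t ω.1) s 0 ∈ 𝒜} := by
  have hR := measurableSet_region hK s 0
  have hRfin := volume_region_ne_top hKb s 0
  rw [measureReal_def, measureReal_def, measure_localData_mem_eq hK hKb hZ hstat hN hD hDfin hyD hR
    hRfin subset_rfl h𝒜]
  congr 1
  refine measure_congr ?_
  filter_upwards [ae_markedData_eq_localData (P₁ := P₁) K Z hN hR hRfin] with ω hω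
  exact propext (iff_of_eq (congrArg (· ∈ 𝒜) (hω s 0 subset_rfl).symm))

theorem aemeasurable_comp_markedData {K : Set 𝔼} (hK : MeasurableSet K)
    (hKb : Bornology.IsBounded K) {P₁ : Measure Ω₁} [IsProbabilityMeasure P₁]
    {P₂ : Measure Ω₂} [IsProbabilityMeasure P₂] {Z : 𝔼 → Ω₁ → ℝ}
    (hZ : Measurable (Function.uncurry Z)) {r : ℝ≥0}
    {N : Ω₂ → Measure 𝔼} (hN : IsPoissonRandomMeasure (r • (volume : Measure 𝔼)) N P₂)
    (s : ℝ) {g : Measure (𝔼 × ℝ) → ℝ} (hg : Measurable g) :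
    AEMeasurable (fun ω : Ω₁ × Ω₂ => g (markedData K (N ω.2) (fun t => Z t ω.1) s 0))
      (P₁.prod P₂) := by
  have hR := measurableSet_region hK s 0
  have hRfin := volume_region_ne_top hKb s 0
  refine ⟨fun ω => g (localData K Z N s (region K s 0) (0, ω)),
    hg.comp (measurable_localData_right hK hZ hN.measurable s hR 0), ?_⟩
  filter_upwards [ae_markedData_eq_localData (P₁ := P₁) K Z hN hR hRfin] with ω hω
  rw [hω s 0 subset_rfl]

theorem measureReal_countOn_le {K : Set 𝔼} (hK : MeasurableSet K)
    (hKb : Bornology.IsBounded K) (P₁ : Measure Ω₁) [IsProbabilityMeasure P₁]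
    {P₂ : Measure Ω₂} [IsProbabilityMeasure P₂] {r : ℝ≥0}
    {N : Ω₂ → Measure 𝔼} (hN : IsPoissonRandomMeasure (r • (volume : Measure 𝔼)) N P₂)
    (s : ℝ) (y : 𝔼) (hpos : 0 < r * volume.real (s • K)) {δ : ℝ} (hδ : 0 < δ) :
    (P₁.prod P₂).real {ω | δ * (r * volume.real (s • K)) ≤
      |(countOn K N s y ω : ℝ) - r * volume.real (s • K)|} ≤
      1 / (δ ^ 2 * (r * volume.real (s • K))) := by
  have hΛ : (r • (volume : Measure 𝔼)).real (region K s y) = r * volume.real (s • K) := by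
    rw [measureReal_nnreal_smul_apply, region, measureReal_def, measure_vadd, ← measureReal_def]
  have h := measureReal_pointCount_le hN (measurableSet_region hK s y)
    (smul_volume_ne_top r (volume_region_ne_top hKb s y)) (hΛ ▸ hpos) hδ
  rw [hΛ] at h
  refine le_trans (le_of_eq ?_) h
  have e : {ω : Ω₁ × Ω₂ | δ * (r * volume.real (s • K)) ≤
      |(countOn K N s y ω : ℝ) - r * volume.real (s • K)|} =
      Set.univ ×ˢ {ω | δ * (r * volume.real (s • K)) ≤
        |(pointCount (N ω) (region K s y) : ℝ) - r * volume.real (s • K)|} := by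
    ext ω
    simp [countOn]
  rw [e, measureReal_prod_prod, probReal_univ, one_mul]

end Statistics

/-! ### The ratio of rates -/

/-- The sequential condition on the rates as a uniform statement about pairs of large integers,
which can be applied at random counts. -/
theorem exists_forall_ratio_lt {a : ℕ → ℝ}
    (ha_ratio : ∀ k m : ℕ → ℕ, Tendsto k atTop atTop → Tendsto m atTop atTop →
      Tendsto (fun i => (k i : ℝ) / (m i : ℝ)) atTop (𝓝 0) →
      Tendsto (fun i => a (k i) / a (m i)) atTop (𝓝 0)) {θ : ℝ} (hθ : 0 < θ) :
    ∃ j : ℕ, ∀ k m : ℕ, j ≤ k → j ≤ m → (k : ℝ) / m < 1 / (j + 1) → a k / a m < θ := by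
  by_contra! hcon
  choose k m hk hm hkm hθ' using hcon
  have h1 : Tendsto k atTop atTop := tendsto_atTop_mono hk tendsto_id
  have h2 : Tendsto m atTop atTop := tendsto_atTop_mono hm tendsto_id
  have h3 : Tendsto (fun i => (k i : ℝ) / (m i : ℝ)) atTop (𝓝 0) :=
    squeeze_zero (fun i => by positivity) (fun i => (hkm i).le)
      tendsto_one_div_add_atTop_nhds_zero_nat
  obtain ⟨i, hi⟩ := ((ha_ratio k m h1 h2 h3).eventually_lt_const hθ).exists
  exact absurd hi (not_lt.2 (hθ' i))

section Main

variable {d : ℕ} {Ω₁ Ω₂ : Type*} [MeasurableSpace Ω₁] [MeasurableSpace Ω₂]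

local notation "𝔼" => EuclideanSpace ℝ (Fin d)

/-! ### Mass of a law at infinity and near zero -/

theorem exists_measureReal_abs_ge_lt (Q : Measure ℝ) [IsProbabilityMeasure Q] {ε : ℝ}
    (hε : 0 < ε) : ∃ B : ℝ, 0 < B ∧ Q.real {x | B ≤ |x|} < ε := by
  have hanti : Antitone fun n : ℕ => {x : ℝ | (n + 1 : ℝ) ≤ |x|} := by
    intro i j hij x hx
    have : (i : ℝ) ≤ j := by exact_mod_cast hij
    exact le_trans (by linarith) (show (j + 1 : ℝ) ≤ |x| from hx)
  have h := tendsto_measure_iInter_atTop (μ := Q) (s := fun n : ℕ => {x : ℝ | (n + 1 : ℝ) ≤ |x|})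
    (fun n => (isClosed_le continuous_const continuous_abs).measurableSet.nullMeasurableSet)
    hanti ⟨0, measure_ne_top _ _⟩
  have he : ⋂ n : ℕ, {x : ℝ | (n + 1 : ℝ) ≤ |x|} = ∅ := by
    rw [Set.eq_empty_iff_forall_notMem]
    intro x hx
    obtain ⟨n, hn⟩ := exists_nat_gt |x|
    have : (n + 1 : ℝ) ≤ |x| := Set.mem_iInter.1 hx n
    linarith
  rw [he, measure_empty] at h
  have h2 := (ENNReal.tendsto_toReal ENNReal.zero_ne_top).comp h
  obtain ⟨n, hn⟩ := (h2.eventually_lt_const (by simpa using hε)).exists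
  exact ⟨n + 1, by positivity, hn⟩

theorem exists_measureReal_Icc_lt {Q : Measure ℝ} [IsProbabilityMeasure Q] (hQ : Q {0} = 0) {ε : ℝ}
    (hε : 0 < ε) : ∃ κ : ℝ, 0 < κ ∧ Q.real (Set.Icc (-κ) κ) < ε := by
  have hanti : Antitone fun n : ℕ => Set.Icc (-(1 / (n + 1 : ℝ))) (1 / (n + 1 : ℝ)) := by
    intro i j hij
    have : 1 / (j + 1 : ℝ) ≤ 1 / (i + 1 : ℝ) :=
      one_div_le_one_div_of_le (by positivity) (by exact_mod_cast Nat.succ_le_succ hij)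
    exact Set.Icc_subset_Icc (by linarith) this
  have h := tendsto_measure_iInter_atTop (μ := Q)
    (fun n => measurableSet_Icc.nullMeasurableSet) hanti ⟨0, measure_ne_top _ _⟩
  have he : ⋂ n : ℕ, Set.Icc (-(1 / (n + 1 : ℝ))) (1 / (n + 1 : ℝ)) = {0} := by
    ext x
    rw [Set.mem_iInter, Set.mem_singleton_iff]
    constructor
    · intro hx
      have hlim := tendsto_one_div_add_atTop_nhds_zero_nat (𝕜 := ℝ)
      refine le_antisymm (ge_of_tendsto' hlim fun n => (hx n).2) ?_
      have := le_of_tendsto' hlim.neg fun n => (hx n).1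
      simpa using this
    · rintro rfl n
      have : (0 : ℝ) ≤ 1 / (n + 1) := by positivity
      exact ⟨by linarith, this⟩
  rw [he, hQ] at h
  have h2 := (ENNReal.tendsto_toReal ENNReal.zero_ne_top).comp h
  obtain ⟨n, hn⟩ := (h2.eventually_lt_const (by simpa using hε)).exists
  exact ⟨1 / (n + 1), by positivity, hn⟩

/-! ### Replacing the estimated centre by the true parameter -/

/-- Deterministic bound for the effect of the centring: it is the product of the ratio of the two
rates, the rescaled estimation error on the large region and the inverse of the rescaled scale
estimate on the block. -/
theorem abs_mul_div_sub_mul_div_le {t A B A' m μ' μ σ θ κ C δ : ℝ} (ht : t = A / B) (hA : 0 < A)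
    (hB : 0 < B) (hA' : 0 < A') (hκ : 0 < κ) (hC : 0 < C) (hθ : A / A' < θ)
    (herr : |A' * (μ' - μ)| < C) (hscale : κ < B * σ) (hδ : θ * C / κ ≤ δ) :
    |t * ((m - μ') / σ) - t * ((m - μ) / σ)| ≤ δ := by
  have hσ : 0 < σ := (pos_iff_pos_of_mul_pos (hκ.trans hscale)).1 hB
  have e : t * ((m - μ') / σ) - t * ((m - μ) / σ) =
      -((A / A') * (A' * (μ' - μ)) / (B * σ)) := by
    rw [ht]; field_simp; ring
  rw [e, abs_neg, abs_div, abs_mul, abs_of_pos (div_pos hA hA'), abs_of_pos (mul_pos hB hσ)]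
  refine le_trans ?_ hδ
  have hθ0 : 0 < θ := (div_pos hA hA').trans hθ
  gcongr

theorem tendsto_mean_count {K : Set 𝔼} (hd : 0 < d) (hKpos : 0 < volume.real K) {r : ℝ≥0}
    (hr : 0 < r) : Tendsto (fun n : ℕ => (r : ℝ) * volume.real ((n : ℝ) • K)) atTop atTop := by
  have hq : 0 < (r : ℝ) * volume.real K := mul_pos (by exact_mod_cast hr) hKpos
  refine (((tendsto_pow_atTop hd.ne').comp tendsto_natCast_atTop_atTop).const_mul_atTop
    hq).congr fun n => ?_
  rw [volume_real_smul n.cast_nonneg, Function.comp_apply]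
  ring

/-- The statistics with estimated centre are close to the ideal ones, uniformly over the block
locations. -/
theorem eventually_measureReal_studentized_sub_le {K : Set 𝔼} (hK : MeasurableSet K)
    (hKb : Bornology.IsBounded K) (hKpos : 0 < volume.real K)
    {P₁ : Measure Ω₁} [IsProbabilityMeasure P₁]
    {P₂ : Measure Ω₂} [IsProbabilityMeasure P₂] {Z : 𝔼 → Ω₁ → ℝ}
    (hZ : Measurable (Function.uncurry Z)) (hstat : IsStationary P₁ Z) {r : ℝ≥0} (hr : 0 < r)
    {N : Ω₂ → Measure 𝔼} (hN : IsPoissonRandomMeasure (r • (volume : Measure 𝔼)) N P₂)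
    {muHat sigmaHat : ℝ → Measure (𝔼 × ℝ) → ℝ}
    (hsigma_meas : ∀ s, Measurable (sigmaHat s)) (hsigma_nonneg : ∀ s M, 0 ≤ sigmaHat s M) {μ : ℝ} {τ : ℝ → ℝ} {a b : ℕ → ℝ}
    (ha : ∀ m, 0 < m → 0 < a m) (hb : ∀ m, 0 < m → 0 < b m)
    (hτab : ∀ m : ℕ, 0 < m → τ m = a m / b m)
    (ha_ratio : ∀ k m : ℕ → ℕ, Tendsto k atTop atTop → Tendsto m atTop atTop →
      Tendsto (fun i => (k i : ℝ) / (m i : ℝ)) atTop (𝓝 0) →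
      Tendsto (fun i => a (k i) / a (m i)) atTop (𝓝 0))
    {V W : Measure ℝ} [IsProbabilityMeasure V] [IsProbabilityMeasure W]
    (hV : ConvergesInLaw (P₁.prod P₂)
      (fun s ω => a (countOn K N s 0 ω) * (statOn K Z N muHat s 0 ω - μ)) V)
    (hW : ConvergesInLaw (P₁.prod P₂)
      (fun s ω => b (countOn K N s 0 ω) * statOn K Z N sigmaHat s 0 ω) W)
    (hW_zero : W {0} = 0) {c : ℕ → ℝ} (hd : 0 < d) (hc_mem : ∀ n, c n ∈ Set.Ioo (0 : ℝ) 1)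
    (hc_zero : Tendsto c atTop (𝓝 0)) (hs : Tendsto (fun n : ℕ => c n * n) atTop atTop)
    {D : ℕ → Set 𝔼} (hD : ∀ n, MeasurableSet (D n)) (hDfin : ∀ n, volume (D n) ≠ ∞)
    (hD0 : ∀ n : ℕ, region K n 0 ⊆ D n)
    (hDy : ∀ n : ℕ, ∀ y ∈ (n : ℝ) • K, region K (c n * n) y ⊆ D n)
    {δ ε : ℝ} (hδ : 0 < δ) (hε : 0 < ε) :
    ∀ᶠ n : ℕ in atTop, ∀ y ∈ (n : ℝ) • K, (P₁.prod P₂).real {ω | δ <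
      |studentized muHat sigmaHat τ (c n * n) (muHat n (localData K Z N n (D n) (0, ω)))
          (localData K Z N (c n * n) (D n) (y, ω)) -
        studentized muHat sigmaHat τ (c n * n) μ
          (localData K Z N (c n * n) (D n) (y, ω))|} ≤ ε := by
  have hn : Tendsto (fun n : ℕ => (n : ℝ)) atTop atTop := tendsto_natCast_atTop_atTop
  -- With `a k / a m < δ * κ / C`, error at most `C` and scale at least `κ` the difference is at
  -- most `δ`. Each of four exceptional events has probability at most `ε / 4`.
  obtain ⟨κ, hκ, hκW⟩ := exists_measureReal_Icc_lt hW_zero (show 0 < ε / 4 by positivity)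
  obtain ⟨C, hC, hCV⟩ := exists_measureReal_abs_ge_lt V (show 0 < ε / 4 by positivity)
  have hCcl : IsClosed {x : ℝ | C ≤ |x|} := isClosed_le continuous_const continuous_abs
  have evW := hs.eventually (eventually_measureReal_lt_of_isClosed hW isClosed_Icc hκW)
  have evV := hn.eventually (eventually_measureReal_lt_of_isClosed hV hCcl hCV)
  obtain ⟨j, hj⟩ := exists_forall_ratio_lt ha_ratio (show 0 < δ * κ / C by positivity)
  have hq : 0 < (r : ℝ) * volume.real K := mul_pos (by exact_mod_cast hr) hKpos
  -- The expected numbers of points in the block and in the large region.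
  have hv : Tendsto (fun n : ℕ => r * volume.real ((c n * n) • K)) atTop atTop := by
    have h1 := ((tendsto_pow_atTop hd.ne').comp hs).const_mul_atTop hq
    refine h1.congr fun n => ?_
    rw [volume_real_smul (mul_nonneg (hc_mem n).1.le n.cast_nonneg), Function.comp_apply]
    ring
  have hw : Tendsto (fun n : ℕ => r * volume.real ((n : ℝ) • K)) atTop atTop :=
    tendsto_mean_count hd hKpos hr
  have hc3 : Tendsto (fun n => 3 * c n ^ d) atTop (𝓝 0) := by
    have := (hc_zero.pow d).const_mul 3
    rwa [zero_pow hd.ne', mul_zero] at this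
  filter_upwards [evW, evV, hv.eventually_ge_atTop (16 / ε), hw.eventually_ge_atTop (16 / ε),
    hv.eventually_ge_atTop (2 * j), hw.eventually_ge_atTop (2 * j), hv.eventually_gt_atTop 0,
    hw.eventually_gt_atTop 0,
    hc3.eventually_lt_const (show (0 : ℝ) < 1 / (j + 1) by positivity), eventually_gt_atTop 0]
    with n evW evV hv1 hw1 hv2 hw2 hv0 hw0 hcj hn0 y hy
  have hn0' : (0 : ℝ) < n := by exact_mod_cast hn0
  set s : ℝ := c n * n with hs_def
  set v : ℝ := r * volume.real (s • K) with hv_def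
  set w : ℝ := r * volume.real ((n : ℝ) • K) with hw_def
  have hvw : v = c n ^ d * w := by
    rw [hv_def, hw_def, volume_real_smul (mul_nonneg (hc_mem n).1.le n.cast_nonneg),
      volume_real_smul n.cast_nonneg, mul_pow]
    ring
  set P := P₁.prod P₂
  let E₁ : Set (Ω₁ × Ω₂) := {ω | 1 / 2 * v ≤ |(countOn K N s y ω : ℝ) - v|}
  let E₂ : Set (Ω₁ × Ω₂) := {ω | 1 / 2 * w ≤ |(countOn K N n 0 ω : ℝ) - w|}
  let E₃ : Set (Ω₁ × Ω₂) :=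
    {ω | a (countOn K N n 0 ω) * (statOn K Z N muHat n 0 ω - μ) ∈ {x : ℝ | C ≤ |x|}}
  let 𝒜 : Set (Measure (𝔼 × ℝ)) :=
    {M | b (configCount M) * sigmaHat s M ∈ Set.Icc (-κ) κ}
  have h𝒜 : MeasurableSet 𝒜 :=
    ((measurable_comp_configCount b).mul (hsigma_meas s)) measurableSet_Icc
  let E₄ : Set (Ω₁ × Ω₂) := {ω | localData K Z N s (D n) (y, ω) ∈ 𝒜}
  have hquarter : ∀ x : ℝ, 16 / ε ≤ x → 1 / ((1 / 2) ^ 2 * x) ≤ ε / 4 := by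
    intro x hx
    have hx0 : 0 < x := lt_of_lt_of_le (by positivity) hx
    rw [div_le_iff₀ hε] at hx
    rw [div_le_iff₀ (by positivity)]
    linarith
  have hE₁ : P.real E₁ ≤ ε / 4 :=
    (measureReal_countOn_le hK hKb P₁ hN s y hv0 (by norm_num)).trans (hquarter v hv1)
  have hE₂ : P.real E₂ ≤ ε / 4 :=
    (measureReal_countOn_le hK hKb P₁ hN n 0 hw0 (by norm_num)).trans (hquarter w hw1)
  have hE₄ : P.real E₄ ≤ ε / 4 := by
    rw [measureReal_localData_eq hK hKb hZ hstat hN (hD n) (hDfin n) (hDy n y hy) h𝒜]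
    refine le_trans (le_of_eq ?_) evW.le
    congr 1
    ext ω
    change b (configCount _) * sigmaHat s _ ∈ Set.Icc (-κ) κ ↔ _
    rw [← countOn_eq hZ]
    rfl
  have hunion : P.real (E₁ ∪ E₂ ∪ E₃ ∪ E₄) ≤ ε := by
    have h1 := measureReal_union_le (μ := P) (E₁ ∪ E₂ ∪ E₃) E₄
    have h2 := measureReal_union_le (μ := P) (E₁ ∪ E₂) E₃
    have h3 := measureReal_union_le (μ := P) E₁ E₂
    have h4 : P.real E₃ < ε / 4 := evV
    linarith
  refine (measureReal_le_of_ae_imp P ?_).trans hunion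
  filter_upwards [ae_markedData_eq_localData (P₁ := P₁) K Z hN (hD n) (hDfin n)] with ω hω hbad
  by_contra hnot
  have hn₁ : |(countOn K N s y ω : ℝ) - v| < 1 / 2 * v :=
    not_le.1 fun h => hnot (Or.inl (Or.inl (Or.inl h)))
  have hn₂ : |(countOn K N n 0 ω : ℝ) - w| < 1 / 2 * w :=
    not_le.1 fun h => hnot (Or.inl (Or.inl (Or.inr h)))
  have hn₃ : |a (countOn K N n 0 ω) * (statOn K Z N muHat n 0 ω - μ)| < C :=
    not_le.1 fun h => hnot (Or.inl (Or.inr h))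
  have hn₄ : localData K Z N s (D n) (y, ω) ∉ 𝒜 := fun h => hnot (Or.inr h)
  have hcy := countOn_eq (K := K) hZ N s y ω
  rw [hω s y (hDy n y hy)] at hcy
  set M := localData K Z N s (D n) (y, ω)
  have hM0 : muHat n (localData K Z N n (D n) (0, ω)) = statOn K Z N muHat n 0 ω := by
    rw [← hω n 0 (hD0 n)]; rfl
  have hbad' : δ < |studentized muHat sigmaHat τ s (muHat n (localData K Z N n (D n) (0, ω))) M -
      studentized muHat sigmaHat τ s μ M| := hbad
  rw [hM0, studentized, studentized, ← hcy] at hbad'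
  have hn₄' : b (countOn K N s y ω) * sigmaHat s M ∉ Set.Icc (-κ) κ := by
    rw [hcy]; exact hn₄
  generalize countOn K N s y ω = k at *
  generalize countOn K N n 0 ω = m at *
  rw [abs_lt] at hn₁ hn₂
  have hk0 : 0 < k := by
    have : (0 : ℝ) < k := by linarith [hn₁.1]
    exact_mod_cast this
  have hm0 : 0 < m := by
    have : (0 : ℝ) < m := by linarith [hn₂.1]
    exact_mod_cast this
  have hkj : j ≤ k := by
    have : (j : ℝ) ≤ k := by linarith [hn₁.1]
    exact_mod_cast this
  have hmj : j ≤ m := by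
    have : (j : ℝ) ≤ m := by linarith [hn₂.1]
    exact_mod_cast this
  -- The counts are within a factor `3 / 2` and `1 / 2` of their means, of ratio `c n ^ d`.
  have hkm : (k : ℝ) / m < 1 / (j + 1) := by
    refine lt_of_le_of_lt ?_ hcj
    have hm0' : (0 : ℝ) < m := by exact_mod_cast hm0
    rw [div_le_iff₀ hm0']
    have h1 : (k : ℝ) ≤ 3 / 2 * (c n ^ d * w) := by rw [← hvw]; linarith [hn₁.2]
    have h2 : c n ^ d * w ≤ c n ^ d * (2 * m) :=
      mul_le_mul_of_nonneg_left (by linarith [hn₂.1]) (pow_nonneg (hc_mem n).1.le d)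
    linarith
  refine absurd hbad' (not_lt.2 ?_)
  have hscale : κ < b k * sigmaHat s M := by
    by_contra hle
    exact hn₄' ⟨(neg_nonpos.2 hκ.le).trans (mul_nonneg (hb k hk0).le (hsigma_nonneg s M)),
      not_lt.1 hle⟩
  exact abs_mul_div_sub_mul_div_le (hτab k hk0) (ha k hk0) (hb k hk0) (ha m hm0) hκ hC
    (hj k m hkj hmj hkm) hn₃ hscale (le_of_eq (by field_simp))

end Main

section Estimator

variable {d : ℕ} {Ω₁ Ω₂ : Type*} [MeasurableSpace Ω₁] [MeasurableSpace Ω₂]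

local notation "𝔼" => EuclideanSpace ℝ (Fin d)

/-! ### The subsampling distribution estimator -/

/-- Almost surely, simultaneously for all `x`, the estimator is a proportion of locations at which
a jointly measurable statistic is at most `x`. -/
theorem ae_subsamplingDist_eq {K : Set 𝔼} (hK : MeasurableSet K)
    {P₁ : Measure Ω₁} [IsProbabilityMeasure P₁] {P₂ : Measure Ω₂} [IsProbabilityMeasure P₂]
    {Z : 𝔼 → Ω₁ → ℝ} (hZ : Measurable (Function.uncurry Z)) {r : ℝ≥0}
    {N : Ω₂ → Measure 𝔼} (hN : IsPoissonRandomMeasure (r • (volume : Measure 𝔼)) N P₂)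
    {muHat sigmaHat : ℝ → Measure (𝔼 × ℝ) → ℝ} (hmu : ∀ s, Measurable (muHat s))
    (hsigma : ∀ s, Measurable (sigmaHat s)) (τ : ℝ → ℝ) {n : ℕ} {c : ℝ}
    {D : Set 𝔼} (hD : MeasurableSet D) (hDfin : volume D ≠ ∞) (hD0 : region K n 0 ⊆ D)
    (hDy : ∀ y ∈ (n : ℝ) • K, region K (c * n) y ⊆ D) :
    ∀ᵐ ω ∂(P₁.prod P₂), ∀ x : ℝ, subsamplingDist K Z N muHat sigmaHat τ n c x ω =
      (volume.real (blockLocations ((n : ℝ) • K) (c • ((n : ℝ) • K))))⁻¹ *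
        volume.real ({y | studentized muHat sigmaHat τ (c * n)
            (muHat n (localData K Z N n D (0, ω))) (localData K Z N (c * n) D (y, ω)) ≤ x} ∩
          blockLocations ((n : ℝ) • K) (c • ((n : ℝ) • K))) := by
  have hA : MeasurableSet ((n : ℝ) • K) := by
    simpa [region] using measurableSet_region hK (n : ℝ) 0
  filter_upwards [ae_markedData_eq_localData (P₁ := P₁) K Z hN hD hDfin] with ω hω x
  have hM0 : statOn K Z N muHat n 0 ω = muHat n (localData K Z N n D (0, ω)) := by
    rw [statOn, hω _ _ hD0]
  generalize muHat n (localData K Z N n D (0, ω)) = θ at *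
  have hloc : Measurable fun y => localData K Z N (c * n) D (y, ω) :=
    (measurable_localData hK hZ hN.measurable (c * n) hD).comp measurable_prodMk_right
  have hmeas : MeasurableSet {y | studentized muHat sigmaHat τ (c * n)
      θ (localData K Z N (c * n) D (y, ω)) ≤ x} :=
    measurable_studentized hmu hsigma τ (c * n) measurable_const hloc measurableSet_Iic
  rw [← measureReal_restrict_apply hmeas, ← integral_indicator_one hmeas, subsamplingDist]
  congr 1
  refine integral_congr_ae ?_
  filter_upwards [ae_mono (Measure.restrict_mono (blockLocations_subset _ _) le_rfl)
    (ae_restrict_mem hA)] with y hy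
  have e : τ (countOn K N (c * n) y ω) *
      ((statOn K Z N muHat (c * n) y ω - statOn K Z N muHat n 0 ω) /
        statOn K Z N sigmaHat (c * n) y ω) = studentized muHat sigmaHat τ (c * n)
          θ (localData K Z N (c * n) D (y, ω)) := by
    rw [countOn_eq hZ, hM0, statOn, statOn, hω _ _ (hDy y hy), studentized]
  simp only [Set.indicator_apply, Set.mem_ofPred_eq, e, Pi.one_apply]

/-- A proportion of locations is monotone in the threshold with values in the unit interval. If `S`
is null the proportion is zero, so that no positivity is needed. -/
theorem monotone_inv_mul_measureReal_inter {X : Type*} [MeasurableSpace X] (m : Measure X)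
    {S : Set X} (hS : m S ≠ ∞) (f : X → ℝ) :
    Monotone (fun x => (m.real S)⁻¹ * m.real ({y | f y ≤ x} ∩ S)) ∧
      ∀ x, 0 ≤ (m.real S)⁻¹ * m.real ({y | f y ≤ x} ∩ S) ∧
        (m.real S)⁻¹ * m.real ({y | f y ≤ x} ∩ S) ≤ 1 := by
  refine ⟨fun x x' hx => ?_, fun x => ⟨by positivity, ?_⟩⟩
  · refine mul_le_mul_of_nonneg_left (measureReal_mono ?_ ?_) (by positivity)
    · exact Set.inter_subset_inter_left _ fun y (hy : f y ≤ x) => hy.trans hx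
    · exact ne_top_of_le_ne_top hS (measure_mono Set.inter_subset_right)
  · rw [inv_mul_eq_div]
    exact div_le_one_of_le₀ (measureReal_mono Set.inter_subset_right hS) measureReal_nonneg

/-- The second moment bound for the average of the ideal indicators vanishes under the mixing
condition. -/
theorem tendsto_average_bound (hd : 0 < d) {K : Set 𝔼} (hKpos : 0 < volume.real K)
    (P₁ : Measure Ω₁) (Z : 𝔼 → Ω₁ → ℝ) {c : ℕ → ℝ} (hc_mem : ∀ n, c n ∈ Set.Ioo (0 : ℝ) 1)
    (hc_zero : Tendsto c atTop (𝓝 0))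
    (hmix : Tendsto (fun n : ℕ => (volume.real ((n : ℝ) • K))⁻¹ *
      ∫ k in (0 : ℝ)..Metric.diam ((n : ℝ) • K),
        k ^ (d - 1) * mixingCoeff P₁ Z k
          (volume.real (convexHull ℝ (c n • ((n : ℝ) • K))))) atTop (𝓝 0)) (κ : ℝ) :
    Tendsto (fun n : ℕ => κ * ((volume.real ((n : ℝ) • K))⁻¹ *
        ((2 * Metric.diam ((c n * n) • K)) ^ d + d * 2 ^ d *
          ∫ k in (0 : ℝ)..Metric.diam ((n : ℝ) • K),
            k ^ (d - 1) * mixingCoeff P₁ Z k (volume.real (convexHull ℝ ((c n * n) • K))))))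
      atTop (𝓝 0) := by
  have h1 : Tendsto (fun n : ℕ => c n ^ d * ((2 * Metric.diam K) ^ d / volume.real K)) atTop
      (𝓝 0) := by
    have := (hc_zero.pow d).mul_const ((2 * Metric.diam K) ^ d / volume.real K)
    rwa [zero_pow hd.ne', zero_mul] at this
  have h2 := (h1.add (hmix.const_mul (d * 2 ^ d : ℝ))).const_mul κ
  rw [mul_zero, add_zero, mul_zero] at h2
  refine h2.congr' ?_
  filter_upwards [eventually_gt_atTop 0] with n hn
  have hn' : (0 : ℝ) < n := by exact_mod_cast hn
  have hs : 0 < c n * n := mul_pos (hc_mem n).1 hn'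
  rw [smul_smul, volume_real_smul hn'.le, diam_smul₀ (c n * n), Real.norm_of_nonneg hs.le]
  have e : c n ^ d * ((2 * Metric.diam K) ^ d / volume.real K) =
      ((n : ℝ) ^ d * volume.real K)⁻¹ * (2 * (c n * n * Metric.diam K)) ^ d := by
    rw [mul_left_comm 2, mul_pow (c n * n), mul_pow (c n)]
    field_simp
  rw [e]
  ring

end Estimator

/-! ### Replacing the number of points by its mean in the rate -/

/-- A regularly varying rate may be evaluated at any sequence to which its random argument is
asymptotically equivalent in probability. -/
theorem tendstoInMeasure_rate_sub {Ω : Type*} [MeasurableSpace Ω] {P : Measure Ω}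
    [IsProbabilityMeasure P] {J : Measure ℝ} [IsProbabilityMeasure J] {τ ℓ : ℝ → ℝ} {β : ℝ}
    (hℓ : IsSlowlyVarying ℓ) (hτ : ∀ u : ℝ, 0 < u → τ u = u ^ β * ℓ u)
    {k X : ℕ → Ω → ℝ} {w : ℕ → ℝ} (hw : Tendsto w atTop atTop)
    (hk : ∀ δ : ℝ, 0 < δ →
      Tendsto (fun n => P.real {ω | δ * w n ≤ |k n ω - w n|}) atTop (𝓝 0))
    (hT : TendstoInDistribution (fun n ω => τ (k n ω) * X n ω) atTop (id : ℝ → ℝ)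
      (fun _ => P) J) :
    TendstoInMeasure P (fun n ω => τ (w n) * X n ω - τ (k n ω) * X n ω) atTop
      (fun _ => (0 : ℝ)) := by
  rw [tendstoInMeasure_iff_measureReal_dist]
  intro ε hε
  refine tendsto_zero_of_forall_eventually_le (fun _ => measureReal_nonneg) fun e he => ?_
  obtain ⟨C, hC, hCJ⟩ := exists_measureReal_abs_ge_lt J (show 0 < e / 2 by positivity)
  have hCcl : IsClosed {x : ℝ | C ≤ |x|} := isClosed_le continuous_const continuous_abs
  have hratio := (tendsto_rate_ratio hℓ hτ).eventually
    (Metric.ball_mem_nhds (1 : ℝ) (show 0 < ε / C by positivity))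
  obtain ⟨p, hp, q, hq, hpq⟩ := eventually_prod_iff.1 hratio
  obtain ⟨δ₀, hδ₀, hδp⟩ := Metric.eventually_nhds_iff.1 hp
  obtain ⟨δ, hδ, hδδ₀, hδ1⟩ : ∃ δ, 0 < δ ∧ δ ≤ δ₀ ∧ δ ≤ 1 :=
    ⟨min δ₀ 1, lt_min hδ₀ one_pos, min_le_left _ _, min_le_right _ _⟩
  filter_upwards [eventually_measureReal_lt_of_isClosed hT hCcl hCJ,
    (hk δ hδ).eventually_lt_const (show 0 < e / 2 by positivity), hw.eventually hq,
    hw.eventually_gt_atTop 0] with n h1 h2 h3 h4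
  have hsub : {ω | ε ≤ dist (τ (w n) * X n ω - τ (k n ω) * X n ω) 0} ⊆
      {ω | τ (k n ω) * X n ω ∈ {x : ℝ | C ≤ |x|}} ∪ {ω | δ * w n ≤ |k n ω - w n|} := by
    intro ω hω
    by_contra hnot
    have hn₁ : |τ (k n ω) * X n ω| < C := not_le.1 fun h => hnot (Or.inl h)
    have hn₂ : |k n ω - w n| < δ * w n := not_le.1 fun h => hnot (Or.inr h)
    have hk0 : 0 < k n ω := by
      have := (abs_lt.1 hn₂).1
      nlinarith
    have hτ0 : τ (k n ω) ≠ 0 := by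
      rw [hτ _ hk0]
      exact (mul_pos (Real.rpow_pos_of_pos hk0 β) (hℓ.pos _ hk0)).ne'
    have hd : dist (k n ω / w n) 1 < δ₀ := by
      rw [Real.dist_eq, div_sub_one h4.ne', abs_div, abs_of_pos h4, div_lt_iff₀ h4]
      exact hn₂.trans_le (mul_le_mul_of_nonneg_right hδδ₀ h4.le)
    have h5 : |τ (w n) / τ (k n ω) - 1| < ε / C := by
      have := hpq (hδp hd) h3
      simpa only [div_mul_cancel₀ _ h4.ne', Metric.mem_ball, Real.dist_eq] using this
    have h6 : τ (w n) * X n ω - τ (k n ω) * X n ω =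
        (τ (w n) / τ (k n ω) - 1) * (τ (k n ω) * X n ω) := by
      field_simp
    have hω' : ε ≤ |τ (w n) * X n ω - τ (k n ω) * X n ω| := by
      simpa [Real.dist_eq] using hω
    rw [h6, abs_mul] at hω'
    have h7 : |τ (w n) / τ (k n ω) - 1| * |τ (k n ω) * X n ω| < ε / C * C :=
      mul_lt_mul'' h5 hn₁ (abs_nonneg _) (abs_nonneg _)
    rw [div_mul_cancel₀ _ hC.ne'] at h7
    exact absurd hω' (not_le.2 h7)
  have h5 := (measureReal_mono hsub (measure_ne_top P _)).trans (measureReal_union_le _ _)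
  refine h5.trans ?_
  have h6 : P.real {ω | τ (k n ω) * X n ω ∈ {x : ℝ | C ≤ |x|}} < e / 2 := h1
  linarith

section Consistency

variable {d : ℕ} {Ω₁ Ω₂ : Type*} [MeasurableSpace Ω₁] [MeasurableSpace Ω₂]

local notation "𝔼" => EuclideanSpace ℝ (Fin d)

/-! ### Convergence of the ideal averages -/

/-- The block scale tends to infinity; the hypothesis forces `K` to have positive diameter. -/
theorem tendsto_block_scale {K : Set 𝔼} {c : ℕ → ℝ}
    (hc_diam : Tendsto (fun n : ℕ => c n * Metric.diam ((n : ℝ) • K)) atTop atTop) :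
    Tendsto (fun n : ℕ => c n * n) atTop atTop := by
  have h : Tendsto (fun n : ℕ => c n * n * Metric.diam K) atTop atTop := by
    refine hc_diam.congr fun n => ?_
    rw [diam_smul₀, Real.norm_natCast, mul_assoc]
  have hpos : 0 < Metric.diam K := by
    refine lt_of_le_of_ne Metric.diam_nonneg fun h0 => ?_
    simp only [← h0, mul_zero] at h
    obtain ⟨n, hn⟩ := (h.eventually_gt_atTop 0).exists
    exact lt_irrefl _ hn
  exact (tendsto_mul_const_atTop_of_pos hpos).1 h

theorem tendstoInDistribution_natCast {Ω : Type*} [MeasurableSpace Ω] {P : Measure Ω}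
    [IsProbabilityMeasure P] {T : ℝ → Ω → ℝ} {Q : Measure ℝ} [IsProbabilityMeasure Q]
    (h : ConvergesInLaw P T Q) :
    TendstoInDistribution (fun (n : ℕ) ω => T n ω) atTop (id : ℝ → ℝ) (fun _ => P) Q :=
  ⟨fun n => h.forall_aemeasurable n, h.aemeasurable_limit,
    h.tendsto.comp tendsto_natCast_atTop_atTop⟩

/-- Under the mixing condition the proportion of locations at which the statistic with the true
centre is at most `x` converges to the limit distribution function. -/
theorem tendsto_measureReal_abs_average_sub_cdf {K : Set 𝔼} (hd : 0 < d) (hK : MeasurableSet K)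
    (hKb : Bornology.IsBounded K) (hKpos : 0 < volume.real K)
    {P₁ : Measure Ω₁} [IsProbabilityMeasure P₁] {P₂ : Measure Ω₂} [IsProbabilityMeasure P₂]
    {Z : 𝔼 → Ω₁ → ℝ} (hZ : Measurable (Function.uncurry Z)) (hstat : IsStationary P₁ Z)
    {r : ℝ≥0} {N : Ω₂ → Measure 𝔼}
    (hN : IsPoissonRandomMeasure (r • (volume : Measure 𝔼)) N P₂)
    {muHat sigmaHat : ℝ → Measure (𝔼 × ℝ) → ℝ} (hmu_meas : ∀ s, Measurable (muHat s))
    (hsigma_meas : ∀ s, Measurable (sigmaHat s)) {μ : ℝ} {τ : ℝ → ℝ}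
    {J : Measure ℝ} [IsProbabilityMeasure J]
    (hJ : ConvergesInLaw (P₁.prod P₂) (fun s ω => τ (countOn K N s 0 ω) *
      ((statOn K Z N muHat s 0 ω - μ) / statOn K Z N sigmaHat s 0 ω)) J)
    {c : ℕ → ℝ} (hc_mem : ∀ n, c n ∈ Set.Ioo (0 : ℝ) 1) (hc_zero : Tendsto c atTop (𝓝 0))
    (hs : Tendsto (fun n : ℕ => c n * n) atTop atTop)
    (hmix : Tendsto (fun n : ℕ => (volume.real ((n : ℝ) • K))⁻¹ *
      ∫ k in (0 : ℝ)..Metric.diam ((n : ℝ) • K),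
        k ^ (d - 1) * mixingCoeff P₁ Z k
          (volume.real (convexHull ℝ (c n • ((n : ℝ) • K))))) atTop (𝓝 0))
    {D : ℕ → Set 𝔼} (hD : ∀ n, MeasurableSet (D n)) (hDfin : ∀ n, volume (D n) ≠ ∞)
    (hDy : ∀ n : ℕ, ∀ y ∈ (n : ℝ) • K, region K (c n * n) y ⊆ D n)
    {x : ℝ} (hx : ContinuousAt (cdf J) x) {η : ℝ} (hη : 0 < η) :
    Tendsto (fun n : ℕ => (P₁.prod P₂).real {ω | η ≤ |(volume.real ((n : ℝ) • K))⁻¹ *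
      (volume.restrict ((n : ℝ) • K)).real {y | studentized muHat sigmaHat τ (c n * n) μ
        (localData K Z N (c n * n) (D n) (y, ω)) ≤ x} - cdf J x|}) atTop (𝓝 0) := by
  set P := P₁.prod P₂
  let p : ℕ → ℝ := fun n => P.real {ω | τ (countOn K N (c n * n) 0 ω) *
      ((statOn K Z N muHat (c n * n) 0 ω - μ) / statOn K Z N sigmaHat (c n * n) 0 ω) ≤ x}
  have hp : Tendsto p atTop (𝓝 (cdf J x)) :=
    (tendsto_measureReal_le_of_continuousAt hJ hx).comp hs
  let 𝒜 : ℕ → Set (Measure (𝔼 × ℝ)) := fun n =>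
    {M | studentized muHat sigmaHat τ (c n * n) μ M ≤ x}
  have h𝒜 : ∀ n, MeasurableSet (𝒜 n) := fun n =>
    measurable_studentized hmu_meas hsigma_meas τ (c n * n) measurable_const measurable_id
      measurableSet_Iic
  have hpy : ∀ n : ℕ, ∀ y ∈ (n : ℝ) • K,
      P.real {ω | localData K Z N (c n * n) (D n) (y, ω) ∈ 𝒜 n} = p n := by
    intro n y hy
    rw [measureReal_localData_eq hK hKb hZ hstat hN (hD n) (hDfin n) (hDy n y hy) (h𝒜 n)]
    simp only [p, countOn_eq hZ]
    rfl
  have hbound := tendsto_average_bound hd hKpos P₁ Z hc_mem hc_zero hmix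
    (((η / 2) ^ 2)⁻¹ * volume.real (Metric.ball (0 : 𝔼) 1))
  refine squeeze_zero' (Eventually.of_forall fun _ => measureReal_nonneg) ?_ hbound
  filter_upwards [Metric.tendsto_nhds.1 hp (η / 2) (by positivity), eventually_gt_atTop 0]
    with n hpn hn
  have hn' : (0 : ℝ) < n := by exact_mod_cast hn
  have hA : MeasurableSet ((n : ℝ) • K) := by
    simpa [region] using measurableSet_region hK (n : ℝ) 0
  have hApos : 0 < volume.real ((n : ℝ) • K) := by
    rw [volume_real_smul hn'.le]; positivity
  refine le_trans (measureReal_mono ?_) (measureReal_abs_average_sub_le hd hK hKb hZ hN hA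
    (hKb.smul₀ _) hApos (hD n) (hDfin n) (hDy n) (h𝒜 n) (hpy n) (show 0 < η / 2 by positivity))
  intro ω hω
  have hω' : η ≤ |(volume.real ((n : ℝ) • K))⁻¹ *
      (volume.restrict ((n : ℝ) • K)).real
        {y | localData K Z N (c n * n) (D n) (y, ω) ∈ 𝒜 n} - cdf J x| := hω
  change η / 2 ≤ |(volume.real ((n : ℝ) • K))⁻¹ *
      (volume.restrict ((n : ℝ) • K)).real
        {y | localData K Z N (c n * n) (D n) (y, ω) ∈ 𝒜 n} - p n|
  have h1 := abs_sub_le ((volume.real ((n : ℝ) • K))⁻¹ *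
      (volume.restrict ((n : ℝ) • K)).real
        {y | localData K Z N (c n * n) (D n) (y, ω) ∈ 𝒜 n}) (p n) (cdf J x)
  rw [Real.dist_eq] at hpn
  linarith

theorem tendsto_measureReal_countOn_sub {K : Set 𝔼} (hd : 0 < d) (hK : MeasurableSet K)
    (hKb : Bornology.IsBounded K) (hKpos : 0 < volume.real K)
    (P₁ : Measure Ω₁) [IsProbabilityMeasure P₁] {P₂ : Measure Ω₂} [IsProbabilityMeasure P₂]
    {r : ℝ≥0} (hr : 0 < r) {N : Ω₂ → Measure 𝔼}
    (hN : IsPoissonRandomMeasure (r • (volume : Measure 𝔼)) N P₂) {δ : ℝ} (hδ : 0 < δ) :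
    Tendsto (fun n : ℕ => (P₁.prod P₂).real {ω | δ * (r * volume.real ((n : ℝ) • K)) ≤
      |(countOn K N n 0 ω : ℝ) - r * volume.real ((n : ℝ) • K)|}) atTop (𝓝 0) := by
  have hw := tendsto_mean_count hd hKpos hr
  have h0 : Tendsto (fun n : ℕ => 1 / (δ ^ 2 * (r * volume.real ((n : ℝ) • K)))) atTop (𝓝 0) := by
    simp only [one_div]
    exact (hw.const_mul_atTop (pow_pos hδ 2)).inv_tendsto_atTop
  refine squeeze_zero' (Eventually.of_forall fun _ => measureReal_nonneg) ?_ h0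
  filter_upwards [hw.eventually_gt_atTop 0] with n hn
  exact measureReal_countOn_le hK hKb P₁ hN n 0 hn hδ

/-- Off an event of vanishing probability the number of points in `n • K` and the scale estimate
are positive. -/
theorem tendsto_measureReal_degenerate {K : Set 𝔼} (hd : 0 < d) (hK : MeasurableSet K)
    (hKb : Bornology.IsBounded K) (hKpos : 0 < volume.real K)
    {P₁ : Measure Ω₁} [IsProbabilityMeasure P₁] {P₂ : Measure Ω₂} [IsProbabilityMeasure P₂]
    {Z : 𝔼 → Ω₁ → ℝ} {r : ℝ≥0} (hr : 0 < r) {N : Ω₂ → Measure 𝔼}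
    (hN : IsPoissonRandomMeasure (r • (volume : Measure 𝔼)) N P₂)
    {sigmaHat : ℝ → Measure (𝔼 × ℝ) → ℝ} {b : ℕ → ℝ} {W : Measure ℝ} [IsProbabilityMeasure W]
    (hW : ConvergesInLaw (P₁.prod P₂)
      (fun s ω => b (countOn K N s 0 ω) * statOn K Z N sigmaHat s 0 ω) W)
    (hW_zero : W {0} = 0) :
    Tendsto (fun n : ℕ => (P₁.prod P₂).real ({ω | countOn K N n 0 ω = 0} ∪
      {ω | statOn K Z N sigmaHat n 0 ω = 0})) atTop (𝓝 0) := by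
  have hw := tendsto_mean_count hd hKpos hr
  have h1 := tendsto_measureReal_countOn_sub hd hK hKb hKpos P₁ hr hN one_pos
  have h2 : Tendsto (fun n : ℕ => (P₁.prod P₂).real
      {ω | b (countOn K N n 0 ω) * statOn K Z N sigmaHat n 0 ω ∈ ({0} : Set ℝ)}) atTop (𝓝 0) := by
    refine tendsto_zero_of_forall_eventually_le (fun _ => measureReal_nonneg) fun ε hε => ?_
    have := tendsto_natCast_atTop_atTop.eventually (eventually_measureReal_lt_of_isClosed hW
      isClosed_singleton (show W.real {0} < ε by rwa [measureReal_def, hW_zero]))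
    exact this.mono fun n hn => hn.le
  have h3 := h1.add h2
  rw [add_zero] at h3
  refine squeeze_zero' (Eventually.of_forall fun _ => measureReal_nonneg) ?_ h3
  filter_upwards [hw.eventually_gt_atTop 0] with n hn
  refine (measureReal_union_le _ _).trans (add_le_add (measureReal_mono ?_) (measureReal_mono ?_))
  · intro ω hω
    have h : countOn K N n 0 ω = 0 := hω
    change 1 * (r * volume.real ((n : ℝ) • K)) ≤
      |(countOn K N n 0 ω : ℝ) - r * volume.real ((n : ℝ) • K)|
    rw [h, Nat.cast_zero, zero_sub, abs_neg, abs_of_pos hn, one_mul]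
  · intro ω hω
    have h : statOn K Z N sigmaHat n 0 ω = 0 := hω
    change b (countOn K N n 0 ω) * statOn K Z N sigmaHat n 0 ω = 0
    rw [h, mul_zero]

end Consistency

end PoissonSubsampling

/-! ### Subsampling inference -/

theorem theorem3
    {d : ℕ} (hd : 0 < d)
    {Ω₁ Ω₂ : Type*} [MeasurableSpace Ω₁] [MeasurableSpace Ω₂]
    (P₁ : Measure Ω₁) [IsProbabilityMeasure P₁] (P₂ : Measure Ω₂) [IsProbabilityMeasure P₂]
    -- the random field and the Poisson process, independent of each other
    (Z : EuclideanSpace ℝ (Fin d) → Ω₁ → ℝ)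
    (hZ_meas : Measurable (Function.uncurry Z))
    (hZ_stat : PoissonSubsampling.IsStationary P₁ Z)
    (r : ℝ≥0) (hr : 0 < r)
    (N : Ω₂ → Measure (EuclideanSpace ℝ (Fin d)))
    (hN : PoissonSubsampling.IsPoissonRandomMeasure
      (r • (volume : Measure (EuclideanSpace ℝ (Fin d)))) N P₂)
    -- the prototype region
    (K : Set (EuclideanSpace ℝ (Fin d))) (hK_meas : MeasurableSet K)
    (hK_bdd : Bornology.IsBounded K) (hK_pos : 0 < volume K) (hK_front : volume (frontier K) = 0)
    -- the estimators of location and scale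
    (muHat sigmaHat : ℝ → Measure (EuclideanSpace ℝ (Fin d) × ℝ) → ℝ)
    (hmu_meas : ∀ s, Measurable (muHat s)) (hsigma_meas : ∀ s, Measurable (sigmaHat s))
    (hsigma_nonneg : ∀ s M, 0 ≤ sigmaHat s M)
    (μ : ℝ)
    -- the rates
    (τ : ℝ → ℝ) (β : ℝ) (ℓ : ℝ → ℝ) (hℓ : PoissonSubsampling.IsSlowlyVarying ℓ)
    (hτ : ∀ u : ℝ, 0 < u → τ u = u ^ β * ℓ u)
    (a b : ℕ → ℝ) (ha : ∀ m, 0 < m → 0 < a m) (hb : ∀ m, 0 < m → 0 < b m)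
    (hτab : ∀ m : ℕ, 0 < m → τ m = a m / b m)
    (ha_ratio : ∀ k m : ℕ → ℕ, Tendsto k atTop atTop → Tendsto m atTop atTop →
      Tendsto (fun i => (k i : ℝ) / (m i : ℝ)) atTop (𝓝 0) →
      Tendsto (fun i => a (k i) / a (m i)) atTop (𝓝 0))
    -- the limit laws and the three convergences
    (J V W : Measure ℝ) [IsProbabilityMeasure J] [IsProbabilityMeasure V] [IsProbabilityMeasure W]
    (hJ : PoissonSubsampling.ConvergesInLaw (P₁.prod P₂)
      (fun s ω => τ (PoissonSubsampling.countOn K N s 0 ω) *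
        ((PoissonSubsampling.statOn K Z N muHat s 0 ω - μ) /
          PoissonSubsampling.statOn K Z N sigmaHat s 0 ω)) J)
    (hV : PoissonSubsampling.ConvergesInLaw (P₁.prod P₂)
      (fun s ω => a (PoissonSubsampling.countOn K N s 0 ω) *
        (PoissonSubsampling.statOn K Z N muHat s 0 ω - μ)) V)
    (hW : PoissonSubsampling.ConvergesInLaw (P₁.prod P₂)
      (fun s ω => b (PoissonSubsampling.countOn K N s 0 ω) *
        PoissonSubsampling.statOn K Z N sigmaHat s 0 ω) W)
    (hW_zero : W {0} = 0)
    -- the block fractions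
    (c : ℕ → ℝ) (hc_mem : ∀ n, c n ∈ Set.Ioo (0 : ℝ) 1) (hc_zero : Tendsto c atTop (𝓝 0))
    (hc_diam : Tendsto (fun n : ℕ => c n * Metric.diam ((n : ℝ) • K)) atTop atTop)
    -- the mixing condition
    (hmix : Tendsto (fun n : ℕ => (volume.real ((n : ℝ) • K))⁻¹ *
      ∫ k in (0 : ℝ)..Metric.diam ((n : ℝ) • K),
        k ^ (d - 1) * PoissonSubsampling.mixingCoeff P₁ Z k
          (volume.real (convexHull ℝ (c n • ((n : ℝ) • K))))) atTop (𝓝 0)) :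
    -- (i) consistency at the continuity points
    (∀ x : ℝ, ContinuousAt (cdf J) x →
      TendstoInMeasure (P₁.prod P₂)
        (fun (n : ℕ) ω =>
          PoissonSubsampling.subsamplingDist K Z N muHat sigmaHat τ n (c n) x ω)
        atTop (fun _ => cdf J x)) ∧
    -- (ii) uniform consistency
    (Continuous (cdf J) →
      TendstoInMeasure (P₁.prod P₂)
        (fun (n : ℕ) ω => ⨆ x : ℝ,
          |PoissonSubsampling.subsamplingDist K Z N muHat sigmaHat τ n (c n) x ω - cdf J x|)
        atTop (fun _ => (0 : ℝ))) ∧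
    -- (iii) asymptotic coverage
    (∀ t : ℝ, 0 < t → t < 1 →
      ContinuousAt (cdf J) (sInf {x : ℝ | 1 - t ≤ cdf J x}) →
      ContinuousAt (cdf J) (sSup {x : ℝ | cdf J x ≤ 1 - t}) →
      Tendsto (fun n : ℕ => (P₁.prod P₂).real {ω |
          τ (PoissonSubsampling.countOn K N n 0 ω) *
            ((PoissonSubsampling.statOn K Z N muHat n 0 ω - μ) /
              PoissonSubsampling.statOn K Z N sigmaHat n 0 ω) ≤
          PoissonSubsampling.subsamplingQuantile K Z N muHat sigmaHat τ n (c n) (1 - t) ω})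
        atTop (𝓝 (1 - t)) ∧
      Tendsto (fun n : ℕ => (P₁.prod P₂).real {ω |
          τ ((r : ℝ) * volume.real ((n : ℝ) • K)) *
            ((PoissonSubsampling.statOn K Z N muHat n 0 ω - μ) /
              PoissonSubsampling.statOn K Z N sigmaHat n 0 ω) ≤
          PoissonSubsampling.subsamplingQuantile K Z N muHat sigmaHat τ n (c n) (1 - t) ω})
        atTop (𝓝 (1 - t)) ∧
      Tendsto (fun n : ℕ => (P₁.prod P₂).real {ω | μ ∈ Set.Ici
          (PoissonSubsampling.statOn K Z N muHat n 0 ω -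
            PoissonSubsampling.statOn K Z N sigmaHat n 0 ω *
              (τ (PoissonSubsampling.countOn K N n 0 ω))⁻¹ *
              PoissonSubsampling.subsamplingQuantile K Z N muHat sigmaHat τ n (c n) (1 - t) ω)})
        atTop (𝓝 (1 - t))) := by
  set P := P₁.prod P₂
  have hKpos : 0 < volume.real K := ENNReal.toReal_pos hK_pos.ne' hK_bdd.measure_lt_top.ne
  obtain ⟨M, hM⟩ := PoissonSubsampling.exists_window hK_bdd
  let D : ℕ → Set (EuclideanSpace ℝ (Fin d)) := fun n => Metric.closedBall 0 (n * M)
  have hD : ∀ n, MeasurableSet (D n) := fun n => Metric.isClosed_closedBall.measurableSet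
  have hDfin : ∀ n, volume (D n) ≠ ∞ := fun n => Metric.isBounded_closedBall.measure_lt_top.ne
  have hD0 : ∀ n : ℕ, PoissonSubsampling.region K n 0 ⊆ D n := fun n => (hM n (c n) (hc_mem n)).1
  have hDy : ∀ n : ℕ, ∀ y ∈ (n : ℝ) • K, PoissonSubsampling.region K (c n * n) y ⊆ D n :=
    fun n => (hM n (c n) (hc_mem n)).2
  have hs := PoissonSubsampling.tendsto_block_scale hc_diam
  have hA : ∀ n : ℕ, MeasurableSet ((n : ℝ) • K) := fun n => by
    simpa [PoissonSubsampling.region] using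
      PoissonSubsampling.measurableSet_region hK_meas (n : ℝ) 0
  have hAfin : ∀ n : ℕ, volume ((n : ℝ) • K) ≠ ∞ := fun n =>
    (hK_bdd.smul₀ (n : ℝ)).measure_lt_top.ne
  have hloc : ∀ n : ℕ, Measurable (PoissonSubsampling.localData K Z N (c n * n) (D n)) := fun n =>
    PoissonSubsampling.measurable_localData hK_meas hZ_meas hN.measurable (c n * n) (hD n)
  have hest := fun n : ℕ => PoissonSubsampling.ae_subsamplingDist_eq hK_meas (P₁ := P₁) hZ_meas hN
    hmu_meas hsigma_meas τ (hD n) (hDfin n) (hD0 n) (hDy n)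
  have hmono : ∀ n : ℕ, ∀ᵐ ω ∂P, Monotone (fun x =>
      PoissonSubsampling.subsamplingDist K Z N muHat sigmaHat τ n (c n) x ω) ∧
      ∀ x, 0 ≤ PoissonSubsampling.subsamplingDist K Z N muHat sigmaHat τ n (c n) x ω ∧
        PoissonSubsampling.subsamplingDist K Z N muHat sigmaHat τ n (c n) x ω ≤ 1 := by
    intro n
    filter_upwards [hest n] with ω hω
    simp only [hω]
    exact PoissonSubsampling.monotone_inv_mul_measureReal_inter _
      (ne_top_of_le_ne_top (hAfin n) (measure_mono
        (PoissonSubsampling.blockLocations_subset _ _))) _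
  have hcons : ∀ x : ℝ, ContinuousAt (cdf J) x → TendstoInMeasure P
      (fun (n : ℕ) ω => PoissonSubsampling.subsamplingDist K Z N muHat sigmaHat τ n (c n) x ω)
      atTop (fun _ => cdf J x) := by
    intro x hx
    -- `T` is the statistic with estimated centre, `R` the one with the true centre `μ`.
    refine PoissonSubsampling.tendstoInMeasure_subsampling P volume hA hAfin
      (fun n => PoissonSubsampling.blockLocations_subset _ ((c n) • ((n : ℝ) • K)))
      (PoissonSubsampling.tendsto_volume_ratio_blockLocations hK_bdd hK_pos hK_front
        (fun n => (hc_mem n).1.le) hc_zero)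
      (T := fun n q => PoissonSubsampling.studentized muHat sigmaHat τ (c n * n)
        (muHat n (PoissonSubsampling.localData K Z N n (D n) (0, q.2)))
        (PoissonSubsampling.localData K Z N (c n * n) (D n) q))
      (R := fun n q => PoissonSubsampling.studentized muHat sigmaHat τ (c n * n) μ
        (PoissonSubsampling.localData K Z N (c n * n) (D n) q))
      (fun n => ?_) (fun n => ?_) (monotone_cdf J) hx ?_ ?_
      (Eventually.of_forall fun n => (hest n).mono fun ω hω => hω x)
    · have h0 : Measurable fun ω : Ω₁ × Ω₂ =>
          muHat n (PoissonSubsampling.localData K Z N n (D n) (0, ω)) :=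
        (hmu_meas n).comp (PoissonSubsampling.measurable_localData_right hK_meas hZ_meas
          hN.measurable n (hD n) 0)
      exact PoissonSubsampling.measurable_studentized hmu_meas hsigma_meas τ (c n * n)
        (h0.comp measurable_snd) (hloc n)
    · exact PoissonSubsampling.measurable_studentized hmu_meas hsigma_meas τ (c n * n)
        measurable_const (hloc n)
    · intro δ hδ ε hε
      exact PoissonSubsampling.eventually_measureReal_studentized_sub_le hK_meas hK_bdd hKpos
        hZ_meas hZ_stat hr hN hsigma_meas hsigma_nonneg ha hb hτab ha_ratio hV hW hW_zero hd
        hc_mem hc_zero hs hD hDfin hD0 hDy hδ hε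
    · intro x' hx' η hη
      exact PoissonSubsampling.tendsto_measureReal_abs_average_sub_cdf hd hK_meas hK_bdd hKpos
        hZ_meas hZ_stat hN hmu_meas hsigma_meas hJ hc_mem hc_zero hs hmix hD hDfin hDy hx' hη
  refine ⟨hcons, PoissonSubsampling.tendstoInMeasure_iSup_abs_sub hmono hcons, ?_⟩
  intro t ht0 ht1 hlo hhi
  have hJn := PoissonSubsampling.tendstoInDistribution_natCast hJ
  have hfirst := PoissonSubsampling.tendsto_measureReal_le_quantile hmono hcons hJn
    (show 0 < 1 - t by linarith) (by linarith) hlo hhi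
  refine ⟨hfirst, ?_, ?_⟩
  -- The rate at the mean number of points.
  · have hsub := PoissonSubsampling.tendstoInMeasure_rate_sub hℓ hτ
      (PoissonSubsampling.tendsto_mean_count hd hKpos hr)
      (k := fun (n : ℕ) ω => (PoissonSubsampling.countOn K N n 0 ω : ℝ))
      (fun δ hδ => PoissonSubsampling.tendsto_measureReal_countOn_sub hd hK_meas hK_bdd hKpos P₁
        hr hN hδ) hJn
    refine PoissonSubsampling.tendsto_measureReal_le_quantile hmono hcons
      (T := fun n ω => τ ((r : ℝ) * volume.real ((n : ℝ) • K)) *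
        ((PoissonSubsampling.statOn K Z N muHat n 0 ω - μ) /
          PoissonSubsampling.statOn K Z N sigmaHat n 0 ω))
      (tendstoInDistribution_of_tendstoInMeasure_sub _ _ hJn hsub fun n => ?_)
      (show 0 < 1 - t by linarith) (by linarith) hlo hhi
    have h1 : AEMeasurable (PoissonSubsampling.statOn K Z N muHat n 0) P :=
      PoissonSubsampling.aemeasurable_comp_markedData hK_meas hK_bdd hZ_meas hN n (hmu_meas n)
    have h2 : AEMeasurable (PoissonSubsampling.statOn K Z N sigmaHat n 0) P :=
      PoissonSubsampling.aemeasurable_comp_markedData hK_meas hK_bdd hZ_meas hN n (hsigma_meas n)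
    exact ((h1.sub_const μ).div h2).const_mul _
  -- The confidence interval: the two events agree unless there are no points or `σ̂ = 0`.
  · refine PoissonSubsampling.tendsto_measureReal_of_iff hfirst
      (PoissonSubsampling.tendsto_measureReal_degenerate (P₁ := P₁) hd hK_meas hK_bdd hKpos hr hN
        hW hW_zero) fun n ω hω => ?_
    have hk : 0 < PoissonSubsampling.countOn K N n 0 ω :=
      Nat.pos_of_ne_zero fun h => hω (Or.inl h)
    have hσ : 0 < PoissonSubsampling.statOn K Z N sigmaHat n 0 ω :=
      lt_of_le_of_ne (hsigma_nonneg _ _) fun h => hω (Or.inr h.symm)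
    have hτ0 : 0 < τ (PoissonSubsampling.countOn K N n 0 ω) := by
      rw [hτab _ hk]; exact div_pos (ha _ hk) (hb _ hk)
    change τ _ * ((_ - μ) / _) ≤ sInf _ ↔ _ - _ * _⁻¹ * sInf _ ≤ μ
    rw [← mul_div_assoc, div_le_iff₀ hσ, ← le_div_iff₀' hτ0, sub_le_comm, div_eq_mul_inv]
    ring_nf
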